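/- **Setting.** Let $S$ be an associative unital ring and let $\otimes=\otimes_S$. Let $A=\bigoplus_{n\ge 0}A^n$ be a graded $S$-ring which is connected ($A^0=S$) and strongly graded ($A^mA^n=A^{m+n}$), with $A^1$ projective as a left $S$-module. Let $T=T_A=T_S(A^1)$ be the tensor ring of the $S$-bimodule $A^1$, $\pi_A:T\to A$ the canonical map and $I_A=\ker\pi_A$. Let $R\subseteq T$ be a graded $S$-subbimodule which generates $I_A$ as a two-sided ideal and which is projective as a left $S$-module; so $A\cong A(R):=T/\langle R\rangle$. Write $T^{\le n}=\bigoplus_{i\le n}T^i$. For an $S$-subbimodule $P\subseteq T$ let $R_P$ be the graded bimodule spanned by the highest degree homogeneous components of the elements of $P$; let $U(P)=T/\langle P\rangle$ with the filtration $U(P)^{\le n}$ induced by $T^{\le n}$. If $R\subseteq R_P$, then $U(P)$ is a *PBW-deformation* of $A$ if the canonical graded ring map $A(R)\to\operatorname{gr}U(P)$, $x+\langle R\rangle\mapsto (x+\langle P\rangle)+U(P)^{\le n-1}$ for $x\in T^n$, is an isomorphism. Put $P_n=\sum_{i+j+k=n}T^{\le i}(P\cap T^{\le j})T^{\le k}$;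 the *Jacobi condition* $(\mathcal J_n)$ is $P_{n+1}\cap T^{\le n}\subseteq P_n$. The *complexity* of a graded object $V=\bigoplus_n V^n$ is $c_V=-1$ if $V=0$ and $c_V=\sup\{n-1\mid V^n\ne0\}\in\mathbb Z\cup\{\infty\}$ otherwise. The *homological complexity* $c(A)$ is the complexity of $\operatorname{Tor}_3^A(S,S)$ with its internal grading. A graded bimodule $Q\subseteq T$ is a *bimodule of relations* for $A$ if $I_A=Q\oplus(A^1I_A+I_AA^1)$. Consider graded projective resolutions of the left $A$-module $S$ $$\cdots\to A\otimes V_3\xrightarrow{d_3}A\otimes V_2\xrightarrow{d_2}A\otimes A^1\xrightarrow{d_1}A\to S\to0\qquad(*)$$ with $d_1$ given by multiplication, $V_n$ graded projective left $S$-modules and $V_n^0=V_n^1=0$ for $n\ge2$. For $P$ as above, homogenize $a=\sum_{i\le d}a_i$ ($a_i\in T^i$, $a_d\ne 0$) to $a^*=\sum a_iz^{d-i}\in T[z]$ (and $0^*=0$), and let $D=T[z]/\langle P^*\rangle$, where $P^*=\{a^*\mid a\in P\}$. If $\langle R\rangle=\langle R_P\rangle$, there is a projection $\pi:D\to D/zD=A$.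 Choose graded $D$-linear maps $\partial_1:D\otimes A^1\to D$ and $\partial_2:D\otimes V_2\to D\otimes A^1$ lifting $d_1,d_2$ along $\pi$, and a graded $D$-linear map $f_2:D\otimes V_2\to D(-1)$ with $\partial_1\partial_2=-zf_2$. The complex ${}^1M_*$ is $M_2\xrightarrow{\delta_2}M_1\xrightarrow{\delta_1}M_0\to0$ with $M_2=(D\otimes V_2)\oplus(D\otimes A^1)(-1)$, $M_1=(D\otimes A^1)\oplus D(-1)$, $M_0=D$, $\delta_2(x,y)=(\partial_2x-zy,\ \partial_1y+f_2x)$ and $\delta_1(x,y)=\partial_1x+zy$. **Theorem.** (0) If some bimodule of relations for $A$ is projective as a left $S$-module, then there is a resolution $(*)$ with $c_{V_3}=c(A)$. (1) Let $P\subseteq T$ be an $S$-subbimodule with $R\subseteq R_P$, and fix any resolution $(*)$ with $c_{V_3}=c(A)$. If $\langle R\rangle=\langle R_P\rangle$, then maps $\partial_1,\partial_2,f_2$ as above exist. For every choice of them, $U(P)$ is a PBW-deformation of $A$ if and only if $\langle R\rangle=\langle R_P\rangle$, $H_1({}^1M_*)=0$, and either $c(A)=-1$ or $P$ satisfies $(\mathcal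 J_n)$ for all integers $n$ with $1\le n\le c(A)$. (2) Assume that $R$ is a bimodule of relations for $A$, and let $P=\alpha(R)$, where $\alpha:R\to T$ is a map of $S$-bimodules with $\alpha(r)-r\in T^{\le n-1}$ for all $r\in R^n$ and all $n\geq 0$ (with $T^{\le -1}=0$). Then $U(P)$ is a PBW-deformation of $A$ if and only if either $c(A)=-1$ or $P$ satisfies $(\mathcal J_n)$ for all integers $n$ with $1\le n\le c(A)$. -/

import Mathlib

open scoped TensorProduct Polynomial DirectSum

universe u v w x

noncomputable section

namespace PBW

/-! ## Rings over a (noncommutative) base ring `S`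

An `S`-ring is a ring `B` together with a ring homomorphism `S → B`.  It is encoded by the
instances `[Module S B] [IsScalarTower S B B]`; the ring homomorphism is `s ↦ s • 1`, the left
action is `s • b = (s • 1) * b` and the right action is `b * (s • 1)`. -/

/-- A subset of an `S`-ring is a left `S`-submodule `X`; it is a subbimodule if it is moreover
stable under right multiplication by `S`. -/
def IsSubbimodule {S : Type u} {B : Type v} [Ring S] [Ring B] [Module S B]
    (X : Submodule S B) : Prop :=
  ∀ x ∈ X, ∀ s : S, x * (s • (1 : B)) ∈ X

/-- Homomorphisms of `S`-rings. -/
structure SRingHom (S : Type u) (B : Type v) (C : Type w) [Ring S] [Ring B] [Ring C]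
    [Module S B] [Module S C] extends B →+* C where
  map_smul' : ∀ (s : S) (b : B), toFun (s • b) = s • toFun b

/-! ## The tensor product `B ⊗_S V` over a noncommutative ring -/

section Tensor

variable (S : Type u) (B : Type v) (V : Type w) [Ring S] [Ring B] [Module S B]
  [AddCommGroup V] [Module S V]

/-- The relations `b s ⊗ v = b ⊗ s v`. -/
def balance : Submodule B (B ⊗[ℤ] V) :=
  Submodule.span B {x | ∃ (b : B) (s : S) (v : V),
    x = (b * (s • (1 : B))) ⊗ₜ[ℤ] v - b ⊗ₜ[ℤ] (s • v)}

/-- The tensor product `B ⊗_S V` of an `S`-ring `B` and a left `S`-module `V`, as a left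
`B`-module. -/
abbrev BTensor : Type (max v w) := (B ⊗[ℤ] V) ⧸ balance S B V

variable {S B V}

/-- The pure tensor `b ⊗ v`. -/
def tmul (b : B) (v : V) : BTensor S B V := (balance S B V).mkQ (b ⊗ₜ[ℤ] v)

/-- The degree `n` part of the tensor product of graded objects:
the sum of all `B^i ⊗ V^j` with `i + j = n`. -/
def tensorGrade (ℬ : ℕ → Submodule S B) (𝒱 : ℕ → Submodule S V) (n : ℕ) :
    AddSubgroup (BTensor S B V) :=
  AddSubgroup.closure {x | ∃ (i j : ℕ) (b : B) (v : V),
    i + j = n ∧ b ∈ ℬ i ∧ v ∈ 𝒱 j ∧ x = tmul b v}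

/-- The `B`-linear map `B ⊗_S V → M`, `b ⊗ v ↦ b f(v)`, induced by an `S`-linear `f : V → M`. -/
def tensorLift {M : Type*} [AddCommGroup M] [Module B M] [Module S M] [IsScalarTower S B M]
    (f : V →ₗ[S] M) : BTensor S B V →ₗ[B] M :=
  (balance S B V).liftQ
    (TensorProduct.AlgebraTensorModule.lift
      ({ toFun := fun b => b • f.toAddMonoidHom.toIntLinearMap
         map_add' := fun a b => add_smul a b _
         map_smul' := fun a b => mul_smul a b _ } : B →ₗ[B] (V →ₗ[ℤ] M)))
    (by
      refine Submodule.span_le.2 ?_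
      rintro _ ⟨b, s, v, rfl⟩
      simp [mul_smul])

/-- The map `π ⊗ V : B ⊗_S V → C ⊗_S V` induced by a homomorphism `π : B → C` of `S`-rings. -/
def tensorMap {C : Type*} [Ring C] [Module S C] (π : SRingHom S B C) :
    BTensor S B V →+ BTensor S C V :=
  QuotientAddGroup.map (balance S B V).toAddSubgroup (balance S C V).toAddSubgroup
    (TensorProduct.map π.toRingHom.toAddMonoidHom.toIntLinearMap
      (LinearMap.id : V →ₗ[ℤ] V)).toAddMonoidHom
    (by
      intro x hx
      change x ∈ balance S B V at hx
      change (TensorProduct.map π.toRingHom.toAddMonoidHom.toIntLinearMap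
        (LinearMap.id : V →ₗ[ℤ] V)) x ∈ balance S C V
      refine Submodule.span_induction (p := fun x _ => (TensorProduct.map
        π.toRingHom.toAddMonoidHom.toIntLinearMap (LinearMap.id : V →ₗ[ℤ] V)) x ∈ balance S C V)
        ?_ ?_ ?_ ?_ hx
      · rintro _ ⟨b, s, v, rfl⟩
        refine Submodule.subset_span ⟨π.toRingHom b, s, v, ?_⟩
        have h1 : π.toRingHom (s • (1 : B)) = s • (1 : C) := by
          have := π.map_smul' s 1
          simpa using this
        simp [h1]
      · simp
      · intro x y _ _ hx hy
        rw [map_add]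
        exact add_mem hx hy
      · intro b x _ hx
        have key : ∀ y : B ⊗[ℤ] V, (TensorProduct.map
            π.toRingHom.toAddMonoidHom.toIntLinearMap (LinearMap.id : V →ₗ[ℤ] V)) (b • y) =
            π.toRingHom b • (TensorProduct.map
            π.toRingHom.toAddMonoidHom.toIntLinearMap (LinearMap.id : V →ₗ[ℤ] V)) y := by
          intro y
          induction y with
          | zero => simp
          | tmul c v => simp [TensorProduct.smul_tmul']
          | add y z hy hz => rw [smul_add, map_add, hy, hz, map_add, smul_add]
        rw [key]
        exact Submodule.smul_mem _ _ hx)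

theorem tensorMap_tmul {C : Type*} [Ring C] [Module S C] (π : SRingHom S B C) (b : B) (v : V) :
    tensorMap π (tmul (S := S) b v) = tmul (π.toRingHom b) v := rfl

theorem tensorLift_tmul {M : Type*} [AddCommGroup M] [Module B M] [Module S M]
    [IsScalarTower S B M] (f : V →ₗ[S] M) (b : B) (v : V) :
    tensorLift f (tmul (S := S) b v) = b • f v := rfl

end Tensor

/-! ## The tensor ring of a bimodule -/

section TensorRing

variable (S : Type u) (V : Type v) [Ring S] [AddCommGroup V] [Module S V] [Module Sᵐᵒᵖ V]

/-- The defining relations of the tensor ring, on the free ring on the symbols `s ∈ S` and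
`v ∈ V`. -/
inductive TensorRing.Rel : FreeAlgebra ℤ (S ⊕ V) → FreeAlgebra ℤ (S ⊕ V) → Prop
  | one : TensorRing.Rel (FreeAlgebra.ι ℤ (Sum.inl 1)) 1
  | add_scalar (s t : S) : TensorRing.Rel (FreeAlgebra.ι ℤ (Sum.inl (s + t)))
      (FreeAlgebra.ι ℤ (Sum.inl s) + FreeAlgebra.ι ℤ (Sum.inl t))
  | mul_scalar (s t : S) : TensorRing.Rel (FreeAlgebra.ι ℤ (Sum.inl (s * t)))
      (FreeAlgebra.ι ℤ (Sum.inl s) * FreeAlgebra.ι ℤ (Sum.inl t))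
  | add_vec (x y : V) : TensorRing.Rel (FreeAlgebra.ι ℤ (Sum.inr (x + y)))
      (FreeAlgebra.ι ℤ (Sum.inr x) + FreeAlgebra.ι ℤ (Sum.inr y))
  | left (s : S) (x : V) : TensorRing.Rel (FreeAlgebra.ι ℤ (Sum.inr (s • x)))
      (FreeAlgebra.ι ℤ (Sum.inl s) * FreeAlgebra.ι ℤ (Sum.inr x))
  | right (s : S) (x : V) : TensorRing.Rel (FreeAlgebra.ι ℤ (Sum.inr (MulOpposite.op s • x)))
      (FreeAlgebra.ι ℤ (Sum.inr x) * FreeAlgebra.ι ℤ (Sum.inl s))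

/-- The tensor ring `T_S(V)` of the `S`-bimodule `V`: the universal `S`-ring with a bimodule map
from `V`. -/
def TensorRing : Type (max u v) := RingQuot (TensorRing.Rel S V)

namespace TensorRing

instance : Ring (TensorRing S V) := inferInstanceAs (Ring (RingQuot (TensorRing.Rel S V)))

/-- The canonical ring homomorphism `S → T_S(V)`. -/
def scalar : S →+* TensorRing S V where
  toFun s := RingQuot.mkRingHom (Rel S V) (FreeAlgebra.ι ℤ (Sum.inl s))
  map_one' := (RingQuot.mkRingHom_rel Rel.one).trans (map_one _)
  map_mul' s t := (RingQuot.mkRingHom_rel (Rel.mul_scalar s t)).trans (map_mul _ _ _)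
  map_add' s t := (RingQuot.mkRingHom_rel (Rel.add_scalar s t)).trans (map_add _ _ _)
  map_zero' := by
    have h := (RingQuot.mkRingHom_rel (Rel.add_scalar (V := V) (0 : S) 0)).trans (map_add _ _ _)
    rw [add_zero] at h
    exact left_eq_add.mp h

/-- The canonical map `V → T_S(V)`. -/
def vec : V →+ TensorRing S V :=
  AddMonoidHom.mk' (fun x => RingQuot.mkRingHom (Rel S V) (FreeAlgebra.ι ℤ (Sum.inr x)))
    (fun x y => (RingQuot.mkRingHom_rel (Rel.add_vec x y)).trans (map_add _ _ _))

instance : Module S (TensorRing S V) := Module.compHom _ (scalar S V)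

theorem smul_def (s : S) (x : TensorRing S V) : s • x = scalar S V s * x := rfl

instance : IsScalarTower S (TensorRing S V) (TensorRing S V) :=
  ⟨fun s x y => by simp only [smul_def, smul_eq_mul, mul_assoc]⟩

theorem vec_smul (s : S) (x : V) : vec S V (s • x) = s • vec S V x :=
  (RingQuot.mkRingHom_rel (Rel.left s x)).trans (map_mul _ _ _)

theorem vec_op_smul (s : S) (x : V) :
    vec S V (MulOpposite.op s • x) = vec S V x * (s • (1 : TensorRing S V)) := by
  rw [smul_def, mul_one]
  exact (RingQuot.mkRingHom_rel (Rel.right s x)).trans (map_mul _ _ _)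

variable {S V}

/-- The universal property of the tensor ring. -/
def lift {B : Type*} [Ring B] (f : S →+* B) (g : V →+ B)
    (hl : ∀ s x, g (s • x) = f s * g x) (hr : ∀ s x, g (MulOpposite.op s • x) = g x * f s) :
    TensorRing S V →+* B :=
  RingQuot.lift ⟨(FreeAlgebra.lift ℤ (Sum.elim f g)).toRingHom, by
    intro x y h
    cases h <;> simp [hl, hr]⟩

theorem lift_scalar {B : Type*} [Ring B] (f : S →+* B) (g : V →+ B)
    (hl : ∀ s x, g (s • x) = f s * g x) (hr : ∀ s x, g (MulOpposite.op s • x) = g x * f s)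
    (s : S) : lift f g hl hr (scalar S V s) = f s := by
  refine (RingQuot.lift_mkRingHom_apply _ _ _).trans ?_
  simp

theorem lift_vec {B : Type*} [Ring B] (f : S →+* B) (g : V →+ B)
    (hl : ∀ s x, g (s • x) = f s * g x) (hr : ∀ s x, g (MulOpposite.op s • x) = g x * f s)
    (x : V) : lift f g hl hr (vec S V x) = g x := by
  refine (RingQuot.lift_mkRingHom_apply _ _ _).trans ?_
  simp

theorem hom_ext {B : Type*} [Ring B] {f g : TensorRing S V →+* B}
    (hs : ∀ s, f (scalar S V s) = g (scalar S V s)) (hv : ∀ x, f (vec S V x) = g (vec S V x)) :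
    f = g := by
  refine RingQuot.ringQuot_ext _ _ ?_
  have key : ((f.comp (RingQuot.mkRingHom (Rel S V))).toIntAlgHom) =
      ((g.comp (RingQuot.mkRingHom (Rel S V))).toIntAlgHom) := by
    refine FreeAlgebra.hom_ext ?_
    funext x
    rcases x with s | x
    · exact hs s
    · exact hv x
  ext x
  exact DFunLike.congr_fun key x

variable (S V)

/-- The degree `n` part of `T_S(V)`: the span of all products `v₁ ⋯ vₙ`. -/
def grade (n : ℕ) : Submodule S (TensorRing S V) :=
  Submodule.span S {x | ∃ l : List V, l.length = n ∧ x = (l.map (vec S V)).prod}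

variable {S V}

theorem scalar_mem (s : S) : scalar S V s ∈ grade S V 0 := by
  have h : s • (1 : TensorRing S V) ∈ grade S V 0 :=
    Submodule.smul_mem _ _ (Submodule.subset_span ⟨[], rfl, rfl⟩)
  rwa [smul_def, mul_one] at h

theorem vec_mem (x : V) : vec S V x ∈ grade S V 1 :=
  Submodule.subset_span ⟨[x], rfl, by simp⟩

theorem mul_scalar_mem {n : ℕ} {x : TensorRing S V} (hx : x ∈ grade S V n) (s : S) :
    x * scalar S V s ∈ grade S V n := by
  refine Submodule.span_induction (p := fun x _ => x * scalar S V s ∈ grade S V n) ?_ ?_ ?_ ?_ hx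
  · rintro _ ⟨l, rfl, rfl⟩
    rcases List.eq_nil_or_concat l with rfl | ⟨l, v, rfl⟩
    · simpa using scalar_mem s
    · refine Submodule.subset_span ⟨l ++ [MulOpposite.op s • v], by simp, ?_⟩
      simp [vec_op_smul, smul_def, mul_assoc]
  · simp
  · intro x y _ _ hx hy
    rw [add_mul]
    exact add_mem hx hy
  · intro t x _ hx
    rw [smul_mul_assoc]
    exact Submodule.smul_mem _ _ hx

instance : SetLike.GradedMonoid (grade S V) where
  one_mem := Submodule.subset_span ⟨[], rfl, rfl⟩
  mul_mem := by
    intro i j x y hx hy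
    refine Submodule.span_induction (p := fun y _ => ∀ x, x ∈ grade S V i →
      x * y ∈ grade S V (i + j)) ?_ ?_ ?_ ?_ hy x hx
    · rintro _ ⟨l, rfl, rfl⟩ x hx
      refine Submodule.span_induction
        (p := fun x _ => x * (l.map (vec S V)).prod ∈ grade S V (i + l.length)) ?_ ?_ ?_ ?_ hx
      · rintro _ ⟨k, rfl, rfl⟩
        exact Submodule.subset_span ⟨k ++ l, by simp, by simp⟩
      · simp
      · intro x y _ _ hx hy
        rw [add_mul]
        exact add_mem hx hy
      · intro t x _ hx
        rw [smul_mul_assoc]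
        exact Submodule.smul_mem _ _ hx
    · simp
    · intro y z _ _ hy hz x hx
      rw [mul_add]
      exact add_mem (hy x hx) (hz x hx)
    · intro t y _ hy x hx
      rw [smul_def, ← mul_assoc]
      exact hy _ (mul_scalar_mem hx t)

variable (S V)

/-- The splitting of `T_S(V)` into its homogeneous components. -/
def split : TensorRing S V →+* ⨁ n, grade S V n :=
  lift
    { toFun := fun s => DirectSum.of (fun n => grade S V n) 0 ⟨scalar S V s, scalar_mem s⟩
      map_one' := by
        rw [DirectSum.one_def]
        congr 1
        exact Subtype.ext (map_one _)
      map_mul' := fun s t => by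
        rw [DirectSum.of_mul_of]
        exact DirectSum.of_eq_of_gradedMonoid_eq
          (Sigma.subtype_ext (zero_add 0).symm (map_mul _ _ _))
      map_zero' := by
        rw [← map_zero (DirectSum.of (fun n => grade S V n) 0)]
        congr 1
        exact Subtype.ext (map_zero _)
      map_add' := fun s t => by
        rw [← map_add]
        congr 1
        exact Subtype.ext (map_add _ _ _) }
    (AddMonoidHom.mk' (fun x => DirectSum.of (fun n => grade S V n) 1 ⟨vec S V x, vec_mem x⟩)
      (fun x y => by
        rw [← map_add]
        congr 1
        exact Subtype.ext (map_add _ _ _)))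
    (fun s x => by
      refine Eq.trans ?_ (DirectSum.of_mul_of _ _).symm
      exact DirectSum.of_eq_of_gradedMonoid_eq
        (Sigma.subtype_ext (zero_add 1).symm ((vec_smul S V s x).trans (smul_def S V _ _))))
    (fun s x => by
      refine Eq.trans ?_ (DirectSum.of_mul_of _ _).symm
      refine DirectSum.of_eq_of_gradedMonoid_eq
        (Sigma.subtype_ext (add_zero 1).symm ((vec_op_smul S V s x).trans ?_))
      rw [smul_def, mul_one]
      rfl)

variable {S V}

theorem split_scalar (s : S) : split S V (scalar S V s) =
    DirectSum.of (fun n => grade S V n) 0 ⟨scalar S V s, scalar_mem s⟩ :=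
  lift_scalar _ _ _ _ s

theorem split_vec (x : V) : split S V (vec S V x) =
    DirectSum.of (fun n => grade S V n) 1 ⟨vec S V x, vec_mem x⟩ :=
  lift_vec _ _ _ _ x

theorem split_of_mem {n : ℕ} {x : TensorRing S V} (hx : x ∈ grade S V n) :
    split S V x = DirectSum.of (fun n => grade S V n) n ⟨x, hx⟩ := by
  refine Submodule.span_induction (p := fun x hx => split S V x =
    DirectSum.of (fun n => grade S V n) n ⟨x, hx⟩) ?_ ?_ ?_ ?_ hx
  · rintro _ ⟨l, rfl, rfl⟩
    clear hx
    induction l with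
    | nil =>
      simp only [List.map_nil, List.prod_nil, map_one, DirectSum.one_def]
      rfl
    | cons v l ih =>
      simp only [List.map_cons, List.prod_cons, map_mul]
      rw [ih, split_vec, DirectSum.of_mul_of]
      exact DirectSum.of_eq_of_gradedMonoid_eq (Sigma.subtype_ext (add_comm _ _) rfl)
  · rw [map_zero, ← map_zero (DirectSum.of (fun n => grade S V n) n)]
    rfl
  · intro x y hx hy h1 h2
    rw [map_add, h1, h2, ← map_add]
    rfl
  · intro s x hx h
    have h2 : split S V (s • x) = split S V (scalar S V s) * split S V x := map_mul _ _ _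
    rw [h2, h, split_scalar, DirectSum.of_mul_of]
    exact DirectSum.of_eq_of_gradedMonoid_eq (Sigma.subtype_ext (zero_add _) rfl)

instance : GradedRing (grade S V) where
  decompose' := split S V
  left_inv := by
    have h : (DirectSum.coeRingHom (grade S V)).comp (split S V) = RingHom.id _ := by
      refine hom_ext ?_ ?_
      · intro s
        rw [RingHom.comp_apply, split_scalar, DirectSum.coeRingHom_of]
        rfl
      · intro x
        rw [RingHom.comp_apply, split_vec, DirectSum.coeRingHom_of]
        rfl
    exact DFunLike.congr_fun h
  right_inv := by
    intro x
    induction x using DirectSum.induction_on with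
    | zero => simp
    | of n x => rw [DirectSum.coeAddMonoidHom_of, split_of_mem x.2]
    | add x y hx hy => rw [map_add, map_add, hx, hy]

end TensorRing

end TensorRing

/-! ## Graded `S`-rings, deformations and Jacobi conditions -/

section Graded

variable {S : Type u} {T : Type v} [Ring S] [Ring T] [Module S T] [IsScalarTower S T T]

/-- A graded `S`-ring is connected if `T^0 = S`. -/
def IsConnected (𝒯 : ℕ → Submodule S T) : Prop :=
  Function.Injective (fun s : S => s • (1 : T)) ∧ ∀ t ∈ 𝒯 0, ∃ s : S, s • (1 : T) = t

/-- A graded `S`-ring is strongly graded if `T^{m+n} = T^m T^n`. -/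
def IsStronglyGraded (𝒯 : ℕ → Submodule S T) : Prop :=
  ∀ m n, ∀ x ∈ 𝒯 (m + n),
    x ∈ AddSubgroup.closure {y | ∃ a ∈ 𝒯 m, ∃ b ∈ 𝒯 n, y = a * b}

/-- The standard filtration `T^{≤ n}`. -/
def filt (𝒯 : ℕ → Submodule S T) (n : ℕ) : Submodule S T := ⨆ i : ℕ, ⨆ _ : i ≤ n, 𝒯 i

/-- `T^{≤ n-1}`, which is `0` for `n = 0`. -/
def filtLT (𝒯 : ℕ → Submodule S T) (n : ℕ) : Submodule S T := ⨆ i : ℕ, ⨆ _ : i < n, 𝒯 i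

section LeadingTerms

variable (𝒯 : ℕ → Submodule S T) [GradedRing 𝒯]

/-- The degree of the highest nonzero homogeneous component (`0` for the zero element). -/
def topDegree (a : T) : ℕ := sSup {i : ℕ | GradedRing.proj 𝒯 i a ≠ 0}

/-- The highest degree homogeneous component `LH(a)`; `LH(0) = 0`. -/
def LH (a : T) : T := GradedRing.proj 𝒯 (topDegree 𝒯 a) a

/-- The graded bimodule `R_P` spanned by the leading components of the elements of `P`. -/
def leading (P : Submodule S T) : Submodule S T := Submodule.span S (LH 𝒯 '' P)

/-- The external homogenization `a* = ∑ aᵢ z^{d-i} ∈ T[z]` of an element of degree `d`. -/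
def homogenization (a : T) : T[X] :=
  ∑ i ∈ Finset.range (topDegree 𝒯 a + 1),
    Polynomial.monomial (topDegree 𝒯 a - i) (GradedRing.proj 𝒯 i a)

/-- `X` is a graded submodule of `T`. -/
def IsGradedSub (X : Submodule S T) : Prop := ∀ x ∈ X, ∀ n, GradedRing.proj 𝒯 n x ∈ X

end LeadingTerms

/-- The two-sided ideal `⟨X⟩`. -/
abbrev idealOf (X : Set T) : TwoSidedIdeal T := TwoSidedIdeal.span X

/-- The quotient ring `T / ⟨X⟩`.  It is `U(P)` for `X = P`, it is `A(R)` for `X = R`. -/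
abbrev QuotRing (X : Set T) : Type v := T ⧸ TwoSidedIdeal.asIdeal (idealOf X)

/-- The class of `t` in `T / ⟨X⟩`. -/
abbrev toQuot (X : Set T) : T →+* QuotRing X := Ideal.Quotient.mk _

/-- The class map `T → T / ⟨X⟩` as an `S`-linear map. -/
def toQuotₗ (X : Set T) : T →ₗ[S] QuotRing X :=
  ((TwoSidedIdeal.asIdeal (idealOf X)).mkQ).restrictScalars S

section Deformation

variable (𝒯 : ℕ → Submodule S T) (P R : Submodule S T)

/-- The homogeneous component `A(R)^n` of `A(R) = T / ⟨R⟩`. -/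
def homogPiece (n : ℕ) : Submodule S (QuotRing (R : Set T)) := (𝒯 n).map (toQuotₗ (R : Set T))

/-- `U(P)^{≤ n}`, the image of `T^{≤ n}` in `U(P)`. -/
def deformFilt (n : ℕ) : Submodule S (QuotRing (P : Set T)) := (filt 𝒯 n).map (toQuotₗ (P : Set T))

/-- `U(P)^{≤ n-1}`, which is `0` for `n = 0`. -/
def deformFiltLT (n : ℕ) : Submodule S (QuotRing (P : Set T)) :=
  (filtLT 𝒯 n).map (toQuotₗ (P : Set T))

/-- `gr^n U(P) = U(P)^{≤ n} / U(P)^{≤ n-1}`. -/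
abbrev grDeform (n : ℕ) : Type v :=
  deformFilt 𝒯 P n ⧸ (deformFiltLT 𝒯 P n).submoduleOf (deformFilt 𝒯 P n)

/-- The map `φ^n : T^n → gr^n U(P)`, sending `x` to the class of `x + ⟨P⟩`. -/
def toGr (n : ℕ) (x : 𝒯 n) : grDeform 𝒯 P n :=
  Submodule.Quotient.mk ⟨toQuotₗ (P : Set T) x.1,
    Submodule.mem_map_of_mem (le_iSup₂_of_le (f := fun i (_ : i ≤ n) => 𝒯 i) n le_rfl le_rfl x.2)⟩

/-- `U(P)` is a PBW-deformation of `A(R)`: the canonical map `Φ_{P,R} : A(R) → gr U(P)`, whose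
component of degree `n` sends `x + ⟨R⟩` to the class of `x + ⟨P⟩` for `x ∈ T^n`, is (well defined
and) bijective in every degree.  Since `Φ_{P,R}` is determined on classes of elements of `T`, it is
then automatically multiplicative and compatible with both actions of `S`, so that it is an
isomorphism of graded `S`-rings. -/
def IsPBWDeformation : Prop :=
  ∀ n : ℕ, ∃ Φ : homogPiece 𝒯 R n ≃ₗ[S] grDeform 𝒯 P n,
    ∀ x : 𝒯 n, Φ ⟨toQuotₗ (R : Set T) x.1, Submodule.mem_map_of_mem x.2⟩ = toGr 𝒯 P n x

/-- `P_n = ∑_{i+j+k=n} T^{≤ i} P^{≤ j} T^{≤ k}` where `P^{≤ j} = P ∩ T^{≤ j}`. -/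
def jacobiFilt (n : ℕ) : Submodule S T :=
  Submodule.span S {x | ∃ (i j k : ℕ) (a p b : T), i + j + k = n ∧ a ∈ filt 𝒯 i ∧
    p ∈ P ∧ p ∈ filt 𝒯 j ∧ b ∈ filt 𝒯 k ∧ x = a * p * b}

/-- The Jacobi condition `(J_n)`: `P_{n+1} ∩ T^{≤ n} ⊆ P_n`. -/
def Jacobi (n : ℕ) : Prop := jacobiFilt 𝒯 P (n + 1) ⊓ filt 𝒯 n ≤ jacobiFilt 𝒯 P n

/-- For an ideal `I`, the submodule `T^1 I + I T^1`. -/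
def decomposables (I : TwoSidedIdeal T) : Submodule S T :=
  Submodule.span S {x | ∃ t ∈ 𝒯 1, ∃ y ∈ I, x = t * y ∨ x = y * t}

/-- `R` is a bimodule of relations for `T / I`: a graded subbimodule with
`I = R ⊕ (T^1 I + I T^1)`. -/
def IsBimoduleOfRelations [GradedRing 𝒯] (I : TwoSidedIdeal T) : Prop :=
  IsSubbimodule R ∧ IsGradedSub 𝒯 R ∧ R ⊓ decomposables 𝒯 I = ⊥ ∧
    ((R ⊔ decomposables 𝒯 I : Submodule S T) : Set T) = I

/-- A map of filtered `S`-bimodules `α : R → T` (whose component of degree zero is, by convention,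
the inclusion of `R` into `T`): `α(r) - r ∈ T^{≤ n-1}` for `r ∈ R^n`. -/
structure FilteredMap where
  toFun : R →ₗ[S] T
  map_right : ∀ (r r' : R) (s : S), (r' : T) = r * (s • (1 : T)) →
    toFun r' = toFun r * (s • (1 : T))
  filtered : ∀ (n : ℕ) (r : R), (r : T) ∈ 𝒯 n → toFun r - r ∈ filtLT 𝒯 n

variable [GradedRing 𝒯]

/-- The set `P*` of homogenizations of elements of `P`. -/
def homogSet : Set T[X] := homogenization 𝒯 '' P

instance : IsScalarTower S T[X] T[X] :=
  ⟨fun s p q => by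
    have h : ∀ p : T[X], s • p = Polynomial.C (s • (1 : T)) * p := by
      intro p
      ext n
      simp
    rw [h, smul_eq_mul, smul_eq_mul, h, mul_assoc]⟩

/-- The central extension `D(P) = T[z] / ⟨P*⟩`. -/
abbrev CentralExt : Type v := QuotRing (homogSet 𝒯 P)

/-- The degree `n` component of `D(P)`, spanned by the classes of `t z^k` with `t ∈ T^i` and
`i + k = n`. -/
def centralGrade (n : ℕ) : Submodule S (CentralExt 𝒯 P) :=
  Submodule.span S {x | ∃ (i k : ℕ) (t : T), i + k = n ∧ t ∈ 𝒯 i ∧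
    x = toQuot (homogSet 𝒯 P) (Polynomial.monomial k t)}

/-- The central element `z` of `D(P)`. -/
def centralElt : CentralExt 𝒯 P := toQuot (homogSet 𝒯 P) Polynomial.X

end Deformation

end Graded

/-! ## Complexity and `Tor` -/

/-- The complexity of a graded object `V = (V^n)`: `-1` if `V = 0`, and
`sup {n - 1 | V^n ≠ 0}` (possibly `∞`) otherwise. -/
def complexity (V : ℕ → Type w) : EReal :=
  open Classical in
  if ∃ n, Nontrivial (V n) then sSup {x : EReal | ∃ n : ℕ, Nontrivial (V n) ∧ x = (n : EReal) - 1}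
  else -1

section Tor

/-- A graded `A`-module `F` with an `A`-linear map to some `A`-module `G`: the last map of a partial
resolution. -/
structure Stage (A : Type v) [Ring A] where
  F : Type v
  G : Type v
  [addF : AddCommGroup F]
  [addG : AddCommGroup G]
  [modF : Module A F]
  [modG : Module A G]
  grade : ℕ → AddSubgroup F
  d : F →ₗ[A] G

attribute [instance] Stage.addF Stage.addG Stage.modF Stage.modG

variable {S : Type u} {A : Type v} [Ring S] [Ring A] [Module S A] (𝒜 : ℕ → Submodule S A)

/-- The augmentation ideal `A^+`, spanned by the components of positive degree. -/
def augIdeal : Ideal A := Ideal.span {a | ∃ n : ℕ, 0 < n ∧ a ∈ 𝒜 n}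

/-- The submodule `A^+ M`, so that `S ⊗_A M = M / A^+ M`. -/
def augSmul (M : Type w) [AddCommGroup M] [Module A M] : Submodule A M :=
  Submodule.span A {x | ∃ a ∈ augIdeal 𝒜, ∃ m : M, x = a • m}

/-- The homogeneous elements of `ker d`, together with their degrees. -/
def Stage.Syz (X : Stage A) : Type v := Σ n : ℕ, {x : X.F // x ∈ X.grade n ∧ X.d x = 0}

/-- The next step of the standard resolution: the graded free `A`-module on the homogeneous elements
of `ker d`, with its canonical map onto `ker d`. -/
def Stage.next (X : Stage A) : Stage A where
  F := X.Syz →₀ A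
  G := X.F
  grade n := AddSubgroup.closure {f | ∃ (x : X.Syz) (k : ℕ) (a : A),
    k + x.1 = n ∧ a ∈ 𝒜 k ∧ f = Finsupp.single x a}
  d := Finsupp.linearCombination A (fun x : X.Syz => x.2.1)

/-- The standard graded free resolution `⋯ → F₂ → F₁ → F₀ = A → A / A^+ = S` of the left `A`-module
`S`; the stage `i` is the map starting at `F_i`. -/
def stdResolution : ℕ → Stage A
  | 0 =>
    { F := A
      G := A ⧸ augIdeal 𝒜
      grade := fun n => (𝒜 n).toAddSubgroup
      d := (augIdeal 𝒜).mkQ }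
  | n + 1 => (stdResolution n).next 𝒜

/-- The cycles of internal degree `m` of `S ⊗_A F_*` at `F_i`, `i ≥ 1`, lifted to `F_i`. -/
def torCycles (i m : ℕ) : AddSubgroup (stdResolution 𝒜 i).F :=
  (stdResolution 𝒜 i).grade m ⊓
    ((augSmul 𝒜 (stdResolution 𝒜 i).G).comap (stdResolution 𝒜 i).d).toAddSubgroup

/-- The boundaries of `S ⊗_A F_*` at `F_i`, lifted to `F_i`. -/
def torBoundaries (i : ℕ) : AddSubgroup (stdResolution 𝒜 i).F :=
  (augSmul 𝒜 (stdResolution 𝒜 i).F ⊔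
    LinearMap.range ((stdResolution 𝒜 i).next 𝒜).d).toAddSubgroup

/-- `Tor_{i,m}^A(S, S)` for `i ≥ 1`, where `S` is both `A / A^+` as a left and as a right module: the homology of `S ⊗_A F_*` in homological degree `i` and
internal degree `m`. -/
def TorPos (i m : ℕ) : Type v :=
  torCycles 𝒜 i m ⧸ (torBoundaries 𝒜 i).addSubgroupOf (torCycles 𝒜 i m)

/-- The homological complexity `c(A)`, the complexity of `Tor_3^A(S, S)`. -/
def homComplexity : EReal := complexity (TorPos 𝒜 3)

end Tor

/-! ## The tensor ring `T_A` of `A^1` -/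

section TA

variable {S : Type u} {A : Type v} [Ring S] [Ring A] [Module S A] [IsScalarTower S A A]
  (𝒜 : ℕ → Submodule S A) [GradedRing 𝒜]

/-- The right `S`-module structure of `A^n`. -/
instance rightModule (n : ℕ) : Module Sᵐᵒᵖ (𝒜 n) where
  smul s a := ⟨a.1 * (s.unop • (1 : A)), by
    have h := SetLike.GradedMul.mul_mem (A := 𝒜) a.2
      (Submodule.smul_mem (𝒜 0) s.unop SetLike.GradedOne.one_mem)
    simpa using h⟩
  one_smul a := Subtype.ext (by
    change a.1 * ((1 : S) • (1 : A)) = a.1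
    simp)
  mul_smul s t a := Subtype.ext (by
    change a.1 * ((t.unop * s.unop) • (1 : A)) =
      (a.1 * (t.unop • (1 : A))) * (s.unop • (1 : A))
    rw [mul_assoc, smul_mul_assoc, one_mul, mul_smul])
  smul_zero s := Subtype.ext (zero_mul _)
  smul_add s a b := Subtype.ext (add_mul _ _ _)
  add_smul s t a := Subtype.ext (by
    change a.1 * ((s.unop + t.unop) • (1 : A)) =
      a.1 * (s.unop • (1 : A)) + a.1 * (t.unop • (1 : A))
    rw [add_smul, mul_add])
  zero_smul a := Subtype.ext (by
    change a.1 * ((0 : S) • (1 : A)) = 0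
    simp)

/-- The tensor ring `T_A = T_S(A^1)`. -/
abbrev TA : Type (max u v) := TensorRing S (𝒜 1)

/-- The grading of `T_A`. -/
abbrev gradeTA : ℕ → Submodule S (TA 𝒜) := TensorRing.grade S (𝒜 1)

/-- The canonical map `π_A : T_A → A` of `S`-rings, extending the identity of `A^1`. -/
def piA : TA 𝒜 →+* A :=
  TensorRing.lift
    { toFun := fun s : S => s • (1 : A)
      map_one' := one_smul _ _
      map_mul' := fun s t => by rw [smul_mul_assoc, one_mul, mul_smul]
      map_zero' := zero_smul _ _
      map_add' := fun s t => add_smul _ _ _ }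
    (𝒜 1).subtype.toAddMonoidHom
    (fun s x => by
      change s • x.1 = (s • (1 : A)) * x.1
      rw [smul_mul_assoc, one_mul])
    (fun s x => rfl)

/-- The ideal `I_A`, the kernel of `π_A`. -/
abbrev idealA : TwoSidedIdeal (TA 𝒜) := TwoSidedIdeal.ker (piA 𝒜)

end TA

/-! ## Projective resolutions of `S` and the complex `¹M_*` -/

section Resolutions

variable {S : Type u} {A : Type v} [Ring S] [Ring A] [Module S A] [IsScalarTower S A A]
  (𝒜 : ℕ → Submodule S A)

/-- `A^1` as a graded module concentrated in degree `1`. -/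
def gradeOne (n : ℕ) : Submodule S (𝒜 1) :=
  open Classical in if n = 1 then ⊤ else ⊥

/-- The `A`-linear map `d₁ : A ⊗ A^1 → A` induced by the multiplication of `A`. -/
def d₁ : BTensor S A (𝒜 1) →ₗ[A] A := tensorLift (𝒜 1).subtype

/-- A graded projective resolution
`⋯ → A ⊗ V₄ → A ⊗ V₃ → A ⊗ V₂ → A ⊗ A^1 → A → S → 0`
of the left `A`-module `S`, with `V_n` graded projective left `S`-modules such that
`V_n^0 = V_n^1 = 0` for `n ≥ 2`.  Here `V k` is the module `V_{k+2}`, and `d k` is the differential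
`A ⊗ V_{k+3} → A ⊗ V_{k+2}`.  Exactness at `A` and at `S` holds for every connected strongly graded
`A`. -/
structure Resolution where
  V : ℕ → Type w
  [addV : ∀ k, AddCommGroup (V k)]
  [modV : ∀ k, Module S (V k)]
  grade : ∀ k, ℕ → Submodule S (V k)
  internal : ∀ k, DirectSum.IsInternal (grade k)
  projective : ∀ k, Module.Projective S (V k)
  grade_zero : ∀ k, grade k 0 = ⊥
  grade_one : ∀ k, grade k 1 = ⊥
  d₂ : BTensor S A (V 0) →ₗ[A] BTensor S A (𝒜 1)
  d : ∀ k, BTensor S A (V (k + 1)) →ₗ[A] BTensor S A (V k)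
  d₂_graded : ∀ n, ∀ x ∈ tensorGrade 𝒜 (grade 0) n, d₂ x ∈ tensorGrade 𝒜 (gradeOne 𝒜) n
  d_graded : ∀ k n, ∀ x ∈ tensorGrade 𝒜 (grade (k + 1)) n, d k x ∈ tensorGrade 𝒜 (grade k) n
  exact₁ : Function.Exact d₂ (d₁ 𝒜)
  exact₂ : Function.Exact (d 0) d₂
  exact : ∀ k, Function.Exact (d (k + 1)) (d k)

attribute [instance] Resolution.addV Resolution.modV

variable {𝒜}

/-- The complexity `c_{V₃}` of the module `V₃` of a resolution. -/
def Resolution.complexity₃ (F : Resolution.{u, v, w} 𝒜) : EReal :=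
  complexity (fun n => F.grade 1 n)

variable {D : Type x} [Ring D] [Module S D]

/-- The data from which the complex `¹M_*` of a central extension `π : D → A = D / zD` is built:
graded `D`-linear lifts `∂₁ : D ⊗ A^1 → D` and `∂₂ : D ⊗ V₂ → D ⊗ A^1` of `d₁` and `d₂`, and a graded
`D`-linear map `f₂ : D ⊗ V₂ → D(-1)` with `∂₁ ∂₂ = - z f₂`. -/
structure LiftData (F : Resolution.{u, v, w} 𝒜) (𝒟 : ℕ → Submodule S D) (π : SRingHom S D A)
    (z : D) where
  del₁ : BTensor S D (𝒜 1) →ₗ[D] D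
  del₂ : BTensor S D (F.V 0) →ₗ[D] BTensor S D (𝒜 1)
  f₂ : BTensor S D (F.V 0) →ₗ[D] D
  del₁_graded : ∀ n, ∀ x ∈ tensorGrade 𝒟 (gradeOne 𝒜) n, del₁ x ∈ 𝒟 n
  del₂_graded : ∀ n, ∀ x ∈ tensorGrade 𝒟 (F.grade 0) n, del₂ x ∈ tensorGrade 𝒟 (gradeOne 𝒜) n
  f₂_graded : ∀ n, ∀ x ∈ tensorGrade 𝒟 (F.grade 0) (n + 1), f₂ x ∈ 𝒟 n
  del₁_lift : ∀ x, π.toRingHom (del₁ x) = d₁ 𝒜 (tensorMap π x)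
  del₂_lift : ∀ x, tensorMap π (del₂ x) = F.d₂ (tensorMap π x)
  del_comp : ∀ x, del₁ (del₂ x) = -(z * f₂ x)

variable {F : Resolution.{u, v, w} 𝒜} {𝒟 : ℕ → Submodule S D} {π : SRingHom S D A} {z : D}

/-- `δ₁ : M₁ = (D ⊗ A^1) ⊕ D(-1) → M₀ = D`, `δ₁(x, y) = ∂₁(x) + z y`. -/
def LiftData.delta₁ (L : LiftData F 𝒟 π z) : BTensor S D (𝒜 1) × D →+ D :=
  L.del₁.toAddMonoidHom.coprod (AddMonoidHom.mulLeft z)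

/-- `δ₂ : M₂ = (D ⊗ V₂) ⊕ (D ⊗ A^1)(-1) → M₁ = (D ⊗ A^1) ⊕ D(-1)`,
`δ₂(x, y) = (∂₂(x) - z y, ∂₁(y) + f₂(x))`. -/
def LiftData.delta₂ (L : LiftData F 𝒟 π z) :
    BTensor S D (F.V 0) × BTensor S D (𝒜 1) →+ BTensor S D (𝒜 1) × D :=
  AddMonoidHom.prod
    (L.del₂.toAddMonoidHom.coprod (-(DistribSMul.toAddMonoidHom (BTensor S D (𝒜 1)) z)))
    (L.f₂.toAddMonoidHom.coprod L.del₁.toAddMonoidHom)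

theorem LiftData.delta₁_apply (L : LiftData F 𝒟 π z) (x : BTensor S D (𝒜 1)) (y : D) :
    L.delta₁ (x, y) = L.del₁ x + z * y := rfl

theorem LiftData.delta₂_apply (L : LiftData F 𝒟 π z) (x : BTensor S D (F.V 0))
    (y : BTensor S D (𝒜 1)) :
    L.delta₂ (x, y) = (L.del₂ x - z • y, L.del₁ y + L.f₂ x) := by
  refine Prod.ext ?_ (add_comm _ _)
  exact (sub_eq_add_neg _ _).symm

/-- The homology group `H₁(¹M_*) = ker δ₁ / im δ₂` of `M₂ → M₁ → M₀ → 0`. -/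
abbrev LiftData.H₁ (L : LiftData F 𝒟 π z) : Type (max v x) :=
  L.delta₁.ker ⧸ L.delta₂.range.addSubgroupOf L.delta₁.ker

end Resolutions

section Projection

variable {S : Type u} {A : Type v} [Ring S] [Ring A] [Module S A] [IsScalarTower S A A]
  (𝒜 : ℕ → Submodule S A) [GradedRing 𝒜] (P R : Submodule S (TA 𝒜))

theorem LH_mem_leading {p : TA 𝒜} (hp : p ∈ P) :
    LH (gradeTA 𝒜) p ∈ leading (gradeTA 𝒜) P :=
  Submodule.subset_span ⟨p, hp, rfl⟩

/-- Evaluation of a homogenization at `z = 0` gives the leading component. -/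
theorem coeff_zero_homogenization (a : TA 𝒜) :
    (homogenization (gradeTA 𝒜) a).coeff 0 = LH (gradeTA 𝒜) a := by
  unfold homogenization LH
  rw [Polynomial.finsetSum_coeff, Finset.sum_eq_single (topDegree (gradeTA 𝒜) a)]
  · simp
  · intro i hi hne
    rw [Finset.mem_range] at hi
    rw [Polynomial.coeff_monomial, if_neg (by omega)]
  · simp

/-- The projection `π : D(P) → A`, `t ↦ π_A(t)`, `z ↦ 0`, of the central extension `D(P)` when `R`
generates `I_A` and `⟨R⟩ = ⟨R_P⟩`. -/
def projection (hgen : idealOf (R : Set (TA 𝒜)) = idealA 𝒜)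
    (h : idealOf (R : Set (TA 𝒜)) = idealOf (leading (gradeTA 𝒜) P : Set (TA 𝒜))) :
    SRingHom S (CentralExt (gradeTA 𝒜) P) A where
  toRingHom := Ideal.Quotient.lift _
    ((piA 𝒜).comp (Polynomial.constantCoeff : (TA 𝒜)[X] →+* TA 𝒜)) (by
      intro a ha
      have hle : idealOf (homogSet (gradeTA 𝒜) P) ≤ TwoSidedIdeal.ker
          ((piA 𝒜).comp (Polynomial.constantCoeff : (TA 𝒜)[X] →+* TA 𝒜)) := by
        refine TwoSidedIdeal.span_le.2 ?_
        rintro _ ⟨p, hp, rfl⟩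
        refine (TwoSidedIdeal.mem_ker _).2 ?_
        have h1 : LH (gradeTA 𝒜) p ∈ idealA 𝒜 := by
          rw [← hgen, h]
          exact TwoSidedIdeal.subset_span (LH_mem_leading 𝒜 P hp)
        rw [RingHom.comp_apply, Polynomial.constantCoeff_apply, coeff_zero_homogenization]
        exact (TwoSidedIdeal.mem_ker _).1 h1
      exact (TwoSidedIdeal.mem_ker _).1 (hle ha))
  map_smul' := by
    intro s b
    obtain ⟨p, rfl⟩ := Ideal.Quotient.mk_surjective b
    change piA 𝒜 ((s • p).coeff 0) = s • piA 𝒜 (p.coeff 0)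
    rw [Polynomial.coeff_smul, TensorRing.smul_def, map_mul]
    have h2 : piA 𝒜 (TensorRing.scalar S (𝒜 1) s) = s • (1 : A) :=
      TensorRing.lift_scalar _ _ _ _ s
    rw [h2, smul_mul_assoc, one_mul]

end Projection

end PBW
end

/-!
Everything is reduced to the regularity of the central element `z` of `D = D(P) = T[z]/⟨P*⟩`.

*The dictionary.* Dehomogenization `∑ aᵢ zⁱ ↦ ∑ aᵢ` identifies `D^n` with `T^{≤n}/P_n`, and
multiplication by `z` with the map induced by the inclusion `T^{≤n} ⊆ T^{≤n+1}`. Hence the Jacobi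
condition `(𝒥_n)` says that `z` is injective on `D^n`. On the other hand `⟨P⟩` is the union of the
`P_n`, and the leading components of the elements of `P_n` make up `⟨R_P⟩`, so `U(P)` is a
PBW-deformation if and only if `⟨R⟩ = ⟨R_P⟩` and `(𝒥_n)` holds for all `n`
(`isPBWDeformation_iff_jacobi`).

*From finitely many degrees to all degrees.* If `z` is regular, then `¹M_*` is exact at `M₁`
(`LiftData.subsingleton_H₁_of_regular`). Conversely assume exactness at `M₁` and injectivity of `z`
on `D^{j-1}` whenever `V₃^j ≠ 0`, which is what the conditions `(𝒥_n)` with `1 ≤ n ≤ c(A)` provide.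
Lift `d₃` to `∂₃` and choose `f₃` with `∂₂ ∂₃ = - z f₃`. Then `f₂ ∂₃ - ∂₁ f₃` is annihilated by `z`,
so it vanishes by the assumption on `V₃`. For `x ∈ D^n` with `z x = 0` the cycle `(0, x)` of `M₁` is
a boundary, and this leads to `x = ∂₁ t` with `z t = 0`. As `D ⊗ A^1` is, as a left `D`-module, a
summand of a free module, the coordinates of `t` lie in the kernel of `z` and have degree `n - 1`,
so they vanish by induction (`LiftData.regular_of_subsingleton_H₁`). The lifts `∂₁`, `∂₂` and `f₂`
exist by projectivity, because `∂₁ ∂₂` has values in the kernel `z D` of `D → A`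
(`IsCentralExtension.nonempty_liftData`).

*Existence of resolutions.* Let `R` be a bimodule of relations, projective as a left `S`-module. The
isomorphism `T⁺ ≅ T ⊗ A^1` yields a map `A ⊗ R → A ⊗ A^1` whose image is the kernel of
`A ⊗ A^1 → A`, because `I_A = ⟨R⟩`. The next module `V₃` is taken free on the homogeneous elements of
the kernel whose degrees are those with `Tor₃ ≠ 0`; by the graded Nakayama lemma these already
generate it (`ProjStage.range_nextD`). That `Tor₃`, defined by the standard resolution, can be
computed from the new one is a comparison argument (`TorVanishes.of_comparison`), and it needs the
kernel of `A ⊗ R → A ⊗ A^1` to be contained in `A⁺ ⊗ R`, which is the directness of the sum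
`R ⊕ (A^1 I_A + I_A A^1)`.

*Filtered maps.* If `P = α(R)` with `R` a bimodule of relations, then `R_P = R`, and it suffices to
exhibit one choice of lifts with `H₁(¹M_*) = 0`. The obvious lifts have `∂₂(1 ⊗ r)` equal to the
class of `r` under `T⁺ ≅ T ⊗ A^1`, and `f₂(1 ⊗ r)` the homogenization of `α(r) - r`. The map
`theta : T[z] → (D ⊗ A^1) × D`, which sends `t v` to `([t] ⊗ v, 0)` and `f z` to `(0, [f])`, maps the
kernel of `T[z] → D` to boundaries. Every cycle is, modulo boundaries, a value of `theta` on that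
kernel, whence exactness (`mem_coneBoundaries_of_cycle`).
-/

set_option linter.unusedSectionVars false

noncomputable section

namespace PBW

universe y

/-! ### Homogeneous components in a graded `S`-ring -/

section Components

variable {S : Type u} {T : Type v} [Ring S] [Ring T] [Module S T]
  (𝒯 : ℕ → Submodule S T) [GradedRing 𝒯]

theorem proj_mem (i : ℕ) (x : T) : GradedRing.proj 𝒯 i x ∈ 𝒯 i := by
  rw [GradedRing.proj_apply]
  exact SetLike.coe_mem _

variable {𝒯} in
theorem proj_of_mem {i : ℕ} {x : T} (hx : x ∈ 𝒯 i) (j : ℕ) :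
    GradedRing.proj 𝒯 j x = if i = j then x else 0 := by
  rw [GradedRing.proj_apply]
  split_ifs with h
  · subst h
    exact DirectSum.decompose_of_mem_same _ hx
  · exact DirectSum.decompose_of_mem_ne _ hx h

theorem proj_smul (i : ℕ) (s : S) (x : T) :
    GradedRing.proj 𝒯 i (s • x) = s • GradedRing.proj 𝒯 i x := by
  simp only [GradedRing.proj_apply]
  rw [DirectSum.decompose_smul]
  rfl

variable {𝒯} in
theorem ext_proj {x y : T} (h : ∀ i, GradedRing.proj 𝒯 i x = GradedRing.proj 𝒯 i y) : x = y := by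
  apply (DirectSum.decompose 𝒯).injective
  ext i
  simpa only [GradedRing.proj_apply] using h i

/-- Every element is the sum of its homogeneous components of degree `< M`, for all large `M`. -/
theorem exists_eq_sum_proj (x : T) : ∃ N, ∀ M, N ≤ M →
    x = ∑ i ∈ Finset.range M, GradedRing.proj 𝒯 i x := by
  induction x using DirectSum.Decomposition.inductionOn 𝒯 with
  | zero => exact ⟨0, fun M _ => by simp⟩
  | @homogeneous i m =>
    refine ⟨i + 1, fun M hM => ?_⟩
    rw [Finset.sum_eq_single_of_mem i (Finset.mem_range.2 (by omega))
      (fun j _ hj => by rw [proj_of_mem m.2, if_neg (Ne.symm hj)])]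
    rw [proj_of_mem m.2, if_pos rfl]
  | add m m' h h' =>
    obtain ⟨N, hN⟩ := h
    obtain ⟨N', hN'⟩ := h'
    refine ⟨max N N', fun M hM => ?_⟩
    conv_lhs => rw [hN M (le_trans (le_max_left _ _) hM), hN' M (le_trans (le_max_right _ _) hM)]
    rw [← Finset.sum_add_distrib]
    simp only [map_add]

theorem proj_mul (n : ℕ) (x y : T) : GradedRing.proj 𝒯 n (x * y) =
    ∑ p ∈ Finset.HasAntidiagonal.antidiagonal n, GradedRing.proj 𝒯 p.1 x * GradedRing.proj 𝒯 p.2 y := by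
  induction x using DirectSum.Decomposition.inductionOn 𝒯 with
  | zero => simp
  | add m m' h h' => simp only [add_mul, map_add, h, h', Finset.sum_add_distrib]
  | @homogeneous i a =>
    induction y using DirectSum.Decomposition.inductionOn 𝒯 with
    | zero => simp
    | add m m' h h' => simp only [mul_add, map_add, h, h', Finset.sum_add_distrib]
    | @homogeneous j b =>
      rw [proj_of_mem (SetLike.GradedMul.mul_mem a.2 b.2)]
      simp only [proj_of_mem a.2, proj_of_mem b.2]
      split_ifs with h
      · subst h
        rw [Finset.sum_eq_single_of_mem (i, j) (by simp)]
        · simp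
        · rintro ⟨k, l⟩ _ hkl
          by_cases hk : i = k
          · have : j ≠ l := fun hl => hkl (by rw [hk, hl])
            simp [this]
          · simp [hk]
      · symm
        refine Finset.sum_eq_zero ?_
        rintro ⟨k, l⟩ hkl
        rw [Finset.HasAntidiagonal.mem_antidiagonal] at hkl
        by_cases hk : i = k
        · have : j ≠ l := fun hl => h (by rw [hk, hl]; exact hkl)
          simp [this]
        · simp [hk]

theorem mem_filt_iff {n : ℕ} {x : T} : x ∈ filt 𝒯 n ↔ ∀ i, n < i → GradedRing.proj 𝒯 i x = 0 := by
  constructor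
  · intro hx i hi
    have hle : filt 𝒯 n ≤ { carrier := {x | GradedRing.proj 𝒯 i x = 0}
                            add_mem' := fun {a b} ha hb => by
                              rw [Set.mem_ofPred_eq] at *; rw [map_add, ha, hb, add_zero]
                            zero_mem' := map_zero _
                            smul_mem' := fun s a ha => by
                              rw [Set.mem_ofPred_eq] at *
                              rw [proj_smul, ha, smul_zero] : Submodule S T } := by
      refine iSup₂_le fun j hj y hy => ?_
      change GradedRing.proj 𝒯 i y = 0
      rw [proj_of_mem hy, if_neg (by omega)]
    exact hle hx
  · intro h
    obtain ⟨N, hN⟩ := exists_eq_sum_proj 𝒯 x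
    rw [hN N le_rfl]
    refine sum_mem fun i _ => ?_
    by_cases hi : n < i
    · rw [h i hi]; exact zero_mem _
    · exact le_iSup₂_of_le (f := fun i (_ : i ≤ n) => 𝒯 i) i (by omega) le_rfl (proj_mem 𝒯 i x)

theorem filtLT_succ (n : ℕ) : filtLT 𝒯 (n + 1) = filt 𝒯 n := by
  simp only [filtLT, filt, Nat.lt_succ_iff]

theorem filtLT_zero : filtLT 𝒯 0 = ⊥ := by simp [filtLT]

theorem mem_filtLT_iff {n : ℕ} {x : T} :
    x ∈ filtLT 𝒯 n ↔ ∀ i, n ≤ i → GradedRing.proj 𝒯 i x = 0 := by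
  cases n with
  | zero =>
    rw [filtLT_zero, Submodule.mem_bot]
    constructor
    · rintro rfl i -
      exact map_zero _
    · intro h
      exact ext_proj (𝒯 := 𝒯) fun i => by rw [h i (Nat.zero_le _), map_zero]
  | succ n => rw [filtLT_succ, mem_filt_iff]; rfl

theorem mem_filt_of_mem {i n : ℕ} (h : i ≤ n) {x : T} (hx : x ∈ 𝒯 i) : x ∈ filt 𝒯 n :=
  le_iSup₂_of_le (f := fun i (_ : i ≤ n) => 𝒯 i) i h le_rfl hx

theorem filt_mono {m n : ℕ} (h : m ≤ n) : filt 𝒯 m ≤ filt 𝒯 n := fun x hx => by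
  rw [mem_filt_iff] at *
  exact fun i hi => hx i (by omega)

theorem exists_mem_filt (x : T) : ∃ n, x ∈ filt 𝒯 n := by
  obtain ⟨N, hN⟩ := exists_eq_sum_proj 𝒯 x
  refine ⟨N, ?_⟩
  rw [hN N le_rfl]
  exact sum_mem fun i hi => mem_filt_of_mem 𝒯 (Finset.mem_range.1 hi).le (proj_mem 𝒯 i x)

theorem filt_eq_sum {n : ℕ} {x : T} (hx : x ∈ filt 𝒯 n) :
    x = ∑ i ∈ Finset.range (n + 1), GradedRing.proj 𝒯 i x := by
  obtain ⟨N, hN⟩ := exists_eq_sum_proj 𝒯 x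
  conv_lhs => rw [hN (max N (n + 1)) (le_max_left _ _)]
  symm
  refine Finset.sum_subset (Finset.range_mono (le_max_right _ _)) fun i _ hi => ?_
  exact (mem_filt_iff 𝒯).1 hx i (by simpa using hi)

theorem filt_mul_mem {m n : ℕ} {x y : T} (hx : x ∈ filt 𝒯 m) (hy : y ∈ filt 𝒯 n) :
    x * y ∈ filt 𝒯 (m + n) := by
  rw [mem_filt_iff] at *
  intro i hi
  rw [proj_mul]
  refine Finset.sum_eq_zero fun p hp => ?_
  rw [Finset.HasAntidiagonal.mem_antidiagonal] at hp
  by_cases h : m < p.1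
  · rw [hx _ h, zero_mul]
  · rw [hy p.2 (by omega), mul_zero]

theorem filt_sub_proj {n : ℕ} {x : T} (hx : x ∈ filt 𝒯 n) :
    x - GradedRing.proj 𝒯 n x ∈ filtLT 𝒯 n := by
  rw [mem_filtLT_iff]
  intro i hi
  rw [map_sub, proj_of_mem (proj_mem 𝒯 n x)]
  split_ifs with h
  · rw [h, sub_self]
  · rw [(mem_filt_iff 𝒯).1 hx i (by omega), sub_zero]

theorem bddAbove_degrees (a : T) : BddAbove {i : ℕ | GradedRing.proj 𝒯 i a ≠ 0} := by
  obtain ⟨n, hn⟩ := exists_mem_filt 𝒯 a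
  refine ⟨n, fun i hi => ?_⟩
  by_contra h
  exact hi ((mem_filt_iff 𝒯).1 hn i (by omega))

theorem mem_filt_topDegree (a : T) : a ∈ filt 𝒯 (topDegree 𝒯 a) := by
  rw [mem_filt_iff]
  intro i hi
  by_contra h
  exact absurd (le_csSup (bddAbove_degrees 𝒯 a) h) (not_le.2 hi)

theorem topDegree_le {n : ℕ} {a : T} (ha : a ∈ filt 𝒯 n) : topDegree 𝒯 a ≤ n := by
  rcases Set.eq_empty_or_nonempty {i : ℕ | GradedRing.proj 𝒯 i a ≠ 0} with h | h
  · rw [topDegree, h]; simp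
  · refine csSup_le h fun i hi => ?_
    by_contra hn
    exact hi ((mem_filt_iff 𝒯).1 ha i (by omega))

theorem topDegree_eq {n : ℕ} {a : T} (ha : a ∈ filt 𝒯 n) (h : GradedRing.proj 𝒯 n a ≠ 0) :
    topDegree 𝒯 a = n :=
  le_antisymm (topDegree_le 𝒯 ha) (le_csSup (bddAbove_degrees 𝒯 a) h)

end Components

/-! ### Homogenization and the filtration `P_n` -/

section Homogenization

variable {S : Type u} {T : Type v} [Ring S] [Ring T] [Module S T]
  (𝒯 : ℕ → Submodule S T) [GradedRing 𝒯]

/-- The dehomogenization (at `z = 1`) of the component of total degree `n` of a polynomial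
`f ∈ T[z]`, where `z` has degree `1`. -/
def dehom (n : ℕ) : T[X] →+ T where
  toFun f := ∑ p ∈ Finset.HasAntidiagonal.antidiagonal n, GradedRing.proj 𝒯 p.1 (f.coeff p.2)
  map_zero' := by simp
  map_add' f g := by simp [Finset.sum_add_distrib]

/-- The homogenization of `t` in degree `n`: the polynomial `∑ tᵢ z^{n-i}`, which forgets the
components of `t` of degree `> n`. -/
def homAt (n : ℕ) : T →+ T[X] where
  toFun t := ∑ p ∈ Finset.HasAntidiagonal.antidiagonal n, Polynomial.monomial p.2 (GradedRing.proj 𝒯 p.1 t)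
  map_zero' := by simp
  map_add' f g := by simp [Finset.sum_add_distrib]

theorem dehom_apply (n : ℕ) (f : T[X]) : dehom 𝒯 n f =
    ∑ p ∈ Finset.HasAntidiagonal.antidiagonal n, GradedRing.proj 𝒯 p.1 (f.coeff p.2) := rfl

theorem homAt_apply (n : ℕ) (t : T) : homAt 𝒯 n t =
    ∑ p ∈ Finset.HasAntidiagonal.antidiagonal n, Polynomial.monomial p.2 (GradedRing.proj 𝒯 p.1 t) := rfl

theorem dehom_mem_filt (n : ℕ) (f : T[X]) : dehom 𝒯 n f ∈ filt 𝒯 n := by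
  rw [dehom_apply]
  refine sum_mem fun p hp => mem_filt_of_mem 𝒯 ?_ (proj_mem 𝒯 p.1 _)
  rw [Finset.HasAntidiagonal.mem_antidiagonal] at hp
  omega

theorem dehom_smul (n : ℕ) (s : S) (f : T[X]) : dehom 𝒯 n (s • f) = s • dehom 𝒯 n f := by
  simp only [dehom_apply, Polynomial.coeff_smul, proj_smul, Finset.smul_sum]

variable {𝒯} in
theorem dehom_monomial {i : ℕ} {t : T} (ht : t ∈ 𝒯 i) (n k : ℕ) :
    dehom 𝒯 n (Polynomial.monomial k t) = if i + k = n then t else 0 := by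
  rw [dehom_apply]
  split_ifs with h
  · rw [Finset.sum_eq_single_of_mem (i, k) (by simpa using h)]
    · simp [proj_of_mem ht]
    · rintro ⟨a, b⟩ hab hne
      simp only [Polynomial.coeff_monomial]
      split_ifs with hb
      · rw [proj_of_mem ht, if_neg]
        rintro rfl
        exact hne (by rw [hb])
      · exact map_zero _
  · refine Finset.sum_eq_zero ?_
    rintro ⟨a, b⟩ hab
    rw [Finset.HasAntidiagonal.mem_antidiagonal] at hab
    simp only [Polynomial.coeff_monomial]
    split_ifs with hb
    · rw [proj_of_mem ht, if_neg]
      rintro rfl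
      exact h (by rw [hb]; exact hab)
    · exact map_zero _

variable {𝒯} in
/-- Additive induction over the bihomogeneous monomials of `T[z]`. -/
theorem homogeneous_induction {p : T[X] → Prop} (h0 : p 0)
    (hadd : ∀ f g, p f → p g → p (f + g))
    (hmon : ∀ (i k : ℕ) (t : T), t ∈ 𝒯 i → p (Polynomial.monomial k t)) (f : T[X]) : p f := by
  induction f using Polynomial.induction_on' with
  | add f g hf hg => exact hadd f g hf hg
  | monomial k t =>
    induction t using DirectSum.Decomposition.inductionOn 𝒯 with
    | zero => rw [map_zero]; exact h0
    | add a b ha hb => rw [map_add]; exact hadd _ _ ha hb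
    | @homogeneous i a => exact hmon i k a a.2

theorem dehom_mul (n : ℕ) (f g : T[X]) : dehom 𝒯 n (f * g) =
    ∑ p ∈ Finset.HasAntidiagonal.antidiagonal n, dehom 𝒯 p.1 f * dehom 𝒯 p.2 g := by
  induction f using homogeneous_induction (𝒯 := 𝒯) with
  | h0 => simp
  | hadd a b ha hb => simp only [add_mul, map_add, ha, hb, Finset.sum_add_distrib]
  | hmon i k t ht =>
    induction g using homogeneous_induction (𝒯 := 𝒯) with
    | h0 => simp
    | hadd a b ha hb => simp only [mul_add, map_add, ha, hb, Finset.sum_add_distrib]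
    | hmon j l r hr =>
      rw [Polynomial.monomial_mul_monomial, dehom_monomial (SetLike.GradedMul.mul_mem ht hr)]
      simp only [dehom_monomial ht, dehom_monomial hr, ite_mul, zero_mul, mul_ite, mul_zero]
      split_ifs with h
      · rw [Finset.sum_eq_single_of_mem (i + k, j + l) (by simp; omega)]
        · simp
        · rintro ⟨a, b⟩ _ hab
          simp only
          split_ifs with h1 h2
          · exact absurd (by rw [h1, h2]) hab
          · rfl
          · rfl
      · symm
        refine Finset.sum_eq_zero ?_
        rintro ⟨a, b⟩ hab
        rw [Finset.HasAntidiagonal.mem_antidiagonal] at hab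
        simp only at hab ⊢
        split_ifs with h1 h2
        · omega
        · rfl
        · rfl

variable {𝒯} in
theorem homAt_of_mem {i : ℕ} {t : T} (ht : t ∈ 𝒯 i) (n : ℕ) :
    homAt 𝒯 n t = if i ≤ n then Polynomial.monomial (n - i) t else 0 := by
  rw [homAt_apply]
  split_ifs with h
  · rw [Finset.sum_eq_single_of_mem (i, n - i) (by simp; omega)]
    · simp [proj_of_mem ht]
    · rintro ⟨a, b⟩ hab hne
      rw [Finset.HasAntidiagonal.mem_antidiagonal] at hab
      have : i ≠ a := fun h => hne (by ext <;> simp <;> omega)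
      simp [proj_of_mem ht, this]
  · refine Finset.sum_eq_zero ?_
    rintro ⟨a, b⟩ hab
    rw [Finset.HasAntidiagonal.mem_antidiagonal] at hab
    have : i ≠ a := by simp only at hab; omega
    simp [proj_of_mem ht, this]

theorem dehom_homAt {n : ℕ} {t : T} (ht : t ∈ filt 𝒯 n) (m : ℕ) :
    dehom 𝒯 m (homAt 𝒯 n t) = if m = n then t else 0 := by
  rw [homAt_apply, map_sum]
  have h : ∀ p ∈ Finset.HasAntidiagonal.antidiagonal n, dehom 𝒯 m (Polynomial.monomial p.2
      (GradedRing.proj 𝒯 p.1 t)) = if m = n then GradedRing.proj 𝒯 p.1 t else 0 := by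
    intro p hp
    rw [Finset.HasAntidiagonal.mem_antidiagonal] at hp
    rw [dehom_monomial (proj_mem 𝒯 _ _), hp]
    simp only [eq_comm]
  rw [Finset.sum_congr rfl h]
  split_ifs with hm
  · rw [Finset.Nat.sum_antidiagonal_eq_sum_range_succ_mk]
    exact (filt_eq_sum 𝒯 ht).symm
  · simp

theorem homogenization_eq_homAt (a : T) :
    homogenization 𝒯 a = homAt 𝒯 (topDegree 𝒯 a) a := by
  rw [homAt_apply, Finset.Nat.sum_antidiagonal_eq_sum_range_succ_mk]
  rfl

/-- A polynomial is the sum of its components of total degree `< M`, for all large `M`. -/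
theorem exists_eq_sum_homAt (f : T[X]) : ∃ N, ∀ M, N ≤ M →
    f = ∑ n ∈ Finset.range M, homAt 𝒯 n (dehom 𝒯 n f) := by
  induction f using homogeneous_induction (𝒯 := 𝒯) with
  | h0 => exact ⟨0, fun M _ => by simp⟩
  | hmon i k t ht =>
    refine ⟨i + k + 1, fun M hM => ?_⟩
    rw [Finset.sum_eq_single_of_mem (i + k) (Finset.mem_range.2 (by omega))]
    · rw [dehom_monomial ht, if_pos rfl, homAt_of_mem ht, if_pos (Nat.le_add_right i k),
        Nat.add_sub_cancel_left]
    · intro j _ hj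
      rw [dehom_monomial ht, if_neg (Ne.symm hj), map_zero]
  | hadd a b h h' =>
    obtain ⟨N, hN⟩ := h
    obtain ⟨N', hN'⟩ := h'
    refine ⟨max N N', fun M hM => ?_⟩
    conv_lhs => rw [hN M (le_trans (le_max_left _ _) hM), hN' M (le_trans (le_max_right _ _) hM)]
    rw [← Finset.sum_add_distrib]
    simp only [map_add]

theorem ext_dehom {f g : T[X]} (h : ∀ n, dehom 𝒯 n f = dehom 𝒯 n g) : f = g := by
  obtain ⟨N, hN⟩ := exists_eq_sum_homAt 𝒯 f
  obtain ⟨N', hN'⟩ := exists_eq_sum_homAt 𝒯 g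
  rw [hN (max N N') (le_max_left _ _), hN' (max N N') (le_max_right _ _)]
  simp only [h]

theorem dehom_X (n : ℕ) : dehom 𝒯 n (Polynomial.X : T[X]) = if n = 1 then 1 else 0 := by
  rw [← Polynomial.monomial_one_one_eq_X, dehom_monomial SetLike.GradedOne.one_mem]
  simp only [zero_add, eq_comm]

theorem dehom_X_mul_succ (n : ℕ) (f : T[X]) :
    dehom 𝒯 (n + 1) (Polynomial.X * f) = dehom 𝒯 n f := by
  rw [dehom_mul, Finset.sum_eq_single_of_mem (1, n) (by simp; omega)]
  · simp [dehom_X]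
  · rintro ⟨a, b⟩ hab hne
    rw [Finset.HasAntidiagonal.mem_antidiagonal] at hab
    have : a ≠ 1 := fun h => hne (by simp only at hab; ext <;> simp <;> omega)
    simp [dehom_X, this]

theorem dehom_X_mul_zero (f : T[X]) : dehom 𝒯 0 (Polynomial.X * f) = 0 := by
  rw [dehom_mul]
  simp [dehom_X]

theorem homAt_add {n : ℕ} {t : T} (ht : t ∈ filt 𝒯 n) (k : ℕ) :
    homAt 𝒯 (n + k) t = Polynomial.X ^ k * homAt 𝒯 n t := by
  induction k with
  | zero => simp
  | succ k ih =>
    rw [pow_succ', mul_assoc, ← ih]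
    refine ext_dehom 𝒯 fun m => ?_
    have h1 := filt_mono 𝒯 (Nat.le_add_right n k) ht
    have h2 := filt_mono 𝒯 (Nat.le_add_right n (k + 1)) ht
    rw [dehom_homAt 𝒯 h2]
    cases m with
    | zero => rw [dehom_X_mul_zero, if_neg (by omega)]
    | succ m =>
      rw [dehom_X_mul_succ, dehom_homAt 𝒯 h1]
      congr 1
      exact propext (by omega)

theorem homAt_mul {m n : ℕ} {a b : T} (ha : a ∈ filt 𝒯 m) (hb : b ∈ filt 𝒯 n) :
    homAt 𝒯 (m + n) (a * b) = homAt 𝒯 m a * homAt 𝒯 n b := by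
  refine ext_dehom 𝒯 fun k => ?_
  rw [dehom_homAt 𝒯 (filt_mul_mem 𝒯 ha hb), dehom_mul]
  simp only [dehom_homAt 𝒯 ha, dehom_homAt 𝒯 hb, ite_mul, zero_mul, mul_ite, mul_zero]
  split_ifs with h
  · rw [Finset.sum_eq_single_of_mem (m, n) (by simp [h])]
    · simp
    · rintro ⟨i, j⟩ _ hij
      simp only
      split_ifs with h1 h2
      · exact absurd (by rw [h1, h2]) hij
      · rfl
      · rfl
  · symm
    refine Finset.sum_eq_zero ?_
    rintro ⟨i, j⟩ hij
    rw [Finset.HasAntidiagonal.mem_antidiagonal] at hij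
    simp only at hij ⊢
    split_ifs with h1 h2
    · omega
    · rfl
    · rfl

theorem homAt_smul (n : ℕ) (s : S) (t : T) : homAt 𝒯 n (s • t) = s • homAt 𝒯 n t := by
  simp only [homAt_apply, proj_smul, Finset.smul_sum, Polynomial.smul_monomial]

variable [IsScalarTower S T T] (P : Submodule S T)

variable {P} in
theorem jacobiFilt_left {i j : ℕ} {a x : T} (ha : a ∈ filt 𝒯 i) (hx : x ∈ jacobiFilt 𝒯 P j) :
    a * x ∈ jacobiFilt 𝒯 P (i + j) := by
  refine Submodule.span_induction (p := fun x _ => ∀ a ∈ filt 𝒯 i,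
    a * x ∈ jacobiFilt 𝒯 P (i + j)) ?_ ?_ ?_ ?_ hx a ha
  · rintro _ ⟨i', j', k', a', p, b, rfl, ha', hp, hpj, hb, rfl⟩ a ha
    refine Submodule.subset_span ⟨i + i', j', k', a * a', p, b, by omega,
      filt_mul_mem 𝒯 ha ha', hp, hpj, hb, by simp only [mul_assoc]⟩
  · intro a _
    rw [mul_zero]
    exact zero_mem _
  · intro x y _ _ hx hy a ha
    rw [mul_add]
    exact add_mem (hx a ha) (hy a ha)
  · intro s x _ hx a ha
    have h : a * s • x = (a * (s • (1 : T))) * x := by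
      rw [mul_assoc, smul_mul_assoc, one_mul]
    rw [h]
    refine hx _ ?_
    have := filt_mul_mem 𝒯 ha (mem_filt_of_mem 𝒯 (le_refl 0)
      (Submodule.smul_mem (𝒯 0) s SetLike.GradedOne.one_mem))
    simpa using this

variable {P} in
theorem jacobiFilt_right {i j : ℕ} {a x : T} (ha : a ∈ filt 𝒯 i) (hx : x ∈ jacobiFilt 𝒯 P j) :
    x * a ∈ jacobiFilt 𝒯 P (j + i) := by
  refine Submodule.span_induction (p := fun x _ => x * a ∈ jacobiFilt 𝒯 P (j + i)) ?_ ?_ ?_ ?_ hx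
  · rintro _ ⟨i', j', k', a', p, b, rfl, ha', hp, hpj, hb, rfl⟩
    refine Submodule.subset_span ⟨i', j', k' + i, a', p, b * a, by omega,
      ha', hp, hpj, filt_mul_mem 𝒯 hb ha, by simp only [mul_assoc]⟩
  · rw [zero_mul]
    exact zero_mem _
  · intro x y _ _ hx hy
    rw [add_mul]
    exact add_mem hx hy
  · intro s x _ hx
    rw [smul_mul_assoc]
    exact Submodule.smul_mem _ _ hx

theorem one_mem_filt (n : ℕ) : (1 : T) ∈ filt 𝒯 n :=
  mem_filt_of_mem 𝒯 (Nat.zero_le n) SetLike.GradedOne.one_mem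

theorem jacobiFilt_mono {m n : ℕ} (h : m ≤ n) : jacobiFilt 𝒯 P m ≤ jacobiFilt 𝒯 P n := by
  intro x hx
  obtain ⟨k, rfl⟩ := Nat.exists_eq_add_of_le h
  simpa using jacobiFilt_right 𝒯 (one_mem_filt 𝒯 k) hx

theorem jacobiFilt_le_filt (n : ℕ) : jacobiFilt 𝒯 P n ≤ filt 𝒯 n := by
  refine Submodule.span_le.2 ?_
  rintro _ ⟨i, j, k, a, p, b, rfl, ha, hp, hpj, hb, rfl⟩
  exact filt_mul_mem 𝒯 (filt_mul_mem 𝒯 ha hpj) hb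

variable {P} in
theorem mem_jacobiFilt_of_mem {n : ℕ} {p : T} (hp : p ∈ P) (hn : p ∈ filt 𝒯 n) :
    p ∈ jacobiFilt 𝒯 P n :=
  Submodule.subset_span ⟨0, n, 0, 1, p, 1, by omega, one_mem_filt 𝒯 0, hp, hn, one_mem_filt 𝒯 0,
    by simp⟩

/-- The ideal of `T[z]` generated by the homogenizations of the elements of `P` consists of the
polynomials whose component of degree `n` dehomogenizes to an element of `P_n`, for every `n`. -/
theorem mem_idealOf_homogSet_iff {f : T[X]} :
    f ∈ idealOf (homogSet 𝒯 P) ↔ ∀ n, dehom 𝒯 n f ∈ jacobiFilt 𝒯 P n := by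
  constructor
  · intro hf
    let J : TwoSidedIdeal T[X] := TwoSidedIdeal.mk'
      {f | ∀ n, dehom 𝒯 n f ∈ jacobiFilt 𝒯 P n}
      (fun n => by rw [map_zero]; exact zero_mem _)
      (fun {a b} ha hb n => by rw [map_add]; exact add_mem (ha n) (hb n))
      (fun {a} ha n => by rw [map_neg]; exact neg_mem (ha n))
      (fun {a b} hb n => by
        rw [dehom_mul]
        refine sum_mem fun p hp => ?_
        rw [Finset.HasAntidiagonal.mem_antidiagonal] at hp
        rw [← hp]
        exact jacobiFilt_left 𝒯 (dehom_mem_filt 𝒯 _ _) (hb _))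
      (fun {a b} ha n => by
        rw [dehom_mul]
        refine sum_mem fun p hp => ?_
        rw [Finset.HasAntidiagonal.mem_antidiagonal] at hp
        rw [← hp]
        exact jacobiFilt_right 𝒯 (dehom_mem_filt 𝒯 _ _) (ha _))
    have hle : idealOf (homogSet 𝒯 P) ≤ J := by
      refine TwoSidedIdeal.span_le.2 ?_
      rintro _ ⟨p, hp, rfl⟩
      refine (TwoSidedIdeal.mem_mk' _ _ _ _ _ _ _).2 fun n => ?_
      rw [homogenization_eq_homAt, dehom_homAt 𝒯 (mem_filt_topDegree 𝒯 p)]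
      split_ifs with h
      · exact mem_jacobiFilt_of_mem 𝒯 hp (h ▸ mem_filt_topDegree 𝒯 p)
      · exact zero_mem _
    exact (TwoSidedIdeal.mem_mk' _ _ _ _ _ _ _).1 (hle hf)
  · intro h
    have key : ∀ n, ∀ x ∈ jacobiFilt 𝒯 P n, homAt 𝒯 n x ∈ idealOf (homogSet 𝒯 P) := by
      intro n x hx
      refine Submodule.span_induction
        (p := fun x _ => homAt 𝒯 n x ∈ idealOf (homogSet 𝒯 P)) ?_ ?_ ?_ ?_ hx
      · rintro _ ⟨i, j, k, a, p, b, rfl, ha, hp, hpj, hb, rfl⟩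
        rw [homAt_mul 𝒯 (filt_mul_mem 𝒯 ha hpj) hb, homAt_mul 𝒯 ha hpj]
        refine TwoSidedIdeal.mul_mem_right _ _ _ (TwoSidedIdeal.mul_mem_left _ _ _ ?_)
        obtain ⟨l, hl⟩ := Nat.exists_eq_add_of_le (topDegree_le 𝒯 hpj)
        rw [hl, homAt_add 𝒯 (mem_filt_topDegree 𝒯 p), ← homogenization_eq_homAt]
        exact TwoSidedIdeal.mul_mem_left _ _ _ (TwoSidedIdeal.subset_span ⟨p, hp, rfl⟩)
      · rw [map_zero]; exact zero_mem _
      · intro x y _ _ hx hy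
        rw [map_add]
        exact add_mem hx hy
      · intro s x _ hx
        have h : homAt 𝒯 n (s • x) = Polynomial.C (s • (1 : T)) * homAt 𝒯 n x := by
          rw [homAt_smul]
          ext k
          simp
        rw [h]
        exact TwoSidedIdeal.mul_mem_left _ _ _ hx
    obtain ⟨N, hN⟩ := exists_eq_sum_homAt 𝒯 f
    rw [hN N le_rfl]
    exact sum_mem fun n _ => key n _ (h n)

end Homogenization

/-! ### The central extension `D(P)` as a graded ring -/

section CentralExtension

variable {S : Type u} {T : Type v} [Ring S] [Ring T] [Module S T] [IsScalarTower S T T]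

instance isScalarTower_quotRing (X : Set T) : IsScalarTower S (QuotRing X) (QuotRing X) :=
  ⟨fun s x y => by
    obtain ⟨a, rfl⟩ := Ideal.Quotient.mk_surjective x
    obtain ⟨b, rfl⟩ := Ideal.Quotient.mk_surjective y
    change Ideal.Quotient.mk _ ((s • a) * b) = Ideal.Quotient.mk _ (s • (a * b))
    rw [smul_mul_assoc]⟩

variable (𝒯 : ℕ → Submodule S T) [GradedRing 𝒯] (P : Submodule S T)

/-- The class of a polynomial in `D(P)`. -/
def toCentral : T[X] →ₗ[S] CentralExt 𝒯 P := toQuotₗ (homogSet 𝒯 P)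

theorem toCentral_surjective : Function.Surjective (toCentral 𝒯 P) :=
  Ideal.Quotient.mk_surjective

theorem toCentral_mul (f g : T[X]) :
    toCentral 𝒯 P (f * g) = toCentral 𝒯 P f * toCentral 𝒯 P g := rfl

theorem centralElt_mul (f : T[X]) :
    centralElt 𝒯 P * toCentral 𝒯 P f = toCentral 𝒯 P (Polynomial.X * f) := rfl

theorem centralElt_comm (d : CentralExt 𝒯 P) : centralElt 𝒯 P * d = d * centralElt 𝒯 P := by
  obtain ⟨f, rfl⟩ := toCentral_surjective 𝒯 P d
  rw [centralElt_mul, Polynomial.X_mul, toCentral_mul]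
  rfl

theorem toCentral_eq_zero {f : T[X]} :
    toCentral 𝒯 P f = 0 ↔ ∀ n, dehom 𝒯 n f ∈ jacobiFilt 𝒯 P n := by
  rw [← mem_idealOf_homogSet_iff]
  exact Ideal.Quotient.eq_zero_iff_mem.trans TwoSidedIdeal.mem_asIdeal

theorem toCentral_homAt_mem (n : ℕ) (t : T) :
    toCentral 𝒯 P (homAt 𝒯 n t) ∈ centralGrade 𝒯 P n := by
  rw [homAt_apply, map_sum]
  refine sum_mem fun p hp => Submodule.subset_span
    ⟨p.1, p.2, _, by simpa using hp, proj_mem 𝒯 _ _, rfl⟩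

theorem dehom_mem_of_mem_centralGrade {n : ℕ} {f : T[X]}
    (hf : toCentral 𝒯 P f ∈ centralGrade 𝒯 P n) {m : ℕ} (hm : m ≠ n) :
    dehom 𝒯 m f ∈ jacobiFilt 𝒯 P m := by
  have key : ∀ d ∈ centralGrade 𝒯 P n, ∃ g : T[X], toCentral 𝒯 P g = d ∧
      dehom 𝒯 m g ∈ jacobiFilt 𝒯 P m := by
    intro d hd
    refine Submodule.span_induction (p := fun d _ => ∃ g : T[X], toCentral 𝒯 P g = d ∧
      dehom 𝒯 m g ∈ jacobiFilt 𝒯 P m) ?_ ?_ ?_ ?_ hd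
    · rintro _ ⟨i, k, t, rfl, ht, rfl⟩
      refine ⟨Polynomial.monomial k t, rfl, ?_⟩
      rw [dehom_monomial ht, if_neg hm.symm]
      exact zero_mem _
    · exact ⟨0, map_zero _, by rw [map_zero]; exact zero_mem _⟩
    · rintro _ _ _ _ ⟨g, rfl, hg⟩ ⟨h, rfl, hh⟩
      exact ⟨g + h, map_add _ _ _, by rw [map_add]; exact add_mem hg hh⟩
    · rintro s _ _ ⟨g, rfl, hg⟩
      exact ⟨s • g, map_smul _ _ _, by rw [dehom_smul]; exact Submodule.smul_mem _ _ hg⟩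
  obtain ⟨g, hg, hgm⟩ := key _ hf
  have h := (toCentral_eq_zero 𝒯 P).1 (by rw [map_sub, hg, sub_self] :
    toCentral 𝒯 P (f - g) = 0) m
  rw [map_sub] at h
  simpa using add_mem h hgm

theorem mem_centralGrade_iff {n : ℕ} {f : T[X]} :
    toCentral 𝒯 P f ∈ centralGrade 𝒯 P n ↔ ∀ m, m ≠ n → dehom 𝒯 m f ∈ jacobiFilt 𝒯 P m := by
  refine ⟨fun h m hm => dehom_mem_of_mem_centralGrade 𝒯 P h hm, fun h => ?_⟩
  have h0 : toCentral 𝒯 P (f - homAt 𝒯 n (dehom 𝒯 n f)) = 0 := by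
    rw [toCentral_eq_zero]
    intro m
    rw [map_sub, dehom_homAt 𝒯 (dehom_mem_filt 𝒯 n f)]
    split_ifs with hm
    · rw [hm, sub_self]
      exact zero_mem _
    · rw [sub_zero]
      exact h m hm
  rw [map_sub, sub_eq_zero] at h0
  rw [h0]
  exact toCentral_homAt_mem 𝒯 P n _

instance gradedMonoid_centralGrade : SetLike.GradedMonoid (centralGrade 𝒯 P) where
  one_mem := Submodule.subset_span ⟨0, 0, 1, rfl, SetLike.GradedOne.one_mem, by simp⟩
  mul_mem := by
    intro i j x y hx hy
    obtain ⟨f, rfl⟩ := toCentral_surjective 𝒯 P x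
    obtain ⟨g, rfl⟩ := toCentral_surjective 𝒯 P y
    rw [← toCentral_mul]
    rw [mem_centralGrade_iff] at *
    intro m hm
    rw [dehom_mul]
    refine sum_mem fun p hp => ?_
    rw [Finset.HasAntidiagonal.mem_antidiagonal] at hp
    by_cases h : p.1 = i
    · rw [← hp]
      exact jacobiFilt_left 𝒯 (dehom_mem_filt 𝒯 _ _) (hy _ (by omega))
    · rw [← hp]
      exact jacobiFilt_right 𝒯 (dehom_mem_filt 𝒯 _ _) (hx _ h)

theorem isInternal_centralGrade : DirectSum.IsInternal (centralGrade 𝒯 P) := by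
  rw [DirectSum.isInternal_submodule_iff_iSupIndep_and_iSup_eq_top]
  constructor
  · rw [iSupIndep_def]
    intro n
    rw [Submodule.disjoint_def]
    intro d hd hd'
    obtain ⟨f, rfl⟩ := toCentral_surjective 𝒯 P d
    have hle : (⨆ j, ⨆ _ : j ≠ n, centralGrade 𝒯 P j) ≤
        ((jacobiFilt 𝒯 P n).comap ({ dehom 𝒯 n with map_smul' := dehom_smul 𝒯 n } :
          T[X] →ₗ[S] T)).map (toCentral 𝒯 P) := by
      refine iSup₂_le fun j hj d hd => ?_
      obtain ⟨g, rfl⟩ := toCentral_surjective 𝒯 P d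
      exact ⟨g, dehom_mem_of_mem_centralGrade 𝒯 P hd hj.symm, rfl⟩
    obtain ⟨g, hg, hgf⟩ := hle hd'
    have hg' : dehom 𝒯 n g ∈ jacobiFilt 𝒯 P n := hg
    rw [toCentral_eq_zero]
    intro m
    by_cases hm : m = n
    · subst hm
      have h := (toCentral_eq_zero 𝒯 P).1 (by rw [map_sub, hgf, sub_self] :
        toCentral 𝒯 P (f - g) = 0) m
      rw [map_sub] at h
      simpa using add_mem h hg'
    · exact dehom_mem_of_mem_centralGrade 𝒯 P hd hm
  · rw [eq_top_iff]
    rintro d -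
    obtain ⟨f, rfl⟩ := toCentral_surjective 𝒯 P d
    obtain ⟨N, hN⟩ := exists_eq_sum_homAt 𝒯 f
    rw [hN N le_rfl, map_sum]
    exact sum_mem fun n _ => Submodule.mem_iSup_of_mem n (toCentral_homAt_mem 𝒯 P n _)

instance gradedRing_centralGrade : GradedRing (centralGrade 𝒯 P) where
  toDecomposition := (isInternal_centralGrade 𝒯 P).chooseDecomposition

theorem centralElt_mem : centralElt 𝒯 P ∈ centralGrade 𝒯 P 1 :=
  Submodule.subset_span ⟨0, 1, 1, rfl, SetLike.GradedOne.one_mem, by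
    rw [Polynomial.monomial_one_one_eq_X]; rfl⟩

/-- `D(P)^n` is `T^{≤ n} / P_n`, and multiplication by `z` is induced by the inclusion of
`T^{≤ n}` into `T^{≤ n+1}`; hence the Jacobi condition says that `z` is injective on `D(P)^n`. -/
theorem jacobi_iff (n : ℕ) : Jacobi 𝒯 P n ↔
    ∀ d ∈ centralGrade 𝒯 P n, centralElt 𝒯 P * d = 0 → d = 0 := by
  constructor
  · intro hJ d hd hzd
    obtain ⟨f, rfl⟩ := toCentral_surjective 𝒯 P d
    rw [centralElt_mul, toCentral_eq_zero] at hzd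
    rw [toCentral_eq_zero]
    intro m
    by_cases hm : m = n
    · subst hm
      have h := hzd (m + 1)
      rw [dehom_X_mul_succ] at h
      exact hJ ⟨h, dehom_mem_filt 𝒯 _ _⟩
    · exact dehom_mem_of_mem_centralGrade 𝒯 P hd hm
  · rintro h x ⟨hx, hxn⟩
    have h0 := h _ (toCentral_homAt_mem 𝒯 P n x) (by
      rw [centralElt_mul, toCentral_eq_zero]
      intro m
      cases m with
      | zero => rw [dehom_X_mul_zero]; exact zero_mem _
      | succ m =>
        rw [dehom_X_mul_succ, dehom_homAt 𝒯 hxn]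
        split_ifs with hm
        · rw [hm]; exact hx
        · exact zero_mem _)
    have h1 := (toCentral_eq_zero 𝒯 P).1 h0 n
    rwa [dehom_homAt 𝒯 hxn, if_pos rfl] at h1

theorem toCentral_C_mem_of_mem_idealOf_leading {t : T}
    (ht : t ∈ idealOf (leading 𝒯 P : Set T)) :
    ∃ d, toCentral 𝒯 P (Polynomial.C t) = centralElt 𝒯 P * d := by
  let J : TwoSidedIdeal T := TwoSidedIdeal.mk'
    {t | ∃ d, toCentral 𝒯 P (Polynomial.C t) = centralElt 𝒯 P * d}
    ⟨0, by rw [map_zero, map_zero, mul_zero]⟩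
    (fun {a b} ⟨d, hd⟩ ⟨e, he⟩ => ⟨d + e, by rw [map_add, map_add, hd, he, mul_add]⟩)
    (fun {a} ⟨d, hd⟩ => ⟨-d, by rw [map_neg, map_neg, hd, mul_neg]⟩)
    (fun {a b} ⟨d, hd⟩ => ⟨toCentral 𝒯 P (Polynomial.C a) * d, by
      rw [map_mul, toCentral_mul, hd, ← mul_assoc, ← centralElt_comm, mul_assoc]⟩)
    (fun {a b} ⟨d, hd⟩ => ⟨d * toCentral 𝒯 P (Polynomial.C b), by
      rw [map_mul, toCentral_mul, hd, mul_assoc]⟩)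
  have hle : idealOf (leading 𝒯 P : Set T) ≤ J := by
    refine TwoSidedIdeal.span_le.2 ?_
    intro x hx
    refine (TwoSidedIdeal.mem_mk' _ _ _ _ _ _ _).2 ?_
    refine Submodule.span_induction (p := fun x _ => ∃ d,
      toCentral 𝒯 P (Polynomial.C x) = centralElt 𝒯 P * d) ?_ ?_ ?_ ?_ hx
    · rintro _ ⟨p, hp, rfl⟩
      have h0 : toCentral 𝒯 P (homogenization 𝒯 p) = 0 :=
        Ideal.Quotient.eq_zero_iff_mem.2 (TwoSidedIdeal.mem_asIdeal.2
          (TwoSidedIdeal.subset_span ⟨p, hp, rfl⟩))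
      have h1 : (homogenization 𝒯 p).coeff 0 = LH 𝒯 p := by
        unfold homogenization LH
        rw [Polynomial.finsetSum_coeff, Finset.sum_eq_single (topDegree 𝒯 p)]
        · simp
        · intro i hi hne
          rw [Finset.mem_range] at hi
          rw [Polynomial.coeff_monomial, if_neg (by omega)]
        · simp
      rw [← Polynomial.X_mul_divX_add (homogenization 𝒯 p), h1, map_add, ← centralElt_mul] at h0
      exact ⟨-_, by rw [mul_neg]; exact eq_neg_of_add_eq_zero_right h0⟩
    · exact ⟨0, by rw [map_zero, map_zero, mul_zero]⟩
    · rintro a b _ _ ⟨d, hd⟩ ⟨e, he⟩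
      exact ⟨d + e, by rw [map_add, map_add, hd, he, mul_add]⟩
    · rintro s a _ ⟨d, hd⟩
      refine ⟨s • d, ?_⟩
      rw [← Polynomial.smul_C, map_smul, hd]
      obtain ⟨f, rfl⟩ := toCentral_surjective 𝒯 P d
      rw [← map_smul, centralElt_mul, centralElt_mul, Polynomial.X_mul,
        Polynomial.X_mul, smul_mul_assoc, map_smul]
  have h := hle ht
  simp only [J] at h
  rw [TwoSidedIdeal.mem_mk'] at h
  exact h

end CentralExtension

/-! ### The PBW property and the Jacobi conditions -/

section PBWProperty

variable {S : Type u} {T : Type v} [Ring S] [Ring T] [Module S T] [IsScalarTower S T T]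
variable (𝒯 : ℕ → Submodule S T) [GradedRing 𝒯] (P R : Submodule S T)

theorem toQuotₗ_eq_zero {X : Set T} {t : T} :
    toQuotₗ (S := S) X t = 0 ↔ t ∈ idealOf X :=
  (Ideal.Quotient.eq_zero_iff_mem (I := TwoSidedIdeal.asIdeal (idealOf X))).trans
    TwoSidedIdeal.mem_asIdeal

theorem toGr_eq_zero {n : ℕ} {x : 𝒯 n} : toGr 𝒯 P n x = 0 ↔
    ∃ y ∈ filtLT 𝒯 n, x.1 - y ∈ idealOf (P : Set T) := by
  rw [toGr, Submodule.Quotient.mk_eq_zero]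
  constructor
  · rintro ⟨y, hy, hxy⟩
    refine ⟨y, hy, toQuotₗ_eq_zero (S := S).1 ?_⟩
    rw [map_sub, hxy]
    exact sub_self _
  · rintro ⟨y, hy, hxy⟩
    refine ⟨y, hy, ?_⟩
    have h := toQuotₗ_eq_zero (S := S).2 hxy
    rw [map_sub, sub_eq_zero] at h
    exact h.symm

/-- `U(P)` is a PBW-deformation if and only if the leading components of degree `n` of the elements
of `⟨P⟩` are exactly the homogeneous elements of `⟨R⟩` of degree `n`. -/
theorem isPBWDeformation_iff : IsPBWDeformation 𝒯 P R ↔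
    ∀ n, ∀ x ∈ 𝒯 n, (x ∈ idealOf (R : Set T) ↔
      ∃ y ∈ filtLT 𝒯 n, x - y ∈ idealOf (P : Set T)) := by
  constructor
  · intro h n x hx
    obtain ⟨Φ, hΦ⟩ := h n
    rw [← toGr_eq_zero 𝒯 P (x := ⟨x, hx⟩), ← hΦ, LinearEquiv.map_eq_zero_iff, ← toQuotₗ_eq_zero (S := S)]
    exact ⟨fun h => Subtype.ext h, fun h => congrArg Subtype.val h⟩
  · intro h n
    let f : 𝒯 n →ₗ[S] homogPiece 𝒯 R n :=
      ((toQuotₗ (R : Set T)).comp (𝒯 n).subtype).codRestrict _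
        (fun x => Submodule.mem_map_of_mem x.2)
    let g : 𝒯 n →ₗ[S] grDeform 𝒯 P n :=
      (Submodule.mkQ _).comp (((toQuotₗ (P : Set T)).comp (𝒯 n).subtype).codRestrict _
        (fun x => Submodule.mem_map_of_mem (mem_filt_of_mem 𝒯 le_rfl x.2)))
    have hf : Function.Surjective f := by
      rintro ⟨_, x, hx, rfl⟩
      exact ⟨⟨x, hx⟩, rfl⟩
    have hg : Function.Surjective g := by
      intro q
      obtain ⟨⟨_, x, hx, rfl⟩, rfl⟩ := Submodule.Quotient.mk_surjective _ q
      refine ⟨⟨GradedRing.proj 𝒯 n x, proj_mem 𝒯 n x⟩, ?_⟩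
      refine (Submodule.Quotient.eq _).2 ?_
      rw [← neg_mem_iff]
      refine ⟨x - GradedRing.proj 𝒯 n x, filt_sub_proj 𝒯 hx, ?_⟩
      rw [map_sub]
      simp
      rfl
    have hker : LinearMap.ker f = LinearMap.ker g := by
      ext x
      rw [LinearMap.mem_ker, LinearMap.mem_ker]
      change _ ↔ toGr 𝒯 P n x = 0
      rw [toGr_eq_zero, ← h n x.1 x.2, ← toQuotₗ_eq_zero (S := S)]
      exact Subtype.ext_iff
    refine ⟨(f.quotKerEquivOfSurjective hf).symm.trans
      ((Submodule.quotEquivOfEq _ _ hker).trans (g.quotKerEquivOfSurjective hg)), fun x => ?_⟩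
    have h1 : (f.quotKerEquivOfSurjective hf).symm (f x) = Submodule.Quotient.mk x := by
      rw [LinearEquiv.symm_apply_eq]
      rfl
    change (g.quotKerEquivOfSurjective hg) ((Submodule.quotEquivOfEq _ _ hker)
      ((f.quotKerEquivOfSurjective hf).symm (f x))) = g x
    rw [h1]
    rfl

theorem jacobiFilt_le_idealOf {n : ℕ} {x : T} (hx : x ∈ jacobiFilt 𝒯 P n) :
    x ∈ idealOf (P : Set T) := by
  refine Submodule.span_induction (p := fun x _ => x ∈ idealOf (P : Set T)) ?_ ?_ ?_ ?_ hx
  · rintro _ ⟨i, j, k, a, p, b, -, -, hp, -, -, rfl⟩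
    exact TwoSidedIdeal.mul_mem_right _ _ _ (TwoSidedIdeal.mul_mem_left _ _ _
      (TwoSidedIdeal.subset_span hp))
  · exact zero_mem _
  · exact fun _ _ _ _ => add_mem
  · intro s x _ hx
    rw [← one_mul x, ← smul_mul_assoc]
    exact TwoSidedIdeal.mul_mem_left _ _ _ hx

theorem exists_mem_jacobiFilt {x : T} (hx : x ∈ idealOf (P : Set T)) :
    ∃ n, x ∈ jacobiFilt 𝒯 P n := by
  let J : TwoSidedIdeal T := TwoSidedIdeal.mk' {x | ∃ n, x ∈ jacobiFilt 𝒯 P n}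
    ⟨0, zero_mem _⟩
    (fun {a b} ⟨m, hm⟩ ⟨n, hn⟩ => ⟨max m n, add_mem (jacobiFilt_mono 𝒯 P (le_max_left _ _) hm)
      (jacobiFilt_mono 𝒯 P (le_max_right _ _) hn)⟩)
    (fun {a} ⟨m, hm⟩ => ⟨m, neg_mem hm⟩)
    (fun {a b} ⟨m, hm⟩ => by
      obtain ⟨n, hn⟩ := exists_mem_filt 𝒯 a
      exact ⟨n + m, jacobiFilt_left 𝒯 hn hm⟩)
    (fun {a b} ⟨m, hm⟩ => by
      obtain ⟨n, hn⟩ := exists_mem_filt 𝒯 b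
      exact ⟨m + n, jacobiFilt_right 𝒯 hn hm⟩)
  have hle : idealOf (P : Set T) ≤ J := by
    refine TwoSidedIdeal.span_le.2 fun p hp => (TwoSidedIdeal.mem_mk' _ _ _ _ _ _ _).2 ?_
    obtain ⟨n, hn⟩ := exists_mem_filt 𝒯 p
    exact ⟨n, mem_jacobiFilt_of_mem 𝒯 hp hn⟩
  have h := hle hx
  simp only [J] at h
  rw [TwoSidedIdeal.mem_mk'] at h
  exact h

theorem mem_jacobiFilt_of_jacobi (h : ∀ n, Jacobi 𝒯 P n) {n : ℕ} {x : T}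
    (hx : x ∈ idealOf (P : Set T)) (hn : x ∈ filt 𝒯 n) : x ∈ jacobiFilt 𝒯 P n := by
  obtain ⟨m, hm⟩ := exists_mem_jacobiFilt 𝒯 P hx
  have h2 : ∀ k, x ∈ jacobiFilt 𝒯 P (n + k) → x ∈ jacobiFilt 𝒯 P n := by
    intro k
    induction k with
    | zero => exact id
    | succ k ih => exact fun hk => ih (h (n + k) ⟨hk, filt_mono 𝒯 (by omega) hn⟩)
  exact h2 m (jacobiFilt_mono 𝒯 P (by omega) hm)

theorem LH_mem_leading' {p : T} (hp : p ∈ P) : LH 𝒯 p ∈ leading 𝒯 P :=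
  Submodule.subset_span ⟨p, hp, rfl⟩

/-- The homogeneous elements of degree `n` of `⟨R_P⟩` are the leading components of the elements
of `P_n`. -/
theorem proj_jacobiFilt_mem {n : ℕ} {x : T} (hx : x ∈ jacobiFilt 𝒯 P n) :
    GradedRing.proj 𝒯 n x ∈ idealOf (leading 𝒯 P : Set T) := by
  refine Submodule.span_induction
    (p := fun x _ => GradedRing.proj 𝒯 n x ∈ idealOf (leading 𝒯 P : Set T)) ?_ ?_ ?_ ?_ hx
  · rintro _ ⟨i, j, k, a, p, b, rfl, ha, hp, hpj, hb, rfl⟩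
    have hp' : GradedRing.proj 𝒯 j p ∈ idealOf (leading 𝒯 P : Set T) := by
      by_cases h : GradedRing.proj 𝒯 j p = 0
      · rw [h]; exact zero_mem _
      · have h1 := TwoSidedIdeal.subset_span (LH_mem_leading' 𝒯 P hp)
        rwa [LH, topDegree_eq 𝒯 hpj h] at h1
    have hap : GradedRing.proj 𝒯 (i + j) (a * p) =
        GradedRing.proj 𝒯 i a * GradedRing.proj 𝒯 j p := by
      rw [proj_mul, Finset.sum_eq_single_of_mem (i, j) (by simp)]
      rintro ⟨i', j'⟩ hij hne
      rw [Finset.HasAntidiagonal.mem_antidiagonal] at hij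
      by_cases h : i < i'
      · rw [(mem_filt_iff 𝒯).1 ha _ h, zero_mul]
      · have h2 : j < j' := by
          by_contra h3
          simp only at hij
          exact hne (by ext <;> simp <;> omega)
        rw [(mem_filt_iff 𝒯).1 hpj _ h2, mul_zero]
    have hapb : GradedRing.proj 𝒯 (i + j + k) (a * p * b) =
        GradedRing.proj 𝒯 (i + j) (a * p) * GradedRing.proj 𝒯 k b := by
      rw [proj_mul, Finset.sum_eq_single_of_mem (i + j, k) (by simp)]
      rintro ⟨i', j'⟩ hij hne
      rw [Finset.HasAntidiagonal.mem_antidiagonal] at hij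
      by_cases h : i + j < i'
      · rw [(mem_filt_iff 𝒯).1 (filt_mul_mem 𝒯 ha hpj) _ h, zero_mul]
      · have h2 : k < j' := by
          by_contra h3
          simp only at hij
          exact hne (by ext <;> simp <;> omega)
        rw [(mem_filt_iff 𝒯).1 hb _ h2, mul_zero]
    rw [hapb, hap]
    exact TwoSidedIdeal.mul_mem_right _ _ _ (TwoSidedIdeal.mul_mem_left _ _ _ hp')
  · rw [map_zero]; exact zero_mem _
  · intro x y _ _ hx hy
    rw [map_add]; exact add_mem hx hy
  · intro s x _ hx
    rw [proj_smul, ← one_mul (GradedRing.proj 𝒯 n x), ← smul_mul_assoc]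
    exact TwoSidedIdeal.mul_mem_left _ _ _ hx

theorem exists_jacobiFilt_of_mem_idealOf_leading {n : ℕ} {x : T}
    (hx : x ∈ idealOf (leading 𝒯 P : Set T)) :
    ∃ y ∈ jacobiFilt 𝒯 P n, GradedRing.proj 𝒯 n x = GradedRing.proj 𝒯 n y := by
  obtain ⟨d, hd⟩ := toCentral_C_mem_of_mem_idealOf_leading 𝒯 P hx
  obtain ⟨f, rfl⟩ := toCentral_surjective 𝒯 P d
  rw [centralElt_mul, ← sub_eq_zero, ← map_sub, toCentral_eq_zero] at hd
  refine ⟨_, hd n, ?_⟩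
  -- the component of degree `n` of `z f` is `z` times one of degree `n - 1`
  have h1 : GradedRing.proj 𝒯 n (dehom 𝒯 n (Polynomial.X * f)) = 0 := by
    cases n with
    | zero => rw [dehom_X_mul_zero, map_zero]
    | succ n =>
      rw [dehom_X_mul_succ]
      exact (mem_filt_iff 𝒯).1 (dehom_mem_filt 𝒯 n f) _ (by omega)
  have h2 : dehom 𝒯 n (Polynomial.C x) = GradedRing.proj 𝒯 n x := by
    rw [dehom_apply, Finset.sum_eq_single_of_mem (n, 0) (by simp)]
    · simp
    · rintro ⟨a, b⟩ hab hne
      rw [Finset.HasAntidiagonal.mem_antidiagonal] at hab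
      have : b ≠ 0 := fun h => hne (by simp only at hab; ext <;> simp <;> omega)
      simp [Polynomial.coeff_C, this]
  rw [map_sub, map_sub, h1, sub_zero, h2, proj_of_mem (proj_mem 𝒯 n x), if_pos rfl]

/-- `U(P)` is a PBW-deformation if and only if `⟨R⟩ = ⟨R_P⟩` and `z` is regular on `D(P)`, the
latter being expressed by the Jacobi conditions. -/
theorem isPBWDeformation_iff_jacobi (hRP : R ≤ leading 𝒯 P) :
    IsPBWDeformation 𝒯 P R ↔
      idealOf (R : Set T) = idealOf (leading 𝒯 P : Set T) ∧ ∀ n, Jacobi 𝒯 P n := by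
  have hRI : idealOf (R : Set T) ≤ idealOf (leading 𝒯 P : Set T) := TwoSidedIdeal.span_mono hRP
  rw [isPBWDeformation_iff]
  constructor
  · intro h
    have heq : idealOf (R : Set T) = idealOf (leading 𝒯 P : Set T) := by
      refine le_antisymm hRI (TwoSidedIdeal.span_le.2 ?_)
      intro x hx
      refine Submodule.span_induction (p := fun x _ => x ∈ idealOf (R : Set T)) ?_ ?_ ?_ ?_ hx
      · rintro _ ⟨p, hp, rfl⟩
        refine (h _ _ (proj_mem 𝒯 _ p)).2 ⟨LH 𝒯 p - p, ?_, ?_⟩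
        · rw [← neg_mem_iff, neg_sub]
          exact filt_sub_proj 𝒯 (mem_filt_topDegree 𝒯 p)
        · rw [LH, sub_sub_cancel]
          exact TwoSidedIdeal.subset_span hp
      · exact zero_mem _
      · exact fun _ _ _ _ => add_mem
      · intro s x _ hx
        rw [← one_mul x, ← smul_mul_assoc]
        exact TwoSidedIdeal.mul_mem_left _ _ _ hx
    refine ⟨heq, ?_⟩
    have key : ∀ n, ∀ x ∈ idealOf (P : Set T), x ∈ filtLT 𝒯 n →
        ∀ m, n ≤ m + 1 → x ∈ jacobiFilt 𝒯 P m := by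
      intro n
      induction n with
      | zero =>
        intro x _ hx m _
        rw [filtLT_zero, Submodule.mem_bot] at hx
        rw [hx]
        exact zero_mem _
      | succ n ih =>
        intro x hx hxn m hm
        rw [filtLT_succ] at hxn
        have h1 : GradedRing.proj 𝒯 n x ∈ idealOf (R : Set T) := by
          refine (h n _ (proj_mem 𝒯 n x)).2 ⟨GradedRing.proj 𝒯 n x - x, ?_, ?_⟩
          · rw [← neg_mem_iff, neg_sub]
            exact filt_sub_proj 𝒯 hxn
          · rwa [sub_sub_cancel]
        rw [heq] at h1
        obtain ⟨y, hy, hxy⟩ := exists_jacobiFilt_of_mem_idealOf_leading 𝒯 P (n := n) h1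
        rw [proj_of_mem (proj_mem 𝒯 n x), if_pos rfl] at hxy
        have h2 : x - y ∈ filtLT 𝒯 n := by
          have h3 := sub_mem (filt_sub_proj 𝒯 hxn)
            (filt_sub_proj 𝒯 (jacobiFilt_le_filt 𝒯 P n hy))
          rwa [hxy, sub_sub_sub_cancel_right] at h3
        have h4 := ih (x - y) (sub_mem hx (jacobiFilt_le_idealOf 𝒯 P hy)) h2 m (by omega)
        have h5 := add_mem h4 (jacobiFilt_mono 𝒯 P (by omega : n ≤ m) hy)
        rwa [sub_add_cancel] at h5
    rintro n x ⟨hx, hxn⟩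
    exact key (n + 1) x (jacobiFilt_le_idealOf 𝒯 P hx) (by rwa [filtLT_succ]) n le_rfl
  · rintro ⟨heq, hJ⟩ n x hx
    constructor
    · intro hxR
      rw [heq] at hxR
      obtain ⟨y, hy, hxy⟩ := exists_jacobiFilt_of_mem_idealOf_leading 𝒯 P (n := n) hxR
      rw [proj_of_mem hx, if_pos rfl] at hxy
      refine ⟨x - y, ?_, ?_⟩
      · rw [hxy, ← neg_mem_iff, neg_sub]
        exact filt_sub_proj 𝒯 (jacobiFilt_le_filt 𝒯 P n hy)
      · rw [sub_sub_cancel]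
        exact jacobiFilt_le_idealOf 𝒯 P hy
    · rintro ⟨y, hy, hxy⟩
      have hyn : y ∈ filt 𝒯 n := by
        rw [← filtLT_succ]
        rw [mem_filtLT_iff] at hy ⊢
        exact fun i hi => hy i (by omega)
      have h1 := mem_jacobiFilt_of_jacobi 𝒯 P hJ hxy
        (sub_mem (mem_filt_of_mem 𝒯 le_rfl hx) hyn)
      have h2 := proj_jacobiFilt_mem 𝒯 P h1
      rw [map_sub, (mem_filtLT_iff 𝒯).1 hy n le_rfl, sub_zero, proj_of_mem hx, if_pos rfl] at h2
      rw [heq]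
      exact h2

end PBWProperty

/-! ### The tensor product `B ⊗_S V` -/

section TensorTools

variable {S : Type u} {B : Type v} {V : Type w} [Ring S] [Ring B] [Module S B]
  [AddCommGroup V] [Module S V]

theorem tmul_add (b : B) (v v' : V) :
    tmul (S := S) b (v + v') = tmul b v + tmul b v' := by
  simp only [tmul, TensorProduct.tmul_add, map_add]

theorem add_tmul (b b' : B) (v : V) :
    tmul (S := S) (b + b') v = tmul b v + tmul b' v := by
  simp only [tmul, TensorProduct.add_tmul, map_add]

theorem tmul_zero (b : B) : tmul (S := S) b (0 : V) = 0 := by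
  simp only [tmul, TensorProduct.tmul_zero, map_zero]

theorem zero_tmul (v : V) : tmul (S := S) (0 : B) v = 0 := by
  simp only [tmul, TensorProduct.zero_tmul, map_zero]

theorem smul_tmul (b c : B) (v : V) : b • tmul (S := S) c v = tmul (b * c) v := by
  rw [tmul, ← map_smul, TensorProduct.smul_tmul']
  rfl

theorem tmul_smul (b : B) (s : S) (v : V) :
    tmul (S := S) b (s • v) = tmul (b * (s • (1 : B))) v := by
  symm
  rw [← sub_eq_zero, tmul, tmul, ← map_sub]
  exact (Submodule.Quotient.mk_eq_zero _).2 (Submodule.subset_span ⟨b, s, v, rfl⟩)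

theorem tmul_eq_smul (b : B) (v : V) : tmul (S := S) b v = b • tmul 1 v := by
  rw [smul_tmul, mul_one]

theorem BTensor.induction {p : BTensor S B V → Prop} (h0 : p 0)
    (ht : ∀ b v, p (tmul b v)) (hadd : ∀ x y, p x → p y → p (x + y)) (x : BTensor S B V) : p x := by
  obtain ⟨x, rfl⟩ := Submodule.Quotient.mk_surjective _ x
  induction x with
  | zero => exact h0
  | tmul b v => exact ht b v
  | add x y hx hy => exact hadd _ _ hx hy

theorem BTensor.hom_ext {M : Type*} [AddCommGroup M] [Module B M] {f g : BTensor S B V →ₗ[B] M}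
    (h : ∀ v, f (tmul 1 v) = g (tmul 1 v)) : f = g := by
  refine LinearMap.ext fun x => ?_
  induction x using BTensor.induction with
  | h0 => rw [map_zero, map_zero]
  | ht b v => rw [tmul_eq_smul, map_smul, map_smul, h]
  | hadd x y hx hy => rw [map_add, map_add, hx, hy]

/-- The additive map on `B ⊗_S V` induced by an `S`-balanced biadditive map. -/
def tensorLiftAdd {M : Type*} [AddCommGroup M] (f : B →+ V →+ M)
    (hf : ∀ b (s : S) v, f (b * (s • (1 : B))) v = f b (s • v)) : BTensor S B V →+ M :=
  QuotientAddGroup.lift (balance S B V).toAddSubgroup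
    (TensorProduct.liftAddHom f (fun n b v => by
      rw [map_zsmul, map_zsmul, AddMonoidHom.zsmul_apply])) (by
    intro x hx
    have hx' : x ∈ balance S B V := hx
    -- the relations are stable under left multiplication
    have key : ∀ b : B, TensorProduct.liftAddHom f (fun n b v => by
        rw [map_zsmul, map_zsmul, AddMonoidHom.zsmul_apply]) (b • x) = 0 := by
      refine Submodule.span_induction (p := fun x _ => ∀ b : B, TensorProduct.liftAddHom f
        (fun n b v => by rw [map_zsmul, map_zsmul, AddMonoidHom.zsmul_apply]) (b • x) = 0)
        ?_ ?_ ?_ ?_ hx'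
      · rintro _ ⟨b, s, v, rfl⟩ c
        rw [smul_sub, map_sub, TensorProduct.smul_tmul', TensorProduct.smul_tmul',
          TensorProduct.liftAddHom_tmul, TensorProduct.liftAddHom_tmul, smul_eq_mul, smul_eq_mul,
          ← mul_assoc, hf, sub_self]
      · intro b
        rw [smul_zero, map_zero]
      · intro x y _ _ hx hy b
        rw [smul_add, map_add, hx, hy, add_zero]
      · intro c x _ hx b
        rw [← mul_smul]
        exact hx _
    have h1 := key 1
    rwa [one_smul] at h1)

theorem tensorLiftAdd_tmul {M : Type*} [AddCommGroup M] (f : B →+ V →+ M)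
    (hf : ∀ b (s : S) v, f (b * (s • (1 : B))) v = f b (s • v)) (b : B) (v : V) :
    tensorLiftAdd (S := S) f hf (tmul b v) = f b v := by
  exact TensorProduct.liftAddHom_tmul (R := ℤ) f (fun n b v => by
    rw [map_zsmul, map_zsmul, AddMonoidHom.zsmul_apply]) b v

section Scalar

variable [IsScalarTower S B B]

instance isScalarTower_bTensor : IsScalarTower S B (BTensor S B V) :=
  ⟨fun s b x => by
    induction x using BTensor.induction with
    | h0 => simp only [smul_zero]
    | ht c v =>
      rw [smul_tmul, smul_tmul, smul_mul_assoc]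
      rfl
    | hadd x y hx hy => rw [smul_add, hx, hy, smul_add, smul_add]⟩

theorem smul_one_smul' {M : Type*} [AddCommGroup M] [Module B M] [Module S M]
    [IsScalarTower S B M] (s : S) (m : M) : (s • (1 : B)) • m = s • m := by
  rw [smul_assoc, one_smul]

variable (B) in
/-- The map `v ↦ 1 ⊗ v`. -/
def oneTmul : V →ₗ[S] BTensor S B V where
  toFun v := tmul 1 v
  map_add' v v' := tmul_add 1 v v'
  map_smul' s v := by
    rw [tmul_smul, one_mul, tmul_eq_smul, smul_one_smul', RingHom.id_apply]

theorem oneTmul_apply (v : V) : oneTmul (S := S) B v = tmul 1 v := rfl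

theorem tensorLift_tmul_one {M : Type*} [AddCommGroup M] [Module B M] [Module S M]
    [IsScalarTower S B M] (f : V →ₗ[S] M) (v : V) :
    tensorLift (B := B) f (tmul 1 v) = f v := by rw [tensorLift_tmul, one_smul]

end Scalar

section Map

variable {C : Type x} [Ring C] [Module S C] (π : SRingHom S B C)

theorem SRingHom.map_smul_one (s : S) : π.toRingHom (s • (1 : B)) = s • (1 : C) := by
  have h := π.map_smul' s 1
  have h1 : π.toFun 1 = 1 := map_one π.toRingHom
  rw [h1] at h
  exact h

theorem tensorMap_smul (b : B) (x : BTensor S B V) :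
    tensorMap π (b • x) = π.toRingHom b • tensorMap π x := by
  induction x using BTensor.induction with
  | h0 => rw [smul_zero, map_zero, smul_zero]
  | ht c v => rw [smul_tmul, tensorMap_tmul, tensorMap_tmul, smul_tmul, map_mul]
  | hadd x y hx hy => rw [smul_add, map_add, hx, hy, map_add, smul_add]

theorem tensorMap_surjective (hπ : Function.Surjective π.toRingHom) :
    Function.Surjective (tensorMap (V := V) π) := by
  intro y
  induction y using BTensor.induction with
  | h0 => exact ⟨0, map_zero _⟩
  | ht c v =>
    obtain ⟨b, rfl⟩ := hπ c
    exact ⟨tmul b v, tensorMap_tmul _ _ _⟩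
  | hadd x y hx hy =>
    obtain ⟨x, rfl⟩ := hx
    obtain ⟨y, rfl⟩ := hy
    exact ⟨x + y, map_add _ _ _⟩

end Map

/-! ### Coordinates on `B ⊗_S V` for projective `V` -/

section Coordinates

variable [Module.Projective S V]

variable (S V) in
/-- A splitting of the canonical map from the free module on `V` onto the projective module `V`. -/
def dualBasis : V →ₗ[S] (V →₀ S) := (Module.Projective.out (R := S) (P := V)).choose

theorem linearCombination_dualBasis (v : V) :
    Finsupp.linearCombination S id (dualBasis S V v) = v :=
  (Module.Projective.out (R := S) (P := V)).choose_spec v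

variable [IsScalarTower S B B]

/-- The coordinates of an element of `B ⊗_S V` with respect to a dual basis of the projective
module `V`; it is a section of `c ↦ ∑ c(v) ⊗ v`. -/
def coord : BTensor S B V →ₗ[B] (V →₀ B) :=
  tensorLift ((Finsupp.mapRange.linearMap (LinearMap.toSpanSingleton S B 1)).comp (dualBasis S V))

theorem coord_tmul (b : B) (v w : V) :
    coord (tmul (S := S) b v) w = b * (dualBasis S V v w • (1 : B)) := by
  rw [coord, tensorLift_tmul]
  simp

theorem linearCombination_coord (x : BTensor S B V) :
    Finsupp.linearCombination B (oneTmul (S := S) (V := V) B) (coord x) = x := by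
  have h : (Finsupp.linearCombination B (oneTmul (S := S) (V := V) B)).comp coord =
      LinearMap.id := by
    refine BTensor.hom_ext fun v => ?_
    rw [LinearMap.comp_apply, coord, tensorLift_tmul_one, LinearMap.id_apply]
    change Finsupp.linearCombination B _ (Finsupp.mapRange.linearMap _ _) = oneTmul B v
    conv_rhs => rw [← linearCombination_dualBasis (S := S) v]
    rw [Finsupp.linearCombination_apply, Finsupp.linearCombination_apply,
      Finsupp.mapRange.linearMap_apply, Finsupp.sum_mapRange_index (by simp), map_finsuppSum]
    refine Finsupp.sum_congr fun w _ => ?_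
    rw [LinearMap.toSpanSingleton_apply, map_smul, smul_one_smul']
    rfl
  exact LinearMap.congr_fun h x

variable {C : Type x} [Ring C] [Module S C] [IsScalarTower S C C] (π : SRingHom S B C)

theorem coord_tensorMap (x : BTensor S B V) (w : V) :
    coord (tensorMap π x) w = π.toRingHom (coord x w) := by
  induction x using BTensor.induction with
  | h0 => simp
  | ht b v => rw [tensorMap_tmul, coord_tmul, coord_tmul, map_mul, π.map_smul_one]
  | hadd x y hx hy => simp only [map_add, Finsupp.add_apply, hx, hy]

/-- If `ker π = z B`, then the kernel of `π ⊗ V` is `z (B ⊗ V)`. -/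
theorem exists_smul_of_tensorMap_eq_zero {z : B}
    (hker : ∀ b, π.toRingHom b = 0 → ∃ c, b = z * c)
    {x : BTensor S B V} (hx : tensorMap π x = 0) : ∃ y, x = z • y := by
  rw [← linearCombination_coord x, Finsupp.linearCombination_apply, Finsupp.sum]
  refine Finset.sum_induction _ (fun x => ∃ y, x = z • y) ?_ ⟨0, (smul_zero _).symm⟩ ?_
  · rintro _ _ ⟨a, rfl⟩ ⟨b, rfl⟩
    exact ⟨a + b, (smul_add _ _ _).symm⟩
  · intro w _
    obtain ⟨c, hc⟩ := hker (coord x w) (by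
      rw [← coord_tensorMap, hx, map_zero, Finsupp.zero_apply])
    exact ⟨c • oneTmul B w, by rw [hc, mul_smul]⟩

end Coordinates

/-! ### Gradings on `B ⊗_S V` and graded lifts -/

section TensorGrade

variable [IsScalarTower S B B] (ℬ : ℕ → Submodule S B) (𝒱 : ℕ → Submodule S V)

variable {ℬ 𝒱} in
theorem tmul_mem_tensorGrade {i j n : ℕ} (h : i + j = n) {b : B} {v : V} (hb : b ∈ ℬ i)
    (hv : v ∈ 𝒱 j) : tmul b v ∈ tensorGrade ℬ 𝒱 n :=
  AddSubgroup.subset_closure ⟨i, j, b, v, h, hb, hv, rfl⟩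

theorem smul_mem_tensorGrade [SetLike.GradedMonoid ℬ] {i n : ℕ} {b : B} {x : BTensor S B V}
    (hb : b ∈ ℬ i) (hx : x ∈ tensorGrade ℬ 𝒱 n) : b • x ∈ tensorGrade ℬ 𝒱 (i + n) := by
  refine AddSubgroup.closure_induction (p := fun x _ => b • x ∈ tensorGrade ℬ 𝒱 (i + n))
    ?_ ?_ ?_ ?_ hx
  · rintro _ ⟨k, j, c, v, rfl, hc, hv, rfl⟩
    rw [smul_tmul]
    exact tmul_mem_tensorGrade (add_assoc i k j) (SetLike.GradedMul.mul_mem hb hc) hv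
  · rw [smul_zero]; exact zero_mem _
  · intro x y _ _ hx hy
    rw [smul_add]; exact add_mem hx hy
  · intro x _ hx
    rw [smul_neg]; exact neg_mem hx

/-- The degree `n` part of `B ⊗_S V` as an `S`-submodule. -/
def tensorGradeₛ [SetLike.GradedMonoid ℬ] (n : ℕ) : Submodule S (BTensor S B V) :=
  { tensorGrade ℬ 𝒱 n with
    smul_mem' := fun s x hx => by
      have h := smul_mem_tensorGrade ℬ 𝒱
        (Submodule.smul_mem (ℬ 0) s SetLike.GradedOne.one_mem) hx
      rw [zero_add, smul_one_smul'] at h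
      exact h }

/-- A `B`-linear map on `B ⊗ V` is homogeneous of degree `-k` if it is so on the generators
`1 ⊗ v`. -/
theorem map_mem_of_forall_tmul_one {M : Type*} [AddCommGroup M] [Module B M]
    {f : BTensor S B V →ₗ[B] M} {𝒩 : ℕ → AddSubgroup M}
    (h𝒩 : ∀ i n b m, b ∈ ℬ i → m ∈ 𝒩 n → b • m ∈ 𝒩 (i + n)) {k : ℕ}
    (h0 : ∀ j, j < k → 𝒱 j = ⊥)
    (h : ∀ j, k ≤ j → ∀ v ∈ 𝒱 j, f (tmul 1 v) ∈ 𝒩 (j - k)) {n : ℕ} {x : BTensor S B V}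
    (hx : x ∈ tensorGrade ℬ 𝒱 (n + k)) : f x ∈ 𝒩 n := by
  refine AddSubgroup.closure_induction (p := fun x _ => f x ∈ 𝒩 n) ?_ ?_ ?_ ?_ hx
  · rintro _ ⟨i, j, c, v, hij, hc, hv, rfl⟩
    rw [tmul_eq_smul, map_smul]
    by_cases hj : j < k
    · rw [h0 j hj, Submodule.mem_bot] at hv
      rw [hv, tmul_zero, map_zero, smul_zero]
      exact zero_mem _
    · have h2 := h𝒩 i (j - k) c _ hc (h j (by omega) v hv)
      rwa [show i + (j - k) = n by omega] at h2
  · rw [map_zero]; exact zero_mem _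
  · intro x y _ _ hx hy
    rw [map_add]; exact add_mem hx hy
  · intro x _ hx
    rw [map_neg]; exact neg_mem hx

variable {ℬ 𝒱} in
theorem tensorMap_mem_tensorGrade {C : Type x} [Ring C] [Module S C]
    [IsScalarTower S C C] (π : SRingHom S B C)
    {𝒞 : ℕ → Submodule S C} (h : ∀ n, ∀ b ∈ ℬ n, π.toRingHom b ∈ 𝒞 n) {n : ℕ}
    {x : BTensor S B V} (hx : x ∈ tensorGrade ℬ 𝒱 n) : tensorMap π x ∈ tensorGrade 𝒞 𝒱 n := by
  refine AddSubgroup.closure_induction (p := fun x _ => tensorMap π x ∈ tensorGrade 𝒞 𝒱 n)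
    ?_ ?_ ?_ ?_ hx
  · rintro _ ⟨i, j, b, v, hij, hb, hv, rfl⟩
    rw [tensorMap_tmul]
    exact tmul_mem_tensorGrade hij (h i b hb) hv
  · rw [map_zero]; exact zero_mem _
  · intro x y _ _ hx hy
    rw [map_add]; exact add_mem hx hy
  · intro x _ hx
    rw [map_neg]; exact neg_mem hx

theorem exists_tensorGrade_lift {C : Type x} [Ring C] [Module S C] (π : SRingHom S B C)
    {𝒞 : ℕ → Submodule S C} (hπ : ∀ n, ∀ c ∈ 𝒞 n, ∃ b ∈ ℬ n, π.toRingHom b = c) {n : ℕ}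
    {y : BTensor S C V} (hy : y ∈ tensorGrade 𝒞 𝒱 n) :
    ∃ x ∈ tensorGrade ℬ 𝒱 n, tensorMap π x = y := by
  refine AddSubgroup.closure_induction
    (p := fun y _ => ∃ x ∈ tensorGrade ℬ 𝒱 n, tensorMap π x = y) ?_ ?_ ?_ ?_ hy
  · rintro _ ⟨i, j, c, v, hij, hc, hv, rfl⟩
    obtain ⟨b, hb, rfl⟩ := hπ i c hc
    exact ⟨tmul b v, tmul_mem_tensorGrade hij hb hv, tensorMap_tmul _ _ _⟩
  · exact ⟨0, zero_mem _, map_zero _⟩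
  · rintro _ _ _ _ ⟨x, hx, rfl⟩ ⟨y, hy, rfl⟩
    exact ⟨x + y, add_mem hx hy, map_add _ _ _⟩
  · rintro _ _ ⟨x, hx, rfl⟩
    exact ⟨-x, neg_mem hx, map_neg _ _⟩

end TensorGrade

/-- Graded lifting property of an internally graded projective module. -/
theorem exists_graded_lift {S : Type u} {V : Type v} {M : Type w} {N : Type x} [Ring S]
    [AddCommGroup V] [Module S V] [AddCommGroup M] [Module S M] [AddCommGroup N] [Module S N]
    [Module.Projective S V] {𝒱 : ℕ → Submodule S V} (hV : DirectSum.IsInternal 𝒱)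
    (f : V →ₗ[S] N) (p : M →ₗ[S] N) (ℳ : ℕ → Submodule S M)
    (h : ∀ j, ∀ v ∈ 𝒱 j, ∃ m ∈ ℳ j, p m = f v) :
    ∃ g : V →ₗ[S] M, (∀ v, p (g v) = f v) ∧ ∀ j, ∀ v ∈ 𝒱 j, g v ∈ ℳ j := by
  let _ := hV.chooseDecomposition
  have hproj : ∀ j, Module.Projective S (𝒱 j) := fun j =>
    Module.Projective.of_split (𝒱 j).subtype
      ((DirectSum.component S ℕ (fun i => 𝒱 i) j).comp
        (DirectSum.decomposeLinearEquiv 𝒱).toLinearMap) (by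
      ext v
      rw [LinearMap.comp_apply, LinearMap.comp_apply]
      simp only [Submodule.subtype_apply, LinearEquiv.coe_coe,
        DirectSum.decomposeLinearEquiv_apply_coe, DirectSum.component.lof_self,
        LinearMap.id_apply])
  have hg : ∀ j, ∃ g : 𝒱 j →ₗ[S] M, ∀ v : 𝒱 j, g v ∈ ℳ j ∧ p (g v) = f v := by
    intro j
    let X : Submodule S (𝒱 j × M) :=
      LinearMap.eqLocus ((f.comp (𝒱 j).subtype).comp (LinearMap.fst S _ _))
        (p.comp (LinearMap.snd S _ _)) ⊓ (ℳ j).comap (LinearMap.snd S _ _)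
    have hsurj : Function.Surjective ((LinearMap.fst S (𝒱 j) M).comp X.subtype) := by
      intro v
      obtain ⟨m, hm, hpm⟩ := h j v v.2
      exact ⟨⟨(v, m), hpm.symm, hm⟩, rfl⟩
    have := hproj j
    obtain ⟨σ, hσ⟩ := Module.projective_lifting_property _ (LinearMap.id : 𝒱 j →ₗ[S] 𝒱 j) hsurj
    refine ⟨((LinearMap.snd S (𝒱 j) M).comp X.subtype).comp σ, fun v => ⟨(σ v).2.2, ?_⟩⟩
    have h1 : f ((σ v).1.1 : V) = p (σ v).1.2 := (σ v).2.1
    have h2 : (σ v).1.1 = v := LinearMap.congr_fun hσ v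
    rw [h2] at h1
    exact h1.symm
  choose g hg using hg
  have hgv : ∀ j (v : V) (hv : v ∈ 𝒱 j), DirectSum.toModule S ℕ M g
      (DirectSum.decompose 𝒱 v) = g j ⟨v, hv⟩ := by
    intro j v hv
    rw [DirectSum.decompose_of_mem 𝒱 hv]
    exact DirectSum.toModule_lof S j _
  refine ⟨(DirectSum.toModule S ℕ M g).comp (DirectSum.decomposeLinearEquiv 𝒱).toLinearMap,
    ?_, ?_⟩
  · intro v
    induction v using DirectSum.Decomposition.inductionOn 𝒱 with
    | zero => simp
    | @homogeneous j v =>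
      change p (DirectSum.toModule S ℕ M g (DirectSum.decompose 𝒱 v.1)) = _
      rw [hgv j v.1 v.2]
      exact (hg j _).2
    | add a b ha hb => rw [map_add, map_add, map_add, ha, hb]
  · intro j v hv
    change DirectSum.toModule S ℕ M g (DirectSum.decompose 𝒱 v) ∈ _
    rw [hgv j v hv]
    exact (hg j _).1

end TensorTools

/-! ### The complex `¹M_*` of a central extension -/

section CentralExtensionComplex

variable {S : Type u} {A : Type v} {D : Type x} [Ring S] [Ring A] [Module S A]
  [IsScalarTower S A A] [Ring D] [Module S D] [IsScalarTower S D D]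

/-- The homomorphism of graded `S`-rings `π : D → A` is surjective with kernel `z D`, for a central
element `z` of degree `1`. -/
structure IsCentralExtension (𝒜 : ℕ → Submodule S A) (𝒟 : ℕ → Submodule S D)
    (π : SRingHom S D A) (z : D) : Prop where
  mem : z ∈ 𝒟 1
  central : ∀ d, z * d = d * z
  map_z : π.toRingHom z = 0
  exists_of_map_eq_zero : ∀ d, π.toRingHom d = 0 → ∃ c, d = z * c
  map_mem : ∀ n, ∀ d ∈ 𝒟 n, π.toRingHom d ∈ 𝒜 n
  exists_lift : ∀ n, ∀ a ∈ 𝒜 n, ∃ d ∈ 𝒟 n, π.toRingHom d = a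

/-- A homomorphism of `S`-rings as an `S`-linear map. -/
def SRingHom.toLinear (π : SRingHom S D A) : D →ₗ[S] A where
  toFun := π.toRingHom
  map_add' := map_add _
  map_smul' := π.map_smul'

/-- The map `π ⊗ V` as an `S`-linear map. -/
def tensorMapₛ (V : Type w) [AddCommGroup V] [Module S V] (π : SRingHom S D A) :
    BTensor S D V →ₗ[S] BTensor S A V where
  toFun := tensorMap π
  map_add' := map_add _
  map_smul' s x := by
    rw [← smul_one_smul' (B := D), tensorMap_smul, π.map_smul_one, smul_one_smul',
      RingHom.id_apply]

/-- Multiplication by a central element as an `S`-linear map. -/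
def centralSmul (M : Type w) [AddCommGroup M] [Module D M] [Module S M] [IsScalarTower S D M]
    (z : D) (hz : ∀ d, z * d = d * z) : M →ₗ[S] M where
  toFun m := z • m
  map_add' := smul_add z
  map_smul' s m := by
    rw [← smul_one_smul' (B := D) s m, ← mul_smul, hz, mul_smul, smul_one_smul', RingHom.id_apply]

theorem SRingHom.surjective_of_exists_lift {𝒜 : ℕ → Submodule S A} [GradedRing 𝒜]
    {𝒟 : ℕ → Submodule S D} {π : SRingHom S D A}
    (h : ∀ n, ∀ a ∈ 𝒜 n, ∃ d ∈ 𝒟 n, π.toRingHom d = a) : Function.Surjective π.toRingHom := by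
  intro a
  induction a using DirectSum.Decomposition.inductionOn 𝒜 with
  | zero => exact ⟨0, map_zero _⟩
  | @homogeneous i a =>
    obtain ⟨d, -, hd⟩ := h i a a.2
    exact ⟨d, hd⟩
  | add a b ha hb =>
    obtain ⟨a, rfl⟩ := ha
    obtain ⟨b, rfl⟩ := hb
    exact ⟨a + b, map_add _ _ _⟩

theorem proj_mul_of_mem_one (𝒟 : ℕ → Submodule S D) [GradedRing 𝒟] {e : D} (he : e ∈ 𝒟 1)
    (n : ℕ) (c : D) : GradedRing.proj 𝒟 (n + 1) (c * e) = GradedRing.proj 𝒟 n c * e := by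
  rw [proj_mul, Finset.sum_eq_single_of_mem (n, 1) (by simp)]
  · rw [proj_of_mem he, if_pos rfl]
  · rintro ⟨a, b⟩ hab hne
    rw [Finset.HasAntidiagonal.mem_antidiagonal] at hab
    rw [proj_of_mem he, if_neg, mul_zero]
    rintro rfl
    exact hne (Prod.ext (by simp only at hab ⊢; omega) rfl)

theorem proj_zero_mul_of_mem_one (𝒟 : ℕ → Submodule S D) [GradedRing 𝒟] {e : D} (he : e ∈ 𝒟 1)
    (c : D) : GradedRing.proj 𝒟 0 (c * e) = 0 := by
  rw [proj_mul, Finset.sum_eq_zero]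
  rintro ⟨a, b⟩ hab
  rw [Finset.HasAntidiagonal.mem_antidiagonal] at hab
  rw [proj_of_mem he, if_neg, mul_zero]
  rintro rfl
  simp at hab

variable {𝒜 : ℕ → Submodule S A} [GradedRing 𝒜] {𝒟 : ℕ → Submodule S D}
  {π : SRingHom S D A} {z : D}

section Kernel

variable [GradedRing 𝒟] (E : IsCentralExtension 𝒜 𝒟 π z)
include E

theorem IsCentralExtension.eq_zero_of_map_eq_zero {d : D} (hd : d ∈ 𝒟 0)
    (h : π.toRingHom d = 0) : d = 0 := by
  obtain ⟨c, rfl⟩ := E.exists_of_map_eq_zero d h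
  have h1 := proj_of_mem hd 0
  rw [if_pos rfl, E.central, proj_zero_mul_of_mem_one 𝒟 E.mem] at h1
  rw [E.central, h1]

theorem IsCentralExtension.exists_mem_of_map_eq_zero {n : ℕ} {d : D} (hd : d ∈ 𝒟 (n + 1))
    (h : π.toRingHom d = 0) : ∃ c ∈ 𝒟 n, z * c = d := by
  obtain ⟨c, rfl⟩ := E.exists_of_map_eq_zero d h
  refine ⟨GradedRing.proj 𝒟 n c, proj_mem 𝒟 n c, ?_⟩
  have h1 := proj_of_mem hd (n + 1)
  rw [if_pos rfl] at h1
  rw [E.central, ← proj_mul_of_mem_one 𝒟 E.mem, ← E.central, h1]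

end Kernel

theorem coord_mem [SetLike.GradedMonoid 𝒟] [Module.Projective S (𝒜 1)] {n : ℕ}
    {x : BTensor S D (𝒜 1)}
    (hx : x ∈ tensorGrade 𝒟 (gradeOne 𝒜) (n + 1)) (v : 𝒜 1) : coord x v ∈ 𝒟 n := by
  refine map_mem_of_forall_tmul_one 𝒟 (gradeOne 𝒜) (f := coord) (k := 1)
    (𝒩 := fun n => AddSubgroup.comap (Finsupp.applyAddHom v) (𝒟 n).toAddSubgroup) ?_ ?_ ?_ hx
  · intro i n b m hb hm
    exact SetLike.GradedMul.mul_mem hb hm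
  · intro j hj
    rw [gradeOne, if_neg (by omega)]
  · intro j hj w hw
    change coord (tmul 1 w) v ∈ 𝒟 (j - 1)
    by_cases h1 : j = 1
    · subst h1
      rw [coord_tmul, one_mul]
      exact Submodule.smul_mem (𝒟 0) _ SetLike.GradedOne.one_mem
    · rw [gradeOne, if_neg h1, Submodule.mem_bot] at hw
      rw [hw, tmul_zero, map_zero]
      exact zero_mem _

theorem mem_gradeOne (v : 𝒜 1) : v ∈ gradeOne 𝒜 1 := by
  rw [gradeOne, if_pos rfl]; trivial

theorem IsCentralExtension.exists_smul_mem [GradedRing 𝒟] [Module.Projective S (𝒜 1)]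
    (E : IsCentralExtension 𝒜 𝒟 π z) {n : ℕ} {x : BTensor S D (𝒜 1)}
    (hx : x ∈ tensorGrade 𝒟 (gradeOne 𝒜) (n + 1)) (h : tensorMap π x = 0) :
    ∃ y ∈ tensorGrade 𝒟 (gradeOne 𝒜) n, z • y = x := by
  have h0 : ∀ v, π.toRingHom (coord x v) = 0 := fun v => by
    rw [← coord_tensorMap, h, map_zero, Finsupp.zero_apply]
  rw [← linearCombination_coord x, Finsupp.linearCombination_apply, Finsupp.sum]
  refine Finset.sum_induction _
    (fun x => ∃ y ∈ tensorGrade 𝒟 (gradeOne 𝒜) n, z • y = x) ?_ ⟨0, zero_mem _, smul_zero _⟩ ?_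
  · rintro _ _ ⟨a, ha, rfl⟩ ⟨b, hb, rfl⟩
    exact ⟨a + b, add_mem ha hb, smul_add _ _ _⟩
  · intro v _
    cases n with
    | zero =>
      rw [E.eq_zero_of_map_eq_zero (coord_mem hx v) (h0 v), zero_smul]
      exact ⟨0, zero_mem _, smul_zero _⟩
    | succ n =>
      obtain ⟨c, hc, hzc⟩ := E.exists_mem_of_map_eq_zero (coord_mem hx v) (h0 v)
      refine ⟨tmul c v, tmul_mem_tensorGrade rfl hc (mem_gradeOne v), ?_⟩
      rw [smul_tmul, hzc, tmul_eq_smul]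
      rfl

variable {F : Resolution.{u, v, w} 𝒜}

theorem LiftData.subsingleton_H₁_iff (L : LiftData F 𝒟 π z) : Subsingleton L.H₁ ↔
    ∀ y x, L.del₁ y + z * x = 0 → ∃ u v, L.del₂ u - z • v = y ∧ L.del₁ v + L.f₂ u = x := by
  rw [LiftData.H₁, QuotientAddGroup.subsingleton_iff, AddSubgroup.addSubgroupOf_eq_top]
  constructor
  · intro h y x hyx
    obtain ⟨⟨u, v⟩, huv⟩ := h (show (y, x) ∈ L.delta₁.ker from hyx)
    rw [LiftData.delta₂_apply, Prod.mk.injEq] at huv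
    exact ⟨u, v, huv⟩
  · rintro h ⟨y, x⟩ hyx
    obtain ⟨u, v, h1, h2⟩ := h y x hyx
    refine ⟨(u, v), ?_⟩
    rw [LiftData.delta₂_apply, h1, h2]

/-- If `z` is regular, then `¹M_*` is exact at `M₁`. -/
theorem LiftData.subsingleton_H₁_of_regular [Module.Projective S (𝒜 1)]
    (E : IsCentralExtension 𝒜 𝒟 π z) (L : LiftData F 𝒟 π z)
    (hreg : ∀ d, z * d = 0 → d = 0) : Subsingleton L.H₁ := by
  rw [L.subsingleton_H₁_iff]
  intro y x hyx
  have hy : d₁ 𝒜 (tensorMap π y) = 0 := by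
    rw [← L.del₁_lift, eq_neg_of_add_eq_zero_left hyx, map_neg, map_mul, E.map_z, zero_mul,
      neg_zero]
  obtain ⟨u', hu'⟩ := (F.exact₁ _).1 hy
  obtain ⟨u, rfl⟩ := tensorMap_surjective π
    (SRingHom.surjective_of_exists_lift E.exists_lift) u'
  rw [← L.del₂_lift, ← sub_eq_zero, ← map_sub] at hu'
  obtain ⟨v, hv⟩ := exists_smul_of_tensorMap_eq_zero π E.exists_of_map_eq_zero hu'
  refine ⟨u, v, ?_, ?_⟩
  · rw [← hv, sub_sub_cancel]
  · rw [← sub_eq_zero]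
    apply hreg
    have h1 := congrArg L.del₁ hv
    rw [map_sub, L.del_comp, map_smul, smul_eq_mul] at h1
    rw [mul_sub, mul_add, ← h1, eq_neg_of_add_eq_zero_left hyx]
    abel

/-- If `¹M_*` is exact at `M₁` and `z` is injective on `D^{j-1}` whenever `V₃^j ≠ 0`, then `z` is
regular: an element of `ker z` of lowest degree gives a cycle `(0, x)` of `M₁`; writing it as a
boundary and comparing with the lifted differential `∂₃` and the homotopy `f₃` with
`∂₂ ∂₃ = - z f₃`, one finds `x = ∂₁ t` with `z t = 0`, and the coordinates of `t` are elements of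
`ker z` of smaller degree. -/
theorem LiftData.regular_of_subsingleton_H₁ [GradedRing 𝒟] [Module.Projective S (𝒜 1)]
    (E : IsCentralExtension 𝒜 𝒟 π z) (L : LiftData F 𝒟 π z) (hH : Subsingleton L.H₁)
    (hV : ∀ j, Nontrivial (F.grade 1 (j + 1)) → ∀ d ∈ 𝒟 j, z * d = 0 → d = 0) (n : ℕ) :
    ∀ x ∈ 𝒟 n, z * x = 0 → x = 0 := by
  rw [L.subsingleton_H₁_iff] at hH
  have hsurj := SRingHom.surjective_of_exists_lift E.exists_lift
  have := F.projective 0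
  have := F.projective 1
  -- the lift `∂₃` of the differential `d₃`
  obtain ⟨p₃, hp₃, hp₃g⟩ := exists_graded_lift (F.internal 1)
    (((F.d 0).restrictScalars S).comp (oneTmul A)) (tensorMapₛ (F.V 0) π)
    (tensorGradeₛ 𝒟 (F.grade 0)) (by
      intro j v hv
      refine exists_tensorGrade_lift 𝒟 (F.grade 0) π E.exists_lift (n := j) (F.d_graded 0 j _ ?_)
      exact tmul_mem_tensorGrade (zero_add j) SetLike.GradedOne.one_mem hv)
  have hp₃' : ∀ w, tensorMap π (tensorLift (B := D) p₃ w) = F.d 0 (tensorMap π w) := by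
    intro w
    induction w using BTensor.induction with
    | h0 => simp only [map_zero]
    | ht b v =>
      rw [tensorLift_tmul, tensorMap_smul, tensorMap_tmul, tmul_eq_smul, map_smul]
      exact congrArg _ (hp₃ v)
    | hadd x y hx hy => simp only [map_add, hx, hy]
  -- the homotopy `f₃`
  obtain ⟨q₃, hq₃, hq₃g⟩ := exists_graded_lift (F.internal 1)
    (-((L.del₂.restrictScalars S).comp p₃))
    (centralSmul (S := S) (BTensor S D (𝒜 1)) z E.central)
    (fun j => tensorGradeₛ 𝒟 (gradeOne 𝒜) (j - 1)) (by
      intro j v hv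
      cases j with
      | zero =>
        rw [F.grade_zero, Submodule.mem_bot] at hv
        exact ⟨0, zero_mem _, by rw [hv, map_zero, map_zero]⟩
      | succ j =>
        refine E.exists_smul_mem (n := j) (x := -L.del₂ (p₃ v))
          (neg_mem (L.del₂_graded _ _ (hp₃g _ v hv))) ?_
        rw [map_neg, L.del₂_lift]
        have h1 : tensorMap π (p₃ v) = F.d 0 (tmul 1 v) := hp₃ v
        rw [h1, (F.exact₂ _).2 ⟨_, rfl⟩, neg_zero])
  have hq₃' : ∀ w, L.del₂ (tensorLift (B := D) p₃ w) = -(z • tensorLift (B := D) q₃ w) := by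
    intro w
    induction w using BTensor.induction with
    | h0 => simp only [map_zero, smul_zero, neg_zero]
    | ht b v =>
      have h1 : z • q₃ v = -L.del₂ (p₃ v) := hq₃ v
      rw [tensorLift_tmul, tensorLift_tmul, map_smul, ← mul_smul, E.central, mul_smul, h1,
        smul_neg, neg_neg]
    | hadd x y hx hy => rw [map_add, map_add, hx, hy, map_add, smul_add, neg_add]
  -- the comparison map `f₂ ∂₃ - ∂₁ f₃` takes values in `ker z`, hence vanishes
  have hg : ∀ w : BTensor S D (F.V 1),
      L.f₂ (tensorLift (B := D) p₃ w) = L.del₁ (tensorLift (B := D) q₃ w) := by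
    have hz : ∀ v, z * (L.f₂ (p₃ v) - L.del₁ (q₃ v)) = 0 := by
      intro v
      have h1 := hq₃' (tmul 1 v)
      rw [tensorLift_tmul_one, tensorLift_tmul_one] at h1
      have h2 := L.del_comp (p₃ v)
      rw [h1, map_neg, map_smul, neg_inj, smul_eq_mul] at h2
      rw [mul_sub, ← h2, sub_self]
    have hv : ∀ v, L.f₂ (p₃ v) - L.del₁ (q₃ v) = 0 := by
      let _ := (F.internal 1).chooseDecomposition
      intro v
      induction v using DirectSum.Decomposition.inductionOn (F.grade 1) with
      | zero => simp only [map_zero, sub_self]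
      | add a b ha hb =>
        simp only [map_add] at *
        rw [add_sub_add_comm, ha, hb, add_zero]
      | @homogeneous j v =>
        cases j with
        | zero =>
          have h0 : (v : F.V 1) = 0 := (Submodule.mem_bot S).1 ((F.grade_zero 1).le v.2)
          rw [h0]
          simp only [map_zero, sub_self]
        | succ j =>
          by_cases h0 : v = 0
          · rw [h0]
            simp only [ZeroMemClass.coe_zero, map_zero, sub_self]
          · refine hV j ⟨v, 0, h0⟩ _ (sub_mem ?_ ?_) (hz _)
            · exact L.f₂_graded j _ (hp₃g (j + 1) v.1 v.2)
            · exact L.del₁_graded j _ (hq₃g (j + 1) v.1 v.2)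
    intro w
    induction w using BTensor.induction with
    | h0 => simp only [map_zero]
    | ht b v =>
      rw [tensorLift_tmul, tensorLift_tmul, map_smul, map_smul, sub_eq_zero.1 (hv v)]
    | hadd x y hx hy => simp only [map_add, hx, hy]
  induction n using Nat.strong_induction_on with
  | _ n ih =>
  intro x hx hzx
  obtain ⟨u, y, huy, hux⟩ := hH 0 x (by rw [map_zero, zero_add, hzx])
  rw [sub_eq_zero] at huy
  obtain ⟨w', hw'⟩ := (F.exact₂ (tensorMap π u)).1 (by
    rw [← L.del₂_lift, huy, tensorMap_smul, E.map_z, zero_smul])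
  obtain ⟨w, rfl⟩ := tensorMap_surjective π hsurj w'
  obtain ⟨u', hu'⟩ := exists_smul_of_tensorMap_eq_zero π E.exists_of_map_eq_zero
    (x := u - tensorLift (B := D) p₃ w) (by rw [map_sub, hp₃', hw', sub_self])
  rw [sub_eq_iff_eq_add] at hu'
  -- subtract from `(u, y)` the boundary contributed by `∂₃` and by multiples of `z`
  obtain ⟨t, ht⟩ : ∃ t, t = y + tensorLift (B := D) q₃ w - L.del₂ u' := ⟨_, rfl⟩
  have hzt : z • t = 0 := by
    rw [ht, smul_sub, smul_add, ← huy, hu', map_add, hq₃', map_smul]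
    abel
  have hxt : x = L.del₁ t := by
    rw [← hux, ht, map_sub, map_add, L.del_comp, hu', map_add, map_smul, smul_eq_mul, hg]
    abel
  -- `A^1` sits in degree `1`, so the coordinates of `t` that matter have degree `n - 1`
  have hc : ∀ v, ∀ m < n, GradedRing.proj 𝒟 m (coord t v) = 0 := by
    intro v m hm
    refine ih m hm _ (proj_mem 𝒟 _ _) ?_
    rw [E.central, ← proj_mul_of_mem_one 𝒟 E.mem, ← E.central]
    have h1 : z * coord t v = coord (z • t) v := by rw [map_smul]; rfl
    rw [h1, hzt, map_zero, Finsupp.zero_apply, map_zero]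
  have hx' := proj_of_mem hx n
  rw [if_pos rfl] at hx'
  rw [← hx', hxt, ← linearCombination_coord t, Finsupp.linearCombination_apply, Finsupp.sum,
    map_sum, map_sum]
  refine Finset.sum_eq_zero fun v _ => ?_
  have he : L.del₁ (oneTmul D v) ∈ 𝒟 1 := L.del₁_graded 1 _
    (tmul_mem_tensorGrade (zero_add 1) SetLike.GradedOne.one_mem (mem_gradeOne v))
  rw [map_smul, smul_eq_mul]
  cases n with
  | zero => exact proj_zero_mul_of_mem_one 𝒟 he _
  | succ n => rw [proj_mul_of_mem_one 𝒟 he, hc v n (Nat.lt_succ_self n), zero_mul]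

/-- The lifts `∂₁` and `∂₂` exist by projectivity, and so does `f₂`, since `∂₁ ∂₂` has values in
`ker π = z D`. -/
theorem IsCentralExtension.nonempty_liftData [GradedRing 𝒟] [Module.Projective S (𝒜 1)]
    (E : IsCentralExtension 𝒜 𝒟 π z) (F : Resolution.{u, v, w} 𝒜) :
    Nonempty (LiftData F 𝒟 π z) := by
  have hsurj := SRingHom.surjective_of_exists_lift E.exists_lift
  have := F.projective 0
  obtain ⟨p₁, hp₁⟩ : ∃ p₁ : 𝒜 1 →ₗ[S] 𝒟 1, ∀ v, π.toRingHom (p₁ v) = v := by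
    obtain ⟨p₁, hp₁⟩ := Module.projective_lifting_property
      (π.toLinear.restrict (fun d hd => E.map_mem 1 d hd)) (LinearMap.id : 𝒜 1 →ₗ[S] 𝒜 1)
      (by
        rintro ⟨a, ha⟩
        obtain ⟨d, hd, rfl⟩ := E.exists_lift 1 a ha
        exact ⟨⟨d, hd⟩, rfl⟩)
    exact ⟨p₁, fun v => congrArg Subtype.val (LinearMap.congr_fun hp₁ v)⟩
  let del₁ : BTensor S D (𝒜 1) →ₗ[D] D := tensorLift ((𝒟 1).subtype.comp p₁)
  have h₁g : ∀ n, ∀ x ∈ tensorGrade 𝒟 (gradeOne 𝒜) n, del₁ x ∈ 𝒟 n := by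
    intro n x hx
    refine map_mem_of_forall_tmul_one 𝒟 (gradeOne 𝒜) (f := del₁) (k := 0)
      (𝒩 := fun n => (𝒟 n).toAddSubgroup) ?_ (fun j hj => by omega) ?_ hx
    · intro i n b m hb hm
      exact SetLike.GradedMul.mul_mem hb hm
    · intro j _ v hv
      change tensorLift _ (tmul 1 v) ∈ 𝒟 j
      rw [tensorLift_tmul_one]
      by_cases h1 : j = 1
      · subst h1
        exact (p₁ v).2
      · rw [gradeOne, if_neg h1, Submodule.mem_bot] at hv
        rw [hv, map_zero]
        exact zero_mem _
  have h₁l : ∀ x, π.toRingHom (del₁ x) = d₁ 𝒜 (tensorMap π x) := by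
    intro x
    induction x using BTensor.induction with
    | h0 => simp only [map_zero]
    | ht b v =>
      rw [tensorMap_tmul, d₁, tensorLift_tmul]
      change π.toRingHom (b • ((p₁ v : 𝒟 1) : D)) = _
      rw [smul_eq_mul, map_mul, hp₁]
      rfl
    | hadd x y hx hy => simp only [map_add, hx, hy]
  obtain ⟨p₂, hp₂, hp₂g⟩ := exists_graded_lift (F.internal 0)
    ((F.d₂.restrictScalars S).comp (oneTmul A)) (tensorMapₛ (𝒜 1) π)
    (tensorGradeₛ 𝒟 (gradeOne 𝒜)) (by
      intro j v hv
      refine exists_tensorGrade_lift 𝒟 (gradeOne 𝒜) π E.exists_lift (n := j) (F.d₂_graded j _ ?_)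
      exact tmul_mem_tensorGrade (zero_add j) SetLike.GradedOne.one_mem hv)
  obtain ⟨q₂, hq₂, hq₂g⟩ := exists_graded_lift (F.internal 0)
    (-((del₁.restrictScalars S).comp p₂)) (centralSmul (S := S) D z E.central)
    (fun j => 𝒟 (j - 1)) (by
      intro j v hv
      cases j with
      | zero =>
        rw [F.grade_zero, Submodule.mem_bot] at hv
        exact ⟨0, zero_mem _, by rw [hv, map_zero, map_zero]⟩
      | succ j =>
        refine E.exists_mem_of_map_eq_zero (n := j) (d := -del₁ (p₂ v))
          (neg_mem (h₁g _ _ (hp₂g _ v hv))) ?_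
        have h1 : tensorMap π (p₂ v) = F.d₂ (tmul 1 v) := hp₂ v
        rw [map_neg, h₁l, h1, (F.exact₁ _).2 ⟨_, rfl⟩, neg_zero])
  refine ⟨{ del₁ := del₁, del₂ := tensorLift (B := D) p₂, f₂ := tensorLift (B := D) q₂,
            del₁_graded := h₁g, del₂_graded := ?_, f₂_graded := ?_, del₁_lift := h₁l, del₂_lift := ?_,
            del_comp := ?_ }⟩
  · intro n x hx
    refine map_mem_of_forall_tmul_one 𝒟 (F.grade 0) (f := tensorLift (B := D) p₂) (k := 0)
      (𝒩 := tensorGrade 𝒟 (gradeOne 𝒜)) ?_ (fun j hj => by omega) ?_ hx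
    · intro i n b m hb hm
      exact smul_mem_tensorGrade _ _ hb hm
    · intro j _ v hv
      rw [tensorLift_tmul_one]
      exact hp₂g j v hv
  · intro n x hx
    refine map_mem_of_forall_tmul_one 𝒟 (F.grade 0) (f := tensorLift (B := D) q₂) (k := 1)
      (𝒩 := fun n => (𝒟 n).toAddSubgroup) ?_ ?_ ?_ hx
    · intro i n b m hb hm
      exact SetLike.GradedMul.mul_mem hb hm
    · intro j hj
      rw [show j = 0 by omega, F.grade_zero]
    · intro j _ v hv
      rw [tensorLift_tmul_one]
      exact hq₂g j v hv
  · intro x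
    induction x using BTensor.induction with
    | h0 => simp only [map_zero]
    | ht b v =>
      rw [tensorLift_tmul, tensorMap_smul, tensorMap_tmul, tmul_eq_smul, map_smul]
      exact congrArg _ (hp₂ v)
    | hadd x y hx hy => simp only [map_add, hx, hy]
  · intro x
    induction x using BTensor.induction with
    | h0 => simp only [map_zero, mul_zero, neg_zero]
    | ht b v =>
      have h1 : z * q₂ v = -del₁ (p₂ v) := hq₂ v
      rw [tensorLift_tmul, tensorLift_tmul, map_smul, smul_eq_mul, smul_eq_mul, ← mul_assoc,
        E.central, mul_assoc, h1, mul_neg, neg_neg]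
    | hadd x y hx hy => rw [map_add, map_add, hx, hy, map_add, mul_add, neg_add]

end CentralExtensionComplex

/-! ### The tensor ring over a connected strongly graded `S`-ring -/

section TensorRingOfA

variable {S : Type u} {A : Type v} [Ring S] [Ring A] [Module S A] [IsScalarTower S A A]
  (𝒜 : ℕ → Submodule S A) [GradedRing 𝒜]

theorem piA_scalar (s : S) : piA 𝒜 (TensorRing.scalar S (𝒜 1) s) = s • (1 : A) :=
  TensorRing.lift_scalar _ _ _ _ s

theorem piA_vec (v : 𝒜 1) : piA 𝒜 (TensorRing.vec S (𝒜 1) v) = v :=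
  TensorRing.lift_vec _ _ _ _ v

theorem piA_smul (s : S) (t : TA 𝒜) : piA 𝒜 (s • t) = s • piA 𝒜 t := by
  rw [TensorRing.smul_def, map_mul, piA_scalar, smul_mul_assoc, one_mul]

/-- The canonical map `π_A` as a homomorphism of `S`-rings. -/
def piAHom : SRingHom S (TA 𝒜) A where
  toRingHom := piA 𝒜
  map_smul' := piA_smul 𝒜

theorem piA_mem {n : ℕ} {t : TA 𝒜} (ht : t ∈ gradeTA 𝒜 n) : piA 𝒜 t ∈ 𝒜 n := by
  refine Submodule.span_induction (p := fun t _ => piA 𝒜 t ∈ 𝒜 n) ?_ ?_ ?_ ?_ ht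
  · rintro _ ⟨l, rfl, rfl⟩
    clear ht
    induction l with
    | nil =>
      simp only [List.map_nil, List.prod_nil, map_one, List.length_nil]
      exact SetLike.GradedOne.one_mem
    | cons v l ih =>
      simp only [List.map_cons, List.prod_cons, map_mul, List.length_cons, piA_vec]
      rw [add_comm]
      exact SetLike.GradedMul.mul_mem v.2 ih
  · rw [map_zero]; exact zero_mem _
  · intro x y _ _ hx hy
    rw [map_add]; exact add_mem hx hy
  · intro s x _ hx
    rw [piA_smul]; exact Submodule.smul_mem _ _ hx

theorem exists_piA_eq (hconn : IsConnected 𝒜) (hstrong : IsStronglyGraded 𝒜) (n : ℕ) :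
    ∀ a ∈ 𝒜 n, ∃ t ∈ gradeTA 𝒜 n, piA 𝒜 t = a := by
  induction n with
  | zero =>
    intro a ha
    obtain ⟨s, rfl⟩ := hconn.2 a ha
    exact ⟨_, TensorRing.scalar_mem s, piA_scalar 𝒜 s⟩
  | succ n ih =>
    intro a ha
    refine AddSubgroup.closure_induction
      (p := fun a _ => ∃ t ∈ gradeTA 𝒜 (n + 1), piA 𝒜 t = a) ?_ ?_ ?_ ?_ (hstrong n 1 a ha)
    · rintro _ ⟨b, hb, c, hc, rfl⟩
      obtain ⟨t, ht, rfl⟩ := ih b hb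
      refine ⟨t * TensorRing.vec S (𝒜 1) ⟨c, hc⟩,
        SetLike.GradedMul.mul_mem ht (TensorRing.vec_mem _), ?_⟩
      rw [map_mul, piA_vec]
    · exact ⟨0, zero_mem _, map_zero _⟩
    · rintro _ _ _ _ ⟨t, ht, rfl⟩ ⟨t', ht', rfl⟩
      exact ⟨t + t', add_mem ht ht', map_add _ _ _⟩
    · rintro _ _ ⟨t, ht, rfl⟩
      exact ⟨-t, neg_mem ht, map_neg _ _⟩

variable (P R : Submodule S (TA 𝒜))

theorem isCentralExtension_projection (hconn : IsConnected 𝒜) (hstrong : IsStronglyGraded 𝒜)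
    (hgen : idealOf (R : Set (TA 𝒜)) = idealA 𝒜)
    (h : idealOf (R : Set (TA 𝒜)) = idealOf (leading (gradeTA 𝒜) P : Set (TA 𝒜))) :
    IsCentralExtension 𝒜 (centralGrade (gradeTA 𝒜) P) (projection 𝒜 P R hgen h)
      (centralElt (gradeTA 𝒜) P) where
  mem := centralElt_mem _ _
  central := centralElt_comm _ _
  map_z := by
    change piA 𝒜 ((Polynomial.X : (TA 𝒜)[X]).coeff 0) = 0
    rw [Polynomial.coeff_X_zero, map_zero]
  exists_of_map_eq_zero := by
    intro d hd
    obtain ⟨f, rfl⟩ := toCentral_surjective (gradeTA 𝒜) P d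
    have h0 : f.coeff 0 ∈ idealA 𝒜 := (TwoSidedIdeal.mem_ker _).2 hd
    rw [← hgen, h] at h0
    obtain ⟨c, hc⟩ := toCentral_C_mem_of_mem_idealOf_leading (gradeTA 𝒜) P h0
    refine ⟨toCentral _ _ f.divX + c, ?_⟩
    conv_lhs => rw [← Polynomial.X_mul_divX_add f]
    rw [map_add, hc, mul_add, centralElt_mul]
  map_mem := by
    intro n d hd
    refine Submodule.span_induction
      (p := fun d _ => (projection 𝒜 P R hgen h).toRingHom d ∈ 𝒜 n) ?_ ?_ ?_ ?_ hd
    · rintro _ ⟨i, k, t, rfl, ht, rfl⟩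
      change piA 𝒜 ((Polynomial.monomial k t).coeff 0) ∈ _
      rw [Polynomial.coeff_monomial]
      split_ifs with hk
      · rw [hk, add_zero]
        exact piA_mem 𝒜 ht
      · rw [map_zero]; exact zero_mem _
    · rw [map_zero]; exact zero_mem _
    · intro x y _ _ hx hy
      rw [map_add]; exact add_mem hx hy
    · intro s x _ hx
      have h1 : (projection 𝒜 P R hgen h).toRingHom (s • x) =
        s • (projection 𝒜 P R hgen h).toRingHom x := (projection 𝒜 P R hgen h).map_smul' s x
      rw [h1]
      exact Submodule.smul_mem (𝒜 n) s hx
  exists_lift := by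
    intro n a ha
    obtain ⟨t, ht, rfl⟩ := exists_piA_eq 𝒜 hconn hstrong n a ha
    refine ⟨toCentral _ _ (Polynomial.C t), Submodule.subset_span ⟨n, 0, t, rfl, ht, rfl⟩, ?_⟩
    change piA 𝒜 ((Polynomial.C t).coeff 0) = _
    rw [Polynomial.coeff_C_zero]

theorem le_complexity {V : ℕ → Type w} {j : ℕ} (h : Nontrivial (V (j + 1))) :
    (j : EReal) ≤ complexity V := by
  rw [complexity, if_pos ⟨_, h⟩]
  refine le_sSup ⟨j + 1, h, ?_⟩
  rw [Nat.cast_add, Nat.cast_one]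
  exact (EReal.add_sub_cancel_right (b := 1)).symm

theorem regular_of_jacobi {S : Type u} {T : Type v} [Ring S] [Ring T] [Module S T]
    [IsScalarTower S T T] (𝒯 : ℕ → Submodule S T) [GradedRing 𝒯] (P : Submodule S T)
    (hJ : ∀ n, Jacobi 𝒯 P n) (d : CentralExt 𝒯 P) (hd : centralElt 𝒯 P * d = 0) : d = 0 := by
  refine ext_proj (𝒯 := centralGrade 𝒯 P) fun n => ?_
  rw [map_zero]
  refine (jacobi_iff 𝒯 P n).1 (hJ n) _ (proj_mem _ _ _) ?_
  rw [centralElt_comm, ← proj_mul_of_mem_one _ (centralElt_mem 𝒯 P), ← centralElt_comm, hd,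
    map_zero]

variable {R} in
theorem jacobi_of_subsingleton_H₁ [Module.Projective S (𝒜 1)]
    (hconn : IsConnected 𝒜) (hstrong : IsStronglyGraded 𝒜)
    (hgen : idealOf (R : Set (TA 𝒜)) = idealA 𝒜)
    (h : idealOf (R : Set (TA 𝒜)) = idealOf (leading (gradeTA 𝒜) P : Set (TA 𝒜)))
    (F : Resolution.{u, v, w} 𝒜) (hF : F.complexity₃ = homComplexity 𝒜)
    (L : LiftData F (centralGrade (gradeTA 𝒜) P) (projection 𝒜 P R hgen h)
      (centralElt (gradeTA 𝒜) P)) (hH : Subsingleton L.H₁)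
    (hJ : homComplexity 𝒜 = -1 ∨ ∀ n : ℕ, 1 ≤ n → (n : EReal) ≤ homComplexity 𝒜 →
      Jacobi (gradeTA 𝒜) P n) (n : ℕ) : Jacobi (gradeTA 𝒜) P n := by
  rw [jacobi_iff]
  refine L.regular_of_subsingleton_H₁ (isCentralExtension_projection 𝒜 P R hconn hstrong hgen h)
    hH ?_ n
  intro j hj
  rw [← jacobi_iff]
  have hle : (j : EReal) ≤ homComplexity 𝒜 := hF ▸ le_complexity hj
  have hj1 : 1 ≤ j := by
    by_contra h0
    obtain rfl : j = 0 := by omega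
    rw [zero_add, F.grade_one] at hj
    exact not_subsingleton (⊥ : Submodule S (F.V 1)) inferInstance
  rcases hJ with hJ | hJ
  · rw [hJ] at hle
    have h1 : (-1 : EReal) < (0 : ℕ) := by
      rw [Nat.cast_zero]
      simp
    exact absurd (le_trans (Nat.cast_le.2 (Nat.zero_le j)) hle) (not_le.2 h1)
  · exact hJ j hj1 hle

end TensorRingOfA

/-! ### The isomorphism `T ⊗_S V ≅ T⁺` for a tensor ring `T = T_S(V)` -/

namespace TensorRing

section Delta

variable {S : Type u} {V : Type v} [Ring S] [AddCommGroup V] [Module S V] [Module Sᵐᵒᵖ V]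

@[elab_as_elim]
theorem induction {p : TensorRing S V → Prop} (hs : ∀ s, p (scalar S V s))
    (hv : ∀ t v, p t → p (t * vec S V v)) (hadd : ∀ a b, p a → p b → p (a + b))
    (t : TensorRing S V) : p t := by
  have h0 : p 0 := by
    have h := hs 0
    rwa [map_zero] at h
  -- left multiplication by scalars is accumulated in front of the products of vectors
  have hprod : ∀ (l : List V) (s : S), p (s • (l.map (vec S V)).prod) := by
    intro l
    induction l using List.reverseRecOn with
    | nil =>
      intro s
      rw [smul_def]
      simpa using hs s
    | append_singleton l v ih =>
      intro s
      rw [List.map_append, List.prod_append, ← smul_mul_assoc]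
      simpa using hv _ v (ih s)
  induction t using DirectSum.Decomposition.inductionOn (grade S V) with
  | zero => exact h0
  | add a b ha hb => exact hadd a b ha hb
  | @homogeneous n t =>
    obtain ⟨t, ht⟩ := t
    change p t
    have key : ∀ s : S, p (s • t) := by
      refine Submodule.span_induction (p := fun t _ => ∀ s : S, p (s • t)) ?_ ?_ ?_ ?_ ht
      · rintro _ ⟨l, -, rfl⟩ s
        exact hprod l s
      · intro s
        rw [smul_zero]
        exact h0
      · intro a b _ _ ha hb s
        rw [smul_add]
        exact hadd _ _ (ha s) (hb s)
      · intro r a _ ha s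
        rw [← mul_smul]
        exact ha _
    have h := key 1
    rwa [one_smul] at h

theorem scalar_eq_smul_one (s : S) : scalar S V s = s • (1 : TensorRing S V) := by
  rw [smul_def, mul_one]

variable (S V) in
/-- The canonical map `V → T_S(V)` as an `S`-linear map. -/
def vecₗ : V →ₗ[S] TensorRing S V :=
  { vec S V with map_smul' := vec_smul S V }

variable (S V) in
/-- The multiplication `T ⊗_S V → T`, whose image is `T⁺`. -/
def mulVec : BTensor S (TensorRing S V) V →ₗ[TensorRing S V] TensorRing S V :=
  tensorLift (vecₗ S V)

theorem mulVec_tmul (t : TensorRing S V) (v : V) : mulVec S V (tmul t v) = t * vec S V v := rfl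

variable [SMulCommClass S Sᵐᵒᵖ V]

variable (S V) in
/-- The action of `T = T_S(V)` on the extension of `S` by `T ⊗_S V` in which `v ∈ V` maps `s ∈ S`
to `1 ⊗ v s`.  As a `T`-module this is `T` itself, written as `T⁺ ⊕ S`. -/
def extAction : TensorRing S V →+*
    AddMonoid.End (BTensor S (TensorRing S V) V × S) :=
  lift (Module.toAddMonoidEnd S (BTensor S (TensorRing S V) V × S))
    (AddMonoidHom.mk' (fun v => AddMonoidHom.mk' (fun x : BTensor S (TensorRing S V) V × S =>
        (vec S V v • x.1 + tmul 1 (MulOpposite.op x.2 • v), (0 : S)))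
      (fun x y => by
        refine Prod.ext ?_ (add_zero _).symm
        change vec S V v • (x.1 + y.1) + tmul 1 (MulOpposite.op (x.2 + y.2) • v) =
          (vec S V v • x.1 + tmul 1 (MulOpposite.op x.2 • v)) +
            (vec S V v • y.1 + tmul 1 (MulOpposite.op y.2 • v))
        rw [smul_add, MulOpposite.op_add, add_smul, tmul_add]
        abel))
      (fun v w => by
        refine AddMonoidHom.ext fun x => Prod.ext ?_ (add_zero _).symm
        change vec S V (v + w) • x.1 + tmul 1 (MulOpposite.op x.2 • (v + w)) =
          (vec S V v • x.1 + tmul 1 (MulOpposite.op x.2 • v)) +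
            (vec S V w • x.1 + tmul 1 (MulOpposite.op x.2 • w))
        rw [smul_add, map_add, add_smul, tmul_add]
        abel))
    (fun s v => by
      refine AddMonoidHom.ext fun x => Prod.ext ?_ (mul_zero s).symm
      change vec S V (s • v) • x.1 + tmul 1 (MulOpposite.op x.2 • s • v) =
        s • (vec S V v • x.1 + tmul 1 (MulOpposite.op x.2 • v))
      rw [vec_smul, smul_add, smul_assoc, ← smul_comm s _ v, ← oneTmul_apply, map_smul]
      rfl)
    (fun s v => by
      refine AddMonoidHom.ext fun x => Prod.ext ?_ rfl
      change vec S V (MulOpposite.op s • v) • x.1 + tmul 1 (MulOpposite.op x.2 •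
          MulOpposite.op s • v) =
        vec S V v • s • x.1 + tmul 1 (MulOpposite.op (s * x.2) • v)
      rw [vec_op_smul, mul_smul, smul_one_smul', MulOpposite.op_mul, mul_smul])

theorem extAction_scalar (s : S) (x : BTensor S (TensorRing S V) V × S) :
    extAction S V (scalar S V s) x = (s • x.1, s * x.2) := by
  exact DFunLike.congr_fun (lift_scalar _ _ _ _ s) x

theorem extAction_vec (v : V) (x : BTensor S (TensorRing S V) V × S) :
    extAction S V (vec S V v) x =
      (vec S V v • x.1 + tmul 1 (MulOpposite.op x.2 • v), 0) := by
  exact DFunLike.congr_fun (lift_vec _ _ _ _ v) x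

theorem extAction_mul (a b : TensorRing S V) (x : BTensor S (TensorRing S V) V × S) :
    extAction S V (a * b) x = extAction S V a (extAction S V b x) := by
  rw [map_mul]
  rfl

theorem extAction_add (a b : TensorRing S V) (x : BTensor S (TensorRing S V) V × S) :
    extAction S V (a + b) x = extAction S V a x + extAction S V b x := by
  rw [map_add]
  rfl

theorem extAction_inl (t : TensorRing S V) (n : BTensor S (TensorRing S V) V) :
    extAction S V t (n, 0) = (t • n, 0) := by
  induction t using induction generalizing n with
  | hs s => rw [extAction_scalar, mul_zero, scalar_eq_smul_one, smul_one_smul']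
  | hv t v ih =>
    rw [extAction_mul, extAction_vec]
    simp only [MulOpposite.op_zero, zero_smul, tmul_zero, add_zero]
    rw [ih, mul_smul]
  | hadd a b ha hb =>
    rw [extAction_add, ha, hb, add_smul, Prod.mk_add_mk, add_zero]

variable (S V) in
/-- The left `S`-linear map `T → T ⊗_S V` with `t v ↦ t ⊗ v` for `v ∈ V`, which vanishes on
`T^0 = S`. -/
def delta : TensorRing S V →ₗ[S] BTensor S (TensorRing S V) V where
  toFun t := (extAction S V t (0, 1)).1
  map_add' a b := by rw [extAction_add]; rfl
  map_smul' s t := by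
    rw [smul_def, extAction_mul, extAction_scalar]
    rfl

theorem delta_scalar (s : S) : delta S V (scalar S V s) = 0 := by
  change (extAction S V (scalar S V s) (0, 1)).1 = 0
  rw [extAction_scalar, smul_zero]

theorem delta_mul_vec (t : TensorRing S V) (v : V) :
    delta S V (t * vec S V v) = tmul t v := by
  change (extAction S V (t * vec S V v) (0, 1)).1 = tmul t v
  rw [extAction_mul, extAction_vec, smul_zero, zero_add, MulOpposite.op_one,
    one_smul, extAction_inl, ← tmul_eq_smul]

theorem delta_mulVec (y : BTensor S (TensorRing S V) V) : delta S V (mulVec S V y) = y := by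
  induction y using BTensor.induction with
  | h0 => rw [map_zero, map_zero]
  | ht t v => rw [mulVec_tmul, delta_mul_vec]
  | hadd x y hx hy => rw [map_add, map_add, hx, hy]

theorem mulVec_delta (t : TensorRing S V) :
    mulVec S V (delta S V t) = t - GradedRing.proj (grade S V) 0 t := by
  induction t using induction with
  | hs s => rw [delta_scalar, map_zero, proj_of_mem (scalar_mem s), if_pos rfl, sub_self]
  | hv t v _ =>
    rw [delta_mul_vec, mulVec_tmul, proj_zero_mul_of_mem_one _ (vec_mem v), sub_zero]
  | hadd a b ha hb => rw [map_add, map_add, ha, hb, map_add, add_sub_add_comm]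

theorem mulVec_delta_of_proj {t : TensorRing S V}
    (ht : GradedRing.proj (grade S V) 0 t = 0) : mulVec S V (delta S V t) = t := by
  rw [mulVec_delta, ht, sub_zero]

theorem delta_mul {t : TensorRing S V} (ht : GradedRing.proj (grade S V) 0 t = 0)
    (a : TensorRing S V) : delta S V (a * t) = a • delta S V t := by
  conv_lhs => rw [← mulVec_delta_of_proj ht, ← smul_eq_mul, ← map_smul, delta_mulVec]

theorem exists_eq_scalar {t : TensorRing S V} (ht : t ∈ grade S V 0) :
    ∃ s, t = scalar S V s := by
  refine Submodule.span_induction (p := fun t _ => ∃ s, t = scalar S V s) ?_ ?_ ?_ ?_ ht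
  · rintro _ ⟨l, hl, rfl⟩
    rw [List.length_eq_zero_iff] at hl
    exact ⟨1, by rw [hl, map_one]; rfl⟩
  · exact ⟨0, (map_zero _).symm⟩
  · rintro _ _ _ _ ⟨a, rfl⟩ ⟨b, rfl⟩
    exact ⟨a + b, (map_add _ _ _).symm⟩
  · rintro s _ _ ⟨a, rfl⟩
    exact ⟨s * a, by rw [smul_def, map_mul]⟩

theorem exists_eq_vec {t : TensorRing S V} (ht : t ∈ grade S V 1) :
    ∃ v, t = vec S V v := by
  refine Submodule.span_induction (p := fun t _ => ∃ v, t = vec S V v) ?_ ?_ ?_ ?_ ht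
  · rintro _ ⟨l, hl, rfl⟩
    obtain ⟨v, rfl⟩ := List.length_eq_one_iff.1 hl
    exact ⟨v, by simp⟩
  · exact ⟨0, (map_zero _).symm⟩
  · rintro _ _ _ _ ⟨a, rfl⟩ ⟨b, rfl⟩
    exact ⟨a + b, (map_add _ _ _).symm⟩
  · rintro s _ _ ⟨a, rfl⟩
    exact ⟨s • a, (vec_smul S V s a).symm⟩

end Delta

end TensorRing

/-! ### The ideal `I_A` and bimodules of relations -/

section Relations

variable {S : Type u} {A : Type v} [Ring S] [Ring A] [Module S A] [IsScalarTower S A A]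
  (𝒜 : ℕ → Submodule S A) [GradedRing 𝒜]

instance smulCommClass_rightModule (n : ℕ) : SMulCommClass S Sᵐᵒᵖ (𝒜 n) :=
  ⟨fun s t a => Subtype.ext (smul_mul_assoc s a.1 (t.unop • (1 : A))).symm⟩

theorem piA_proj (n : ℕ) (t : TA 𝒜) :
    piA 𝒜 (GradedRing.proj (gradeTA 𝒜) n t) = GradedRing.proj 𝒜 n (piA 𝒜 t) := by
  induction t using DirectSum.Decomposition.inductionOn (gradeTA 𝒜) with
  | zero => simp only [map_zero]
  | add a b ha hb => simp only [map_add, ha, hb]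
  | @homogeneous i t =>
    rw [proj_of_mem t.2, proj_of_mem (piA_mem 𝒜 t.2)]
    split_ifs
    · rfl
    · exact map_zero _

variable {𝒜} in
theorem proj_mem_idealA {t : TA 𝒜} (ht : t ∈ idealA 𝒜) (n : ℕ) :
    GradedRing.proj (gradeTA 𝒜) n t ∈ idealA 𝒜 := by
  rw [TwoSidedIdeal.mem_ker] at *
  rw [piA_proj, ht, map_zero]

variable {𝒜} in
theorem proj_zero_of_mem_idealA (hconn : IsConnected 𝒜) {t : TA 𝒜} (ht : t ∈ idealA 𝒜) :
    GradedRing.proj (gradeTA 𝒜) 0 t = 0 := by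
  have h := (TwoSidedIdeal.mem_ker _).1 (proj_mem_idealA ht 0)
  obtain ⟨s, hs⟩ := TensorRing.exists_eq_scalar (proj_mem (gradeTA 𝒜) 0 t)
  rw [hs, piA_scalar] at h
  have h1 : s = 0 := hconn.1 (by simpa using h)
  rw [hs, h1, map_zero]

variable {𝒜} in
theorem proj_one_of_mem_idealA {t : TA 𝒜} (ht : t ∈ idealA 𝒜) :
    GradedRing.proj (gradeTA 𝒜) 1 t = 0 := by
  have h := (TwoSidedIdeal.mem_ker _).1 (proj_mem_idealA ht 1)
  obtain ⟨v, hv⟩ := TensorRing.exists_eq_vec (proj_mem (gradeTA 𝒜) 1 t)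
  rw [hv, piA_vec] at h
  have h1 : v = 0 := Subtype.ext h
  rw [hv, h1, map_zero]

variable {𝒜} in
theorem mul_mem_decomposables {n : ℕ} {t y : TA 𝒜} (ht : t ∈ gradeTA 𝒜 (n + 1))
    (hy : y ∈ idealA 𝒜) : t * y ∈ decomposables (gradeTA 𝒜) (idealA 𝒜) := by
  refine Submodule.span_induction
    (p := fun t _ => t * y ∈ decomposables (gradeTA 𝒜) (idealA 𝒜)) ?_ ?_ ?_ ?_ ht
  · rintro _ ⟨l, hl, rfl⟩
    obtain ⟨v, l, rfl⟩ := List.exists_cons_of_length_eq_add_one hl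
    rw [List.map_cons, List.prod_cons, mul_assoc]
    exact Submodule.subset_span ⟨_, TensorRing.vec_mem v, _, TwoSidedIdeal.mul_mem_left _ _ _ hy,
      Or.inl rfl⟩
  · rw [zero_mul]; exact zero_mem _
  · intro a b _ _ ha hb
    rw [add_mul]; exact add_mem ha hb
  · intro s a _ ha
    rw [smul_mul_assoc]; exact Submodule.smul_mem _ _ ha

variable {𝒜} in
theorem mul_mem_decomposables_of_proj {t y : TA 𝒜}
    (ht : GradedRing.proj (gradeTA 𝒜) 0 t = 0) (hy : y ∈ idealA 𝒜) :
    t * y ∈ decomposables (gradeTA 𝒜) (idealA 𝒜) := by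
  obtain ⟨N, hN⟩ := exists_eq_sum_proj (gradeTA 𝒜) t
  rw [hN N le_rfl, Finset.sum_mul]
  refine sum_mem fun i _ => ?_
  cases i with
  | zero => rw [ht, zero_mul]; exact zero_mem _
  | succ i => exact mul_mem_decomposables (proj_mem _ _ t) hy

variable {𝒜} in
theorem smul_mem_idealOf {X : Set (TA 𝒜)} (s : S) {x : TA 𝒜} (hx : x ∈ idealOf X) :
    s • x ∈ idealOf X := by
  rw [TensorRing.smul_def]
  exact TwoSidedIdeal.mul_mem_left _ _ _ hx

variable {𝒜} in
/-- A bimodule of relations generates the ideal `I_A`, by induction on the degree. -/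
theorem IsBimoduleOfRelations.idealOf_eq {R : Submodule S (TA 𝒜)}
    (hR : IsBimoduleOfRelations (gradeTA 𝒜) R (idealA 𝒜)) :
    idealOf (R : Set (TA 𝒜)) = idealA 𝒜 := by
  obtain ⟨-, hgr, -, hsup⟩ := hR
  have hsup' : ∀ x, x ∈ R ⊔ decomposables (gradeTA 𝒜) (idealA 𝒜) ↔ x ∈ idealA 𝒜 := fun x =>
    Set.ext_iff.1 hsup x
  refine le_antisymm (TwoSidedIdeal.span_le.2 fun r hr => (hsup' r).1
    (Submodule.mem_sup_left hr)) ?_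
  have key : ∀ n, ∀ x ∈ idealA 𝒜, GradedRing.proj (gradeTA 𝒜) n x ∈ idealOf (R : Set (TA 𝒜)) := by
    intro n
    induction n with
    | zero =>
      intro x hx
      obtain ⟨r, hr, y, hy, rfl⟩ := Submodule.mem_sup.1 ((hsup' x).2 hx)
      rw [map_add]
      refine add_mem (TwoSidedIdeal.subset_span (hgr r hr 0)) ?_
      refine Submodule.span_induction (p := fun y _ => GradedRing.proj (gradeTA 𝒜) 0 y ∈
        idealOf (R : Set (TA 𝒜))) ?_ ?_ ?_ ?_ hy
      · rintro _ ⟨t, ht, y, hy, rfl | rfl⟩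
        · have h : GradedRing.proj (gradeTA 𝒜) 0 (t * y) = 0 := by
            rw [proj_mul]
            simp [proj_of_mem ht]
          rw [h]; exact zero_mem _
        · rw [proj_zero_mul_of_mem_one _ ht]; exact zero_mem _
      · rw [map_zero]; exact zero_mem _
      · intro a b _ _ ha hb
        rw [map_add]; exact add_mem ha hb
      · intro s a _ ha
        rw [proj_smul]; exact smul_mem_idealOf s ha
    | succ n ih =>
      intro x hx
      obtain ⟨r, hr, y, hy, rfl⟩ := Submodule.mem_sup.1 ((hsup' x).2 hx)
      rw [map_add]
      refine add_mem (TwoSidedIdeal.subset_span (hgr r hr _)) ?_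
      refine Submodule.span_induction (p := fun y _ => GradedRing.proj (gradeTA 𝒜) (n + 1) y ∈
        idealOf (R : Set (TA 𝒜))) ?_ ?_ ?_ ?_ hy
      · rintro _ ⟨t, ht, y, hy, rfl | rfl⟩
        · have h : GradedRing.proj (gradeTA 𝒜) (n + 1) (t * y) =
              t * GradedRing.proj (gradeTA 𝒜) n y := by
            rw [proj_mul, Finset.sum_eq_single_of_mem (1, n) (by simp; omega)]
            · rw [proj_of_mem ht, if_pos rfl]
            · rintro ⟨a, b⟩ hab hne
              rw [Finset.HasAntidiagonal.mem_antidiagonal] at hab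
              rw [proj_of_mem ht, if_neg, zero_mul]
              rintro rfl
              exact hne (Prod.ext rfl (by simp only at hab ⊢; omega))
          rw [h]
          exact TwoSidedIdeal.mul_mem_left _ _ _ (ih y hy)
        · rw [proj_mul_of_mem_one _ ht]
          exact TwoSidedIdeal.mul_mem_right _ _ _ (ih y hy)
      · rw [map_zero]; exact zero_mem _
      · intro a b _ _ ha hb
        rw [map_add]; exact add_mem ha hb
      · intro s a _ ha
        rw [proj_smul]; exact smul_mem_idealOf s ha
  intro x hx
  obtain ⟨N, hN⟩ := exists_eq_sum_proj (gradeTA 𝒜) x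
  rw [hN N le_rfl]
  exact sum_mem fun n _ => key n x hx

/-- The map `τ : T_A → A ⊗ A^1` with `t v ↦ π_A(t) ⊗ v` for `v ∈ A^1`, which vanishes on `S`. -/
def tau : TA 𝒜 →ₗ[S] BTensor S A (𝒜 1) :=
  (tensorMapₛ (𝒜 1) (piAHom 𝒜)).comp (TensorRing.delta S (𝒜 1))

theorem tau_apply (t : TA 𝒜) : tau 𝒜 t = tensorMap (piAHom 𝒜) (TensorRing.delta S (𝒜 1) t) := rfl

theorem tau_mulVec (y : BTensor S (TA 𝒜) (𝒜 1)) :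
    tau 𝒜 (TensorRing.mulVec S (𝒜 1) y) = tensorMap (piAHom 𝒜) y := by
  rw [tau_apply, TensorRing.delta_mulVec]

theorem tau_mul_vec (t : TA 𝒜) (v : 𝒜 1) :
    tau 𝒜 (t * TensorRing.vec S (𝒜 1) v) = tmul (piA 𝒜 t) v := by
  rw [tau_apply, TensorRing.delta_mul_vec, tensorMap_tmul]
  rfl

variable {𝒜} in
theorem tau_mul {t : TA 𝒜} (ht : GradedRing.proj (gradeTA 𝒜) 0 t = 0) (a : TA 𝒜) :
    tau 𝒜 (a * t) = piA 𝒜 a • tau 𝒜 t := by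
  rw [tau_apply, TensorRing.delta_mul ht, tensorMap_smul]
  rfl

theorem d₁_tensorMap (y : BTensor S (TA 𝒜) (𝒜 1)) :
    d₁ 𝒜 (tensorMap (piAHom 𝒜) y) = piA 𝒜 (TensorRing.mulVec S (𝒜 1) y) := by
  induction y using BTensor.induction with
  | h0 => simp only [map_zero]
  | ht t v =>
    rw [tensorMap_tmul, TensorRing.mulVec_tmul, map_mul, piA_vec]
    rfl
  | hadd x y hx hy => simp only [map_add, hx, hy]

variable {𝒜} in
theorem d₁_tau {t : TA 𝒜} (ht : GradedRing.proj (gradeTA 𝒜) 0 t = 0) :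
    d₁ 𝒜 (tau 𝒜 t) = piA 𝒜 t := by
  rw [tau_apply, d₁_tensorMap, TensorRing.mulVec_delta_of_proj ht]

variable {𝒜} in
theorem delta_mem {n : ℕ} {t : TA 𝒜} (ht : t ∈ gradeTA 𝒜 n) :
    TensorRing.delta S (𝒜 1) t ∈ tensorGrade (gradeTA 𝒜) (gradeOne 𝒜) n := by
  refine Submodule.span_induction (p := fun t _ => TensorRing.delta S (𝒜 1) t ∈
    tensorGradeₛ (gradeTA 𝒜) (gradeOne 𝒜) n) ?_ ?_ ?_ ?_ ht
  · rintro _ ⟨l, rfl, rfl⟩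
    rcases List.eq_nil_or_concat l with rfl | ⟨l, v, rfl⟩
    · rw [List.map_nil, List.prod_nil, ← map_one (TensorRing.scalar S (𝒜 1)),
        TensorRing.delta_scalar]
      exact zero_mem _
    · rw [List.concat_eq_append, List.map_append, List.prod_append, List.map_singleton,
        List.prod_singleton, TensorRing.delta_mul_vec, List.length_append]
      exact tmul_mem_tensorGrade rfl (Submodule.subset_span ⟨l, rfl, rfl⟩) (mem_gradeOne v)
  · rw [map_zero]; exact zero_mem _
  · intro a b _ _ ha hb
    rw [map_add]; exact add_mem ha hb
  · intro s a _ ha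
    rw [map_smul]; exact Submodule.smul_mem _ _ ha

variable {𝒜} in
theorem tau_mem {n : ℕ} {t : TA 𝒜} (ht : t ∈ gradeTA 𝒜 n) :
    tau 𝒜 t ∈ tensorGrade 𝒜 (gradeOne 𝒜) n :=
  tensorMap_mem_tensorGrade (piAHom 𝒜) (fun _ _ => piA_mem 𝒜) (delta_mem ht)

variable {𝒜} in
/-- The kernel of `τ` on `T⁺` is `I_A A^1`. -/
theorem mem_decomposables_of_tau_eq_zero [Module.Projective S (𝒜 1)] {t : TA 𝒜}
    (ht : GradedRing.proj (gradeTA 𝒜) 0 t = 0) (h : tau 𝒜 t = 0) :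
    t ∈ decomposables (gradeTA 𝒜) (idealA 𝒜) := by
  rw [← TensorRing.mulVec_delta_of_proj ht,
    ← linearCombination_coord (TensorRing.delta S (𝒜 1) t), Finsupp.linearCombination_apply,
    Finsupp.sum, map_sum]
  refine sum_mem fun v _ => Submodule.subset_span ⟨TensorRing.vec S (𝒜 1) v,
    TensorRing.vec_mem v, coord (TensorRing.delta S (𝒜 1) t) v, ?_, Or.inr ?_⟩
  · refine (TwoSidedIdeal.mem_ker _).2 ?_
    have h1 := coord_tensorMap (piAHom 𝒜) (TensorRing.delta S (𝒜 1) t) v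
    rw [← tau_apply, h, map_zero, Finsupp.zero_apply] at h1
    exact h1.symm
  · rw [map_smul, oneTmul_apply, TensorRing.mulVec_tmul, one_mul, smul_eq_mul]

variable (R : Submodule S (TA 𝒜))

/-- The map `A ⊗ R → A ⊗ A^1` induced by `R ⊆ T⁺ ≅ T ⊗ A^1`. -/
def relDiff : BTensor S A R →ₗ[A] BTensor S A (𝒜 1) := tensorLift ((tau 𝒜).comp R.subtype)

theorem relDiff_tmul (a : A) (r : R) : relDiff 𝒜 R (tmul a r) = a • tau 𝒜 r := rfl

variable {𝒜 R}

theorem tau_mem_range_relDiff (hconn : IsConnected 𝒜) (hbim : IsSubbimodule R)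
    (hgen : idealOf (R : Set (TA 𝒜)) = idealA 𝒜) {t : TA 𝒜} (ht : t ∈ idealA 𝒜) :
    tau 𝒜 t ∈ LinearMap.range (relDiff 𝒜 R) := by
  have hRI : ∀ r ∈ R, r ∈ idealA 𝒜 := fun r hr => hgen ▸ TwoSidedIdeal.subset_span hr
  rw [← hgen, TwoSidedIdeal.mem_span_iff_mem_addSubgroup_closure] at ht
  refine AddSubgroup.closure_induction
    (p := fun t _ => tau 𝒜 t ∈ LinearMap.range (relDiff 𝒜 R)) ?_ ?_ ?_ ?_ ht
  · rintro _ ⟨_, ⟨a, -, r, hr, rfl⟩, b, -, rfl⟩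
    change tau 𝒜 (a * r * b) ∈ _
    induction b using TensorRing.induction with
    | hs s =>
      have hrs : r * TensorRing.scalar S (𝒜 1) s ∈ R := by
        rw [TensorRing.scalar_eq_smul_one]
        exact hbim r hr s
      rw [mul_assoc, tau_mul (proj_zero_of_mem_idealA hconn (hRI _ hrs))]
      exact ⟨tmul (piA 𝒜 a) ⟨_, hrs⟩, rfl⟩
    | hv t v _ =>
      have h : piA 𝒜 (a * r * t) = 0 := by
        rw [map_mul, map_mul, (TwoSidedIdeal.mem_ker _).1 (hRI r hr), mul_zero, zero_mul]
      rw [← mul_assoc, tau_mul_vec, h, zero_tmul]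
      exact zero_mem _
    | hadd x y hx hy =>
      rw [mul_add, map_add]
      exact add_mem hx hy
  · rw [map_zero]; exact zero_mem _
  · intro a b _ _ ha hb
    rw [map_add]; exact add_mem ha hb
  · intro a _ ha
    rw [map_neg]; exact neg_mem ha

theorem exact_relDiff (hconn : IsConnected 𝒜) (hstrong : IsStronglyGraded 𝒜)
    (hbim : IsSubbimodule R) (hgen : idealOf (R : Set (TA 𝒜)) = idealA 𝒜) :
    Function.Exact (relDiff 𝒜 R) (d₁ 𝒜) := by
  intro y
  constructor
  · intro hy
    obtain ⟨y, rfl⟩ := tensorMap_surjective (piAHom 𝒜) (SRingHom.surjective_of_exists_lift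
      (𝒟 := gradeTA 𝒜) (exists_piA_eq 𝒜 hconn hstrong)) y
    rw [d₁_tensorMap] at hy
    rw [← tau_mulVec]
    exact tau_mem_range_relDiff hconn hbim hgen ((TwoSidedIdeal.mem_ker _).2 hy)
  · rintro ⟨x, rfl⟩
    induction x using BTensor.induction with
    | h0 => simp only [map_zero]
    | ht a r =>
      have hr : r.1 ∈ idealA 𝒜 := hgen ▸ TwoSidedIdeal.subset_span r.2
      rw [relDiff_tmul, map_smul, d₁_tau (proj_zero_of_mem_idealA hconn hr),
        (TwoSidedIdeal.mem_ker _).1 hr, smul_zero]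
    | hadd x y hx hy => rw [map_add, map_add, hx, hy, add_zero]

/-- For a bimodule of relations `R`, the kernel of `A ⊗ R → A ⊗ A^1` is contained in `A⁺ ⊗ R`:
this expresses `R ∩ (A^1 I_A + I_A A^1) = 0`. -/
theorem mem_augSmul_of_relDiff_eq_zero [Module.Projective S (𝒜 1)] (hconn : IsConnected 𝒜)
    (hstrong : IsStronglyGraded 𝒜) (hR : IsBimoduleOfRelations (gradeTA 𝒜) R (idealA 𝒜))
    {x : BTensor S A R} (hx : relDiff 𝒜 R x = 0) : x ∈ augSmul 𝒜 (BTensor S A R) := by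
  have hRI : ∀ r ∈ R, r ∈ idealA 𝒜 := fun r hr => by
    have h : r ∈ ((R ⊔ decomposables (gradeTA 𝒜) (idealA 𝒜) : Submodule S (TA 𝒜)) :
      Set (TA 𝒜)) := Submodule.mem_sup_left hr
    rw [hR.2.2.2] at h
    exact h
  obtain ⟨x, rfl⟩ := tensorMap_surjective (piAHom 𝒜) (SRingHom.surjective_of_exists_lift
      (𝒟 := gradeTA 𝒜) (exists_piA_eq 𝒜 hconn hstrong)) x
  have key : ∀ x : BTensor S (TA 𝒜) R, ∃ t ∈ idealA 𝒜, ∃ r : R,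
      tau 𝒜 t = relDiff 𝒜 R (tensorMap (piAHom 𝒜) x) ∧
      tensorMap (piAHom 𝒜) x - tmul 1 r ∈ augSmul 𝒜 (BTensor S A R) ∧
      t - r ∈ decomposables (gradeTA 𝒜) (idealA 𝒜) := by
    intro x
    induction x using BTensor.induction with
    | h0 =>
      refine ⟨0, zero_mem _, 0, by simp only [map_zero], ?_, ?_⟩
      · rw [map_zero, tmul_zero, sub_zero]; exact zero_mem _
      · rw [ZeroMemClass.coe_zero, sub_zero]; exact zero_mem _
    | ht t r =>
      obtain ⟨s, hs⟩ := TensorRing.exists_eq_scalar (proj_mem (gradeTA 𝒜) 0 t)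
      have ht0 : GradedRing.proj (gradeTA 𝒜) 0 (t - GradedRing.proj (gradeTA 𝒜) 0 t) = 0 := by
        rw [map_sub, proj_of_mem (proj_mem (gradeTA 𝒜) 0 t), if_pos rfl, sub_self]
      refine ⟨t * r, TwoSidedIdeal.mul_mem_left _ _ _ (hRI r r.2), s • r, ?_, ?_, ?_⟩
      · rw [tau_mul (proj_zero_of_mem_idealA hconn (hRI r r.2))]
        rfl
      · have h1 : tensorMap (piAHom 𝒜) (tmul t r) - tmul 1 (s • r) =
            piA 𝒜 (t - GradedRing.proj (gradeTA 𝒜) 0 t) • tmul (S := S) (1 : A) r := by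
          rw [tensorMap_tmul, tmul_smul, one_mul, smul_tmul, mul_one, map_sub, hs, piA_scalar,
            sub_eq_add_neg (piA 𝒜 t), add_tmul, sub_eq_add_neg]
          congr 1
        rw [h1]
        refine Submodule.subset_span ⟨_, ?_, _, rfl⟩
        obtain ⟨N, hN⟩ := exists_eq_sum_proj (gradeTA 𝒜)
          (t - GradedRing.proj (gradeTA 𝒜) 0 t)
        rw [hN N le_rfl, map_sum]
        refine sum_mem fun i _ => ?_
        cases i with
        | zero => rw [ht0, map_zero]; exact zero_mem _
        | succ i =>
          exact Ideal.subset_span ⟨i + 1, Nat.succ_pos i, piA_mem 𝒜 (proj_mem _ _ _)⟩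
      · have h1 : t * r.1 - (s • r : R).1 = (t - GradedRing.proj (gradeTA 𝒜) 0 t) * r.1 := by
          rw [sub_mul, hs, ← TensorRing.smul_def]
          rfl
        rw [h1]
        exact mul_mem_decomposables_of_proj ht0 (hRI r r.2)
    | hadd x y hx hy =>
      obtain ⟨t, ht, r, h1, h2, h3⟩ := hx
      obtain ⟨t', ht', r', h1', h2', h3'⟩ := hy
      refine ⟨t + t', add_mem ht ht', r + r', by simp only [map_add, h1, h1'], ?_, ?_⟩
      · rw [map_add, tmul_add, add_sub_add_comm]; exact add_mem h2 h2'
      · rw [Submodule.coe_add, add_sub_add_comm]; exact add_mem h3 h3'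
  obtain ⟨t, ht, r, h1, h2, h3⟩ := key x
  rw [hx] at h1
  have h4 := mem_decomposables_of_tau_eq_zero (proj_zero_of_mem_idealA hconn ht) h1
  have h5 : (r : TA 𝒜) ∈ decomposables (gradeTA 𝒜) (idealA 𝒜) := by
    have := sub_mem h4 h3
    rwa [sub_sub_cancel] at this
  have h6 : (r : TA 𝒜) ∈ R ⊓ decomposables (gradeTA 𝒜) (idealA 𝒜) := ⟨r.2, h5⟩
  rw [hR.2.2.1, Submodule.mem_bot] at h6
  have h7 : r = 0 := Subtype.ext h6
  rwa [h7, tmul_zero, sub_zero] at h2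

end Relations

/-! ### Graded modules -/

section GradedModules

/-- A family of subgroups is a grading: it spans, and there are projections onto its members. -/
structure IsGradedModule {M : Type*} [AddCommGroup M] (G : ℕ → AddSubgroup M) : Prop where
  exists_proj : ∀ n, ∃ p : M →+ M, (∀ x ∈ G n, p x = x) ∧ ∀ m, m ≠ n → ∀ x ∈ G m, p x = 0
  mem_iSup : ∀ x, x ∈ ⨆ n, G n

namespace IsGradedModule

variable {M : Type*} [AddCommGroup M] {G : ℕ → AddSubgroup M} (h : IsGradedModule G)

/-- The projection onto the component of degree `n`. -/
def proj (n : ℕ) : M →+ M := (h.exists_proj n).choose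

theorem proj_of_mem {n : ℕ} {x : M} (hx : x ∈ G n) : h.proj n x = x :=
  (h.exists_proj n).choose_spec.1 x hx

theorem proj_of_mem_ne {m n : ℕ} (hmn : m ≠ n) {x : M} (hx : x ∈ G m) : h.proj n x = 0 :=
  (h.exists_proj n).choose_spec.2 m hmn x hx

include h in
@[elab_as_elim]
theorem induction {p : M → Prop} (h0 : p 0) (hG : ∀ n, ∀ x ∈ G n, p x)
    (hadd : ∀ x y, p x → p y → p (x + y)) (x : M) : p x :=
  AddSubgroup.iSup_induction (C := p) G (h.mem_iSup x) hG h0 hadd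

theorem proj_mem (n : ℕ) (x : M) : h.proj n x ∈ G n := by
  induction x using h.induction with
  | h0 => rw [map_zero]; exact zero_mem _
  | hG m x hx =>
    by_cases hmn : m = n
    · subst hmn
      rwa [h.proj_of_mem hx]
    · rw [h.proj_of_mem_ne hmn hx]; exact zero_mem _
  | hadd x y hx hy => rw [map_add]; exact add_mem hx hy

theorem exists_eq_sum (x : M) : ∃ N, ∀ K, N ≤ K → x = ∑ n ∈ Finset.range K, h.proj n x := by
  induction x using h.induction with
  | h0 => exact ⟨0, fun K _ => by simp⟩
  | hG m x hx =>
    refine ⟨m + 1, fun K hK => ?_⟩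
    rw [Finset.sum_eq_single_of_mem m (Finset.mem_range.2 (by omega))
      (fun j _ hj => h.proj_of_mem_ne (Ne.symm hj) hx), h.proj_of_mem hx]
  | hadd a b ha hb =>
    obtain ⟨N, hN⟩ := ha
    obtain ⟨N', hN'⟩ := hb
    refine ⟨max N N', fun M hM => ?_⟩
    conv_lhs => rw [hN M (le_trans (le_max_left _ _) hM), hN' M (le_trans (le_max_right _ _) hM)]
    rw [← Finset.sum_add_distrib]
    simp only [map_add]

theorem map_proj {M' : Type*} [AddCommGroup M'] {G' : ℕ → AddSubgroup M'}
    (h' : IsGradedModule G') (d : M →+ M') (hd : ∀ n, ∀ x ∈ G n, d x ∈ G' n) (n : ℕ) (x : M) :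
    d (h.proj n x) = h'.proj n (d x) := by
  induction x using h.induction with
  | h0 => simp only [map_zero]
  | hG m x hx =>
    by_cases hmn : m = n
    · subst hmn
      rw [h.proj_of_mem hx, h'.proj_of_mem (hd _ x hx)]
    · rw [h.proj_of_mem_ne hmn hx, h'.proj_of_mem_ne hmn (hd _ x hx), map_zero]
  | hadd a b ha hb => simp only [map_add, ha, hb]

include h in
/-- The kernel of a homogeneous map is spanned by its homogeneous elements. -/
theorem mem_closure_of_map_eq_zero {M' : Type*} [AddCommGroup M'] {G' : ℕ → AddSubgroup M'}
    (h' : IsGradedModule G') (d : M →+ M') (hd : ∀ n, ∀ x ∈ G n, d x ∈ G' n) {x : M}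
    (hx : d x = 0) : x ∈ AddSubgroup.closure {y | ∃ n, y ∈ G n ∧ d y = 0} := by
  obtain ⟨N, hN⟩ := h.exists_eq_sum x
  rw [hN N le_rfl]
  refine sum_mem fun n _ => AddSubgroup.subset_closure ⟨n, h.proj_mem n x, ?_⟩
  rw [h.map_proj h' d hd, hx, map_zero]

end IsGradedModule

variable {S : Type u} {A : Type v} [Ring S] [Ring A] [Module S A] [IsScalarTower S A A]

theorem isGradedModule_of_gradedRing (𝒜 : ℕ → Submodule S A) [GradedRing 𝒜] :
    IsGradedModule (fun n => (𝒜 n).toAddSubgroup) where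
  exists_proj n := ⟨GradedRing.proj 𝒜 n, fun x hx => by rw [PBW.proj_of_mem hx, if_pos rfl],
    fun m hm x hx => by rw [PBW.proj_of_mem hx, if_neg hm]⟩
  mem_iSup x := by
    obtain ⟨N, hN⟩ := exists_eq_sum_proj 𝒜 x
    rw [hN N le_rfl]
    exact sum_mem fun n _ => AddSubgroup.mem_iSup_of_mem n (proj_mem 𝒜 n x)

variable (𝒜 : ℕ → Submodule S A) [GradedRing 𝒜]

theorem proj_mul_smul_one (n : ℕ) (a : A) (s : S) :
    GradedRing.proj 𝒜 n (a * (s • (1 : A))) = GradedRing.proj 𝒜 n a * (s • (1 : A)) := by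
  simp only [GradedRing.proj_apply]
  exact DirectSum.coe_decompose_mul_of_right_mem_zero 𝒜
    (Submodule.smul_mem (𝒜 0) s SetLike.GradedOne.one_mem)

theorem isGradedModule_tensorGrade {V : Type w} [AddCommGroup V] [Module S V]
    {𝒱 : ℕ → Submodule S V} (hV : DirectSum.IsInternal 𝒱) :
    IsGradedModule (tensorGrade 𝒜 𝒱) := by
  let _ := hV.chooseDecomposition
  have hmem : ∀ {i j : ℕ} {v : V}, v ∈ 𝒱 i → (DirectSum.decompose 𝒱 v j : V) =
      if i = j then v else 0 := by
    intro i j v hv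
    split_ifs with h
    · subst h
      exact DirectSum.decompose_of_mem_same _ hv
    · exact DirectSum.decompose_of_mem_ne _ hv h
  constructor
  · intro n
    -- the projection `a ⊗ v ↦ ∑_{i+j=n} aᵢ ⊗ vⱼ`
    let f : A →+ V →+ BTensor S A V := AddMonoidHom.mk' (fun a => AddMonoidHom.mk'
        (fun v => ∑ p ∈ Finset.HasAntidiagonal.antidiagonal n,
          tmul (GradedRing.proj 𝒜 p.1 a) (DirectSum.decompose 𝒱 v p.2 : V))
        (fun v w => by
          rw [← Finset.sum_add_distrib]
          refine Finset.sum_congr rfl fun p _ => ?_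
          rw [DirectSum.decompose_add, DirectSum.add_apply, Submodule.coe_add, tmul_add]))
      (fun a b => by
        ext v
        simp only [AddMonoidHom.mk'_apply, AddMonoidHom.add_apply, map_add, add_tmul,
          Finset.sum_add_distrib])
    have hf : ∀ a v, f a v = ∑ p ∈ Finset.HasAntidiagonal.antidiagonal n,
        tmul (GradedRing.proj 𝒜 p.1 a) (DirectSum.decompose 𝒱 v p.2 : V) := fun _ _ => rfl
    have hbal : ∀ a (s : S) v, f (a * (s • (1 : A))) v = f a (s • v) := by
      intro a s v
      rw [hf, hf]
      refine Finset.sum_congr rfl fun p _ => ?_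
      rw [proj_mul_smul_one, ← tmul_smul, DirectSum.decompose_smul]
      rfl
    have hhom : ∀ {i j : ℕ} {a : A} {v : V}, a ∈ 𝒜 i → v ∈ 𝒱 j →
        f a v = if i + j = n then tmul a v else 0 := by
      intro i j a v ha hv
      rw [hf]
      split_ifs with h
      · rw [Finset.sum_eq_single_of_mem (i, j) (by simpa using h)]
        · rw [proj_of_mem ha, if_pos rfl, hmem hv, if_pos rfl]
        · rintro ⟨k, l⟩ _ hkl
          rw [proj_of_mem ha, hmem hv]
          simp only
          split_ifs with h1 h2
          · exact absurd (by rw [h1, h2]) hkl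
          · exact tmul_zero _
          · exact zero_tmul _
          · exact zero_tmul _
      · refine Finset.sum_eq_zero ?_
        rintro ⟨k, l⟩ hkl
        rw [Finset.HasAntidiagonal.mem_antidiagonal] at hkl
        rw [proj_of_mem ha, hmem hv]
        simp only at hkl ⊢
        split_ifs with h1 h2
        · exact absurd (by rw [h1, h2]; exact hkl) h
        · exact tmul_zero _
        · exact zero_tmul _
        · exact zero_tmul _
    refine ⟨tensorLiftAdd f hbal, ?_, ?_⟩
    · intro x hx
      refine AddSubgroup.closure_induction (p := fun x _ => tensorLiftAdd f hbal x = x)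
        ?_ ?_ ?_ ?_ hx
      · rintro _ ⟨i, j, b, v, hij, hb, hv, rfl⟩
        rw [tensorLiftAdd_tmul, hhom hb hv, if_pos hij]
      · exact map_zero _
      · intro x y _ _ hx hy
        rw [map_add, hx, hy]
      · intro x _ hx
        rw [map_neg, hx]
    · intro m hm x hx
      refine AddSubgroup.closure_induction (p := fun x _ => tensorLiftAdd f hbal x = 0)
        ?_ ?_ ?_ ?_ hx
      · rintro _ ⟨i, j, b, v, hij, hb, hv, rfl⟩
        rw [tensorLiftAdd_tmul, hhom hb hv, if_neg (by rw [hij]; exact hm)]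
      · exact map_zero _
      · intro x y _ _ hx hy
        rw [map_add, hx, hy, add_zero]
      · intro x _ hx
        rw [map_neg, hx, neg_zero]
  · intro x
    induction x using BTensor.induction with
    | h0 => exact zero_mem _
    | hadd x y hx hy => exact add_mem hx hy
    | ht a v =>
      induction v using DirectSum.Decomposition.inductionOn 𝒱 with
      | zero => rw [tmul_zero]; exact zero_mem _
      | add v w hv hw => rw [tmul_add]; exact add_mem hv hw
      | @homogeneous j v =>
        induction a using DirectSum.Decomposition.inductionOn 𝒜 with
        | zero => rw [zero_tmul]; exact zero_mem _
        | add a b ha hb => rw [add_tmul]; exact add_mem ha hb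
        | @homogeneous i a =>
          exact AddSubgroup.mem_iSup_of_mem (i + j) (tmul_mem_tensorGrade rfl a.2 v.2)

/-- The degree `n` part of the free `A`-module on generators `x ∈ X` of degrees `deg x`. -/
def freeGrade {X : Type w} (deg : X → ℕ) (n : ℕ) : AddSubgroup (X →₀ A) :=
  AddSubgroup.closure {f | ∃ (x : X) (k : ℕ) (a : A),
    k + deg x = n ∧ a ∈ 𝒜 k ∧ f = Finsupp.single x a}

theorem smul_mem_freeGrade {X : Type w} (deg : X → ℕ) {i n : ℕ} {a : A} {f : X →₀ A}
    (ha : a ∈ 𝒜 i) (hf : f ∈ freeGrade 𝒜 deg n) : a • f ∈ freeGrade 𝒜 deg (i + n) := by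
  refine AddSubgroup.closure_induction (p := fun f _ => a • f ∈ freeGrade 𝒜 deg (i + n))
    ?_ ?_ ?_ ?_ hf
  · rintro _ ⟨x, k, b, rfl, hb, rfl⟩
    rw [Finsupp.smul_single]
    exact AddSubgroup.subset_closure ⟨x, i + k, a • b, add_assoc _ _ _,
      SetLike.GradedMul.mul_mem ha hb, rfl⟩
  · rw [smul_zero]; exact zero_mem _
  · intro x y _ _ hx hy
    rw [smul_add]; exact add_mem hx hy
  · intro x _ hx
    rw [smul_neg]; exact neg_mem hx

theorem isGradedModule_freeGrade {X : Type w} (deg : X → ℕ) :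
    IsGradedModule (freeGrade 𝒜 deg) := by
  constructor
  · intro n
    let p : (X →₀ A) →+ (X →₀ A) := Finsupp.liftAddHom (fun x => (Finsupp.singleAddHom x).comp
      (if deg x ≤ n then GradedRing.proj 𝒜 (n - deg x) else 0))
    have hp : ∀ {k : ℕ} {a : A} (x : X), a ∈ 𝒜 k → p (Finsupp.single x a) =
        if k + deg x = n then Finsupp.single x a else 0 := by
      intro k a x ha
      have h1 : p (Finsupp.single x a) = Finsupp.single x
          ((if deg x ≤ n then GradedRing.proj 𝒜 (n - deg x) else 0) a) :=
        Finsupp.liftAddHom_apply_single _ _ _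
      rw [h1]
      split_ifs with h2 h3 h4
      · rw [proj_of_mem ha, if_pos (by omega)]
      · rw [proj_of_mem ha, if_neg (by omega), Finsupp.single_zero]
      · omega
      · rw [AddMonoidHom.zero_apply, Finsupp.single_zero]
    refine ⟨p, ?_, ?_⟩
    · intro x hx
      refine AddSubgroup.closure_induction (p := fun x _ => p x = x) ?_ ?_ ?_ ?_ hx
      · rintro _ ⟨x, k, a, hk, ha, rfl⟩
        rw [hp x ha, if_pos hk]
      · exact map_zero _
      · intro x y _ _ hx hy
        rw [map_add, hx, hy]
      · intro x _ hx
        rw [map_neg, hx]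
    · intro m hm x hx
      refine AddSubgroup.closure_induction (p := fun x _ => p x = 0) ?_ ?_ ?_ ?_ hx
      · rintro _ ⟨x, k, a, hk, ha, rfl⟩
        rw [hp x ha, if_neg (by rw [hk]; exact hm)]
      · exact map_zero _
      · intro x y _ _ hx hy
        rw [map_add, hx, hy, add_zero]
      · intro x _ hx
        rw [map_neg, hx, neg_zero]
  · intro f
    induction f using Finsupp.induction_linear with
    | zero => exact zero_mem _
    | add f g hf hg => exact add_mem hf hg
    | single x a =>
      induction a using DirectSum.Decomposition.inductionOn 𝒜 with
      | zero => rw [Finsupp.single_zero]; exact zero_mem _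
      | add a b ha hb => rw [Finsupp.single_add]; exact add_mem ha hb
      | @homogeneous i a =>
        exact AddSubgroup.mem_iSup_of_mem (i + deg x)
          (AddSubgroup.subset_closure ⟨x, i, a, rfl, a.2, rfl⟩)

/-- The graded lifting property: homogeneous maps out of `F` lift along maps which are surjective
in the relevant degrees. -/
def HasGradedLifts.{a, b, c} {F : Type a} [AddCommGroup F] [Module A F] (G : ℕ → AddSubgroup F) :
    Prop :=
  ∀ {M : Type b} {N : Type c} [AddCommGroup M] [AddCommGroup N] [Module A M] [Module A N]
    (p : M →ₗ[A] N) (f : F →ₗ[A] N) (ℳ : ℕ → AddSubgroup M)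
    (_ : ∀ i n a m, a ∈ 𝒜 i → m ∈ ℳ n → a • m ∈ ℳ (i + n))
    (_ : ∀ n, ∀ x ∈ G n, ∃ m ∈ ℳ n, p m = f x),
    ∃ g : F →ₗ[A] M, (∀ x, p (g x) = f x) ∧ ∀ n, ∀ x ∈ G n, g x ∈ ℳ n

theorem hasGradedLifts_freeGrade {X : Type w} (deg : X → ℕ) :
    HasGradedLifts.{u, v, max v w, x, y} 𝒜 (freeGrade 𝒜 deg) := by
  intro M N _ _ _ _ p f ℳ hℳ h
  have h1 : ∀ x, ∃ m ∈ ℳ (deg x), p m = f (Finsupp.single x 1) := fun x => h _ _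
    (AddSubgroup.subset_closure ⟨x, 0, 1, zero_add _, SetLike.GradedOne.one_mem, rfl⟩)
  choose m hm hpm using h1
  refine ⟨Finsupp.linearCombination A m, ?_, ?_⟩
  · intro x
    induction x using Finsupp.induction_linear with
    | zero => simp only [map_zero]
    | add f g hf hg => simp only [map_add, hf, hg]
    | single x a =>
      rw [Finsupp.linearCombination_single, map_smul, hpm, ← map_smul, Finsupp.smul_single,
        smul_eq_mul, mul_one]
  · intro n x hx
    refine AddSubgroup.closure_induction
      (p := fun x _ => Finsupp.linearCombination A m x ∈ ℳ n) ?_ ?_ ?_ ?_ hx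
    · rintro _ ⟨x, k, a, rfl, ha, rfl⟩
      rw [Finsupp.linearCombination_single]
      exact hℳ _ _ _ _ ha (hm x)
    · rw [map_zero]; exact zero_mem _
    · intro x y _ _ hx hy
      rw [map_add]; exact add_mem hx hy
    · intro x _ hx
      rw [map_neg]; exact neg_mem hx

variable (A) in
/-- The structure map `S → A` of an `S`-ring. -/
def structureMap : S →+* A where
  toFun s := s • 1
  map_one' := one_smul _ _
  map_mul' s t := by rw [smul_mul_assoc, one_mul, mul_smul]
  map_zero' := zero_smul _ _
  map_add' s t := add_smul _ _ _

theorem hasGradedLifts_tensorGrade {V : Type w} [AddCommGroup V] [Module S V]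
    [Module.Projective S V] {𝒱 : ℕ → Submodule S V} (hV : DirectSum.IsInternal 𝒱) :
    HasGradedLifts.{u, v, max v w, x, y} 𝒜 (tensorGrade 𝒜 𝒱) := by
  intro M N _ _ _ _ p f ℳ hℳ h
  let _ : Module S M := Module.compHom M (structureMap (S := S) A)
  let _ : Module S N := Module.compHom N (structureMap (S := S) A)
  have hM : ∀ (s : S) (m : M), s • m = (s • (1 : A)) • m := fun _ _ => rfl
  have hN : ∀ (s : S) (m : N), s • m = (s • (1 : A)) • m := fun _ _ => rfl
  have : IsScalarTower S A M := ⟨fun s a m => by rw [hM, ← mul_smul, smul_mul_assoc, one_mul]⟩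
  have : IsScalarTower S A N := ⟨fun s a m => by rw [hN, ← mul_smul, smul_mul_assoc, one_mul]⟩
  obtain ⟨g, hg, hgm⟩ := exists_graded_lift hV ((f.restrictScalars S).comp (oneTmul A))
    (p.restrictScalars S) (fun n => { ℳ n with
      smul_mem' := fun s m hm => by
        have h1 := hℳ 0 n _ m (Submodule.smul_mem (𝒜 0) s SetLike.GradedOne.one_mem) hm
        rw [zero_add] at h1
        exact h1 }) (fun j v hv => h j _
          (tmul_mem_tensorGrade (zero_add j) SetLike.GradedOne.one_mem hv))
  refine ⟨tensorLift g, ?_, ?_⟩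
  · intro x
    induction x using BTensor.induction with
    | h0 => simp only [map_zero]
    | hadd x y hx hy => simp only [map_add, hx, hy]
    | ht a v =>
      have h1 : p (g v) = f (tmul 1 v) := hg v
      rw [tensorLift_tmul, map_smul, h1, ← map_smul, ← tmul_eq_smul]
  · intro n x hx
    refine map_mem_of_forall_tmul_one 𝒜 𝒱 (f := tensorLift (B := A) g) (k := 0) (𝒩 := ℳ)
      hℳ (fun j hj => by omega) ?_ hx
    intro j _ v hv
    rw [tensorLift_tmul_one]
    exact hgm j v hv

end GradedModules

/-! ### Comparison of resolutions -/

section Comparison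

variable {S : Type u} {A : Type v} [Ring S] [Ring A] [Module S A] (𝒜 : ℕ → Submodule S A)

theorem smul_mem_augSmul {M : Type*} [AddCommGroup M] [Module A M] {a : A}
    (ha : a ∈ augIdeal 𝒜) (m : M) : a • m ∈ augSmul 𝒜 M :=
  Submodule.subset_span ⟨a, ha, m, rfl⟩

theorem map_mem_augSmul {M N : Type*} [AddCommGroup M] [Module A M] [AddCommGroup N] [Module A N]
    (f : M →ₗ[A] N) {x : M} (hx : x ∈ augSmul 𝒜 M) : f x ∈ augSmul 𝒜 N := by
  refine Submodule.span_induction (p := fun x _ => f x ∈ augSmul 𝒜 N) ?_ ?_ ?_ ?_ hx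
  · rintro _ ⟨a, ha, m, rfl⟩
    rw [map_smul]
    exact smul_mem_augSmul 𝒜 ha _
  · rw [map_zero]; exact zero_mem _
  · intro x y _ _ hx hy
    rw [map_add]; exact add_mem hx hy
  · intro a x _ hx
    rw [map_smul]; exact Submodule.smul_mem _ _ hx

theorem exists_mem_augSmul_eq {M N : Type*} [AddCommGroup M] [Module A M] [AddCommGroup N]
    [Module A N] {f : M →ₗ[A] N} (hf : Function.Surjective f) {y : N} (hy : y ∈ augSmul 𝒜 N) :
    ∃ x ∈ augSmul 𝒜 M, f x = y := by
  refine Submodule.span_induction (p := fun y _ => ∃ x ∈ augSmul 𝒜 M, f x = y) ?_ ?_ ?_ ?_ hy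
  · rintro _ ⟨a, ha, n, rfl⟩
    obtain ⟨m, rfl⟩ := hf n
    exact ⟨a • m, smul_mem_augSmul 𝒜 ha m, map_smul _ _ _⟩
  · exact ⟨0, zero_mem _, map_zero _⟩
  · rintro _ _ _ _ ⟨x, hx, rfl⟩ ⟨y, hy, rfl⟩
    exact ⟨x + y, add_mem hx hy, map_add _ _ _⟩
  · rintro a _ _ ⟨x, hx, rfl⟩
    exact ⟨a • x, Submodule.smul_mem _ _ hx, map_smul _ _ _⟩

/-- The elements of `A⁺ ker d`. -/
def augKer {F F' : Type*} [AddCommGroup F] [Module A F] [AddCommGroup F'] [Module A F']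
    (d : F →ₗ[A] F') : Submodule A F :=
  (augSmul 𝒜 (LinearMap.ker d)).map (LinearMap.ker d).subtype

theorem map_mem_augKer {F F' E E' : Type*} [AddCommGroup F] [Module A F] [AddCommGroup F']
    [Module A F'] [AddCommGroup E] [Module A E] [AddCommGroup E'] [Module A E']
    {d : F →ₗ[A] F'} {e : E →ₗ[A] E'} (f : F →ₗ[A] E) (hf : ∀ x, d x = 0 → e (f x) = 0) {x : F}
    (hx : x ∈ augKer 𝒜 d) : f x ∈ augKer 𝒜 e := by
  obtain ⟨k, hk, rfl⟩ := hx
  exact ⟨_, map_mem_augSmul 𝒜 (f.restrict (p := LinearMap.ker d) (q := LinearMap.ker e) hf) hk, rfl⟩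

theorem map_mem_augKer_of_mem_augSmul {E F F' : Type*} [AddCommGroup F] [Module A F]
    [AddCommGroup F'] [Module A F'] [AddCommGroup E] [Module A E] {d : F →ₗ[A] F'}
    (f : E →ₗ[A] F) (hf : ∀ x, d (f x) = 0) {x : E} (hx : x ∈ augSmul 𝒜 E) :
    f x ∈ augKer 𝒜 d :=
  ⟨_, map_mem_augSmul 𝒜 (f.codRestrict (LinearMap.ker d) hf) hx, rfl⟩

/-- For a map `d : F₂ → F₁` in a graded projective resolution, `Tor₃` vanishes in degree `m`: a
homogeneous element of `ker d ∩ A⁺F₂` of degree `m` lies in `A⁺ ker d`. -/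
def TorVanishes {F₁ F₂ : Type*} [AddCommGroup F₁] [Module A F₁] [AddCommGroup F₂] [Module A F₂]
    (G : ℕ → AddSubgroup F₂) (d : F₂ →ₗ[A] F₁) (m : ℕ) : Prop :=
  ∀ x ∈ G m, d x = 0 → x ∈ augSmul 𝒜 F₂ → x ∈ augKer 𝒜 d

/-- The properties of the part `F₂ → F₁ → F₀` of a graded resolution which are used to compare it
with another one. -/
structure IsPartialResolution {F₀ F₁ F₂ : Type*} [AddCommGroup F₀] [Module A F₀] [AddCommGroup F₁]
    [Module A F₁] [AddCommGroup F₂] [Module A F₂] (G₁ : ℕ → AddSubgroup F₁)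
    (G₂ : ℕ → AddSubgroup F₂) (d₁ : F₁ →ₗ[A] F₀) (d₂ : F₂ →ₗ[A] F₁) : Prop where
  smul₁ : ∀ i n a m, a ∈ 𝒜 i → m ∈ G₁ n → a • m ∈ G₁ (i + n)
  smul₂ : ∀ i n a m, a ∈ 𝒜 i → m ∈ G₂ n → a • m ∈ G₂ (i + n)
  map₂ : ∀ n, ∀ x ∈ G₂ n, d₂ x ∈ G₁ n
  comp : ∀ x, d₁ (d₂ x) = 0
  exact : ∀ n, ∀ x ∈ G₁ n, d₁ x = 0 → ∃ y ∈ G₂ n, d₂ y = x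
  ker₁ : ∀ x, d₁ x = 0 → x ∈ AddSubgroup.closure {y | ∃ n, y ∈ G₁ n ∧ d₁ y = 0}

theorem IsPartialResolution.mem_range {F₀ F₁ F₂ : Type*} [AddCommGroup F₀] [Module A F₀]
    [AddCommGroup F₁] [Module A F₁] [AddCommGroup F₂] [Module A F₂] {G₁ : ℕ → AddSubgroup F₁}
    {G₂ : ℕ → AddSubgroup F₂} {d₁ : F₁ →ₗ[A] F₀} {d₂ : F₂ →ₗ[A] F₁}
    (h : IsPartialResolution 𝒜 G₁ G₂ d₁ d₂) {x : F₁} (hx : d₁ x = 0) : ∃ y, d₂ y = x := by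
  have h1 : AddSubgroup.closure {y | ∃ n, y ∈ G₁ n ∧ d₁ y = 0} ≤
      (LinearMap.range d₂).toAddSubgroup := by
    rw [AddSubgroup.closure_le]
    rintro y ⟨n, hy, hd⟩
    obtain ⟨z, _, hz⟩ := h.exact n y hy hd
    exact ⟨z, hz⟩
  exact h1 (h.ker₁ x hx)

/-- Vanishing of `Tor₃` in a given degree does not depend on the resolution.  If `f : F → E` and
`g : E → F` are comparison maps and `h` is a homotopy in degree `1`, then `g₂f₂ - 1 - h d₂` has
image in `ker d₂`, hence maps `A⁺F₂` into `A⁺ ker d₂`. -/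
theorem TorVanishes.of_comparison.{a, b, c, d, e} {F₀ : Type a} {F₁ : Type b} {F₂ : Type c}
    {E₁ : Type d} {E₂ : Type e} [AddCommGroup F₀] [Module A F₀] [AddCommGroup F₁] [Module A F₁]
    [AddCommGroup F₂] [Module A F₂] [AddCommGroup E₁] [Module A E₁] [AddCommGroup E₂] [Module A E₂]
    [IsScalarTower S A A] [GradedRing 𝒜]
    {G₁ : ℕ → AddSubgroup F₁} {G₂ : ℕ → AddSubgroup F₂} {H₁ : ℕ → AddSubgroup E₁}
    {H₂ : ℕ → AddSubgroup E₂} {d₁ : F₁ →ₗ[A] F₀} {d₂ : F₂ →ₗ[A] F₁} {e₁ : E₁ →ₗ[A] F₀}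
    {e₂ : E₂ →ₗ[A] E₁} (hF : IsPartialResolution 𝒜 G₁ G₂ d₁ d₂)
    (hE : IsPartialResolution 𝒜 H₁ H₂ e₁ e₂)
    (hFE : ∀ n, ∀ x ∈ G₁ n, ∃ y ∈ H₁ n, e₁ y = d₁ x)
    (hEF : ∀ n, ∀ x ∈ H₁ n, ∃ y ∈ G₁ n, d₁ y = e₁ x)
    (lf₁ : HasGradedLifts.{u, v, b, d, a} 𝒜 G₁) (lg₁ : HasGradedLifts.{u, v, d, b, a} 𝒜 H₁)
    (lf₂ : HasGradedLifts.{u, v, c, e, d} 𝒜 G₂) (lg₂ : HasGradedLifts.{u, v, e, c, b} 𝒜 H₂)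
    (lh : HasGradedLifts.{u, v, b, c, b} 𝒜 G₁) {m : ℕ} (h : TorVanishes 𝒜 H₂ e₂ m) :
    TorVanishes 𝒜 G₂ d₂ m := by
  obtain ⟨f₁, hf₁, hf₁m⟩ := lf₁ e₁ d₁ H₁ hE.smul₁ hFE
  obtain ⟨g₁, hg₁, hg₁m⟩ := lg₁ d₁ e₁ G₁ hF.smul₁ hEF
  obtain ⟨f₂, hf₂, hf₂m⟩ := lf₂ e₂ (f₁.comp d₂) H₂ hE.smul₂ (fun n x hx => by
    refine hE.exact n _ (hf₁m n _ (hF.map₂ n x hx)) ?_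
    rw [LinearMap.comp_apply, hf₁, hF.comp])
  obtain ⟨g₂, hg₂, -⟩ := lg₂ d₂ (g₁.comp e₂) G₂ hF.smul₂ (fun n x hx => by
    refine hF.exact n _ (hg₁m n _ (hE.map₂ n x hx)) ?_
    rw [LinearMap.comp_apply, hg₁, hE.comp])
  obtain ⟨h₁, hh₁, -⟩ := lh d₂ (g₁.comp f₁ - LinearMap.id : F₁ →ₗ[A] F₁) (fun _ => ⊤)
    (fun _ _ _ _ _ _ => AddSubgroup.mem_top _) (fun n x hx => by
    have h1 : d₁ ((g₁.comp f₁ - LinearMap.id : F₁ →ₗ[A] F₁) x) = 0 := by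
      rw [LinearMap.sub_apply, LinearMap.comp_apply, map_sub, hg₁, hf₁, LinearMap.id_apply, sub_self]
    obtain ⟨y, hy⟩ := hF.mem_range 𝒜 h1
    exact ⟨y, AddSubgroup.mem_top _, hy⟩)
  intro x hx hdx hxm
  have h1 : g₂ (f₂ x) ∈ augKer 𝒜 d₂ := by
    refine map_mem_augKer 𝒜 (d := e₂) g₂ (fun y hy => ?_) (h _ (hf₂m m x hx) ?_
      (map_mem_augSmul 𝒜 f₂ hxm))
    · rw [hg₂, LinearMap.comp_apply, hy, map_zero]
    · rw [hf₂, LinearMap.comp_apply, hdx, map_zero]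
  have h2 : (g₂.comp f₂ - LinearMap.id - h₁.comp d₂ : F₂ →ₗ[A] F₂) x ∈ augKer 𝒜 d₂ := by
    refine map_mem_augKer_of_mem_augSmul 𝒜 _ (fun y => ?_) hxm
    simp only [LinearMap.sub_apply, LinearMap.comp_apply, LinearMap.id_apply, map_sub, hg₂, hf₂, hh₁]
    abel
  have h3 : x = g₂ (f₂ x) - (g₂.comp f₂ - LinearMap.id - h₁.comp d₂ : F₂ →ₗ[A] F₂) x := by
    simp only [LinearMap.sub_apply, LinearMap.comp_apply, LinearMap.id_apply, hdx, map_zero]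
    abel
  rw [h3]
  exact sub_mem h1 h2

end Comparison

/-! ### The standard resolution -/

section Standard

variable {S : Type u} {A : Type v} [Ring S] [Ring A] [Module S A] [IsScalarTower S A A]
  (𝒜 : ℕ → Submodule S A) [GradedRing 𝒜]

theorem mem_augIdeal_of_mem {n : ℕ} (hn : 0 < n) {a : A} (ha : a ∈ 𝒜 n) : a ∈ augIdeal 𝒜 :=
  Ideal.subset_span ⟨n, hn, ha⟩

theorem mem_augIdeal_iff {a : A} : a ∈ augIdeal 𝒜 ↔ GradedRing.proj 𝒜 0 a = 0 := by
  constructor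
  · intro ha
    refine Submodule.span_induction (p := fun a _ => GradedRing.proj 𝒜 0 a = 0) ?_ ?_ ?_ ?_ ha
    · rintro b ⟨n, hn, hb⟩
      rw [proj_of_mem hb, if_neg hn.ne']
    · exact map_zero _
    · intro x y _ _ hx hy
      rw [map_add, hx, hy, add_zero]
    · intro b x _ hx
      rw [smul_eq_mul, proj_mul, Finset.HasAntidiagonal.antidiagonal_zero, Finset.sum_singleton, hx, mul_zero]
  · intro ha
    obtain ⟨N, hN⟩ := exists_eq_sum_proj 𝒜 a
    rw [hN N le_rfl]
    refine sum_mem fun n _ => ?_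
    rcases Nat.eq_zero_or_pos n with rfl | hn
    · rw [ha]; exact zero_mem _
    · exact mem_augIdeal_of_mem 𝒜 hn (proj_mem 𝒜 n a)

/-- The properties of a stage of the standard resolution that are inherited by the next one. -/
structure Stage.IsGraded (X : Stage A) : Prop where
  hom : IsGradedModule X.grade
  smul : ∀ i n a m, a ∈ 𝒜 i → m ∈ X.grade n → a • m ∈ X.grade (i + n)
  ker : ∀ x, X.d x = 0 → x ∈ AddSubgroup.closure {y | ∃ n, y ∈ X.grade n ∧ X.d y = 0}

variable {𝒜} {X : Stage A}

/-- The map from the free module on the homogeneous elements of `ker d` onto `ker d`. -/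
def Stage.nextD (X : Stage A) : (X.Syz →₀ A) →ₗ[A] X.F :=
  Finsupp.linearCombination A (fun x : X.Syz => x.2.1)

variable (𝒜) in
/-- The grading of the free module on the homogeneous elements of `ker d`. -/
abbrev Stage.nextGrade (X : Stage A) : ℕ → AddSubgroup (X.Syz →₀ A) :=
  freeGrade 𝒜 (fun x : X.Syz => x.1)

theorem Stage.nextD_single (x : X.Syz) (a : A) : X.nextD (Finsupp.single x a) = a • x.2.1 :=
  Finsupp.linearCombination_single _ _ _

theorem Stage.IsGraded.nextD_mem (hX : X.IsGraded 𝒜) (n : ℕ) (x : X.Syz →₀ A)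
    (hx : x ∈ X.nextGrade 𝒜 n) : X.nextD x ∈ X.grade n := by
  refine AddSubgroup.closure_induction (p := fun x _ => X.nextD x ∈ X.grade n) ?_ ?_ ?_ ?_ hx
  · rintro _ ⟨x, k, a, rfl, ha, rfl⟩
    rw [nextD_single]
    exact hX.smul _ _ _ _ ha x.2.2.1
  · rw [map_zero]; exact zero_mem _
  · intro x y _ _ hx hy
    rw [map_add]; exact add_mem hx hy
  · intro x _ hx
    rw [map_neg]; exact neg_mem hx

theorem Stage.d_nextD (y : X.Syz →₀ A) : X.d (X.nextD y) = 0 := by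
  have h1 : X.d.comp X.nextD = 0 := by
    ext x
    simp only [LinearMap.comp_apply, Finsupp.lsingle_apply, nextD_single, one_smul,
      LinearMap.zero_apply]
    exact x.2.2.2
  exact DFunLike.congr_fun h1 y

theorem Stage.exists_nextD_eq {n : ℕ} {x : X.F} (hx : x ∈ X.grade n) (h : X.d x = 0) :
    ∃ y ∈ X.nextGrade 𝒜 n, X.nextD y = x :=
  ⟨Finsupp.single ⟨n, x, hx, h⟩ 1,
    AddSubgroup.subset_closure ⟨⟨n, x, hx, h⟩, 0, 1, zero_add _, SetLike.GradedOne.one_mem, rfl⟩,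
    (nextD_single _ _).trans (one_smul _ _)⟩

theorem Stage.IsGraded.next (hX : X.IsGraded 𝒜) : (X.next 𝒜).IsGraded 𝒜 where
  hom := isGradedModule_freeGrade 𝒜 _
  smul _ _ _ _ ha hm := smul_mem_freeGrade 𝒜 _ ha hm
  ker _ hx := (isGradedModule_freeGrade 𝒜 (fun x : X.Syz => x.1)).mem_closure_of_map_eq_zero hX.hom
    X.nextD.toAddMonoidHom hX.nextD_mem hx

theorem Stage.IsGraded.isPartialResolution (hX : X.IsGraded 𝒜) :
    IsPartialResolution 𝒜 X.grade (X.nextGrade 𝒜) X.d X.nextD where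
  smul₁ := hX.smul
  smul₂ _ _ _ _ ha hm := smul_mem_freeGrade 𝒜 _ ha hm
  map₂ := hX.nextD_mem
  comp := Stage.d_nextD
  exact _ _ hx h := Stage.exists_nextD_eq hx h
  ker₁ := hX.ker

variable (𝒜)

theorem isGraded_stdResolution (n : ℕ) : (stdResolution 𝒜 n).IsGraded 𝒜 := by
  induction n with
  | zero =>
    have key : ∀ x : A, (augIdeal 𝒜).mkQ x = 0 →
        x ∈ AddSubgroup.closure {y : A | ∃ n, y ∈ (𝒜 n).toAddSubgroup ∧ (augIdeal 𝒜).mkQ y = 0} := by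
      intro x hx
      have h1 : x ∈ augIdeal 𝒜 := (Submodule.Quotient.mk_eq_zero _).1 hx
      rw [mem_augIdeal_iff] at h1
      obtain ⟨N, hN⟩ := exists_eq_sum_proj 𝒜 (x : A)
      rw [hN N le_rfl]
      refine sum_mem fun n _ => ?_
      rcases Nat.eq_zero_or_pos n with rfl | hn
      · rw [h1]; exact zero_mem _
      · exact AddSubgroup.subset_closure ⟨n, proj_mem 𝒜 n x,
          (Submodule.Quotient.mk_eq_zero _).2 (mem_augIdeal_of_mem 𝒜 hn (proj_mem 𝒜 n x))⟩
    have hmul : ∀ (i n : ℕ) (a m : A), a ∈ 𝒜 i → m ∈ 𝒜 n → a • m ∈ 𝒜 (i + n) :=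
      fun i n a m ha hm => SetLike.GradedMul.mul_mem ha hm
    exact ⟨isGradedModule_of_gradedRing 𝒜, hmul, key⟩
  | succ n ih => exact ih.next

variable {𝒜} in
theorem Stage.IsGraded.range_nextD (hX : X.IsGraded 𝒜) :
    LinearMap.range X.nextD = LinearMap.ker X.d := by
  ext x
  constructor
  · rintro ⟨y, rfl⟩
    exact Stage.d_nextD y
  · exact fun hx => hX.isPartialResolution.mem_range 𝒜 hx

variable {𝒜} in
theorem Stage.IsGraded.torVanishes_iff (hX : X.IsGraded 𝒜) (m : ℕ) :
    TorVanishes 𝒜 X.grade X.d m ↔ ∀ y ∈ X.nextGrade 𝒜 m, X.nextD y ∈ augSmul 𝒜 X.F →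
      y ∈ augSmul 𝒜 (X.Syz →₀ A) ⊔ LinearMap.ker X.nextD := by
  have hsurj : Function.Surjective (X.nextD.codRestrict (LinearMap.ker X.d) Stage.d_nextD) := by
    rintro ⟨x, hx⟩
    obtain ⟨y, hy⟩ := hX.isPartialResolution.mem_range 𝒜 hx
    exact ⟨y, Subtype.ext hy⟩
  have hbd : ∀ x : X.Syz →₀ A, x ∈ augSmul 𝒜 (X.Syz →₀ A) ⊔ LinearMap.ker X.nextD ↔
      X.nextD x ∈ augKer 𝒜 X.d := by
    intro x
    rw [Submodule.mem_sup]
    constructor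
    · rintro ⟨y, hy, w, hw, rfl⟩
      rw [map_add, LinearMap.mem_ker.1 hw, add_zero]
      exact map_mem_augKer_of_mem_augSmul 𝒜 _ Stage.d_nextD hy
    · rintro ⟨k, hk, hkx⟩
      obtain ⟨y, hy, rfl⟩ := exists_mem_augSmul_eq 𝒜 hsurj hk
      refine ⟨y, hy, x - y, ?_, add_sub_cancel _ _⟩
      rw [LinearMap.mem_ker, map_sub, ← hkx]
      exact sub_self _
  constructor
  · intro h y hy hym
    exact (hbd y).2 (h _ (hX.nextD_mem m y hy) (Stage.d_nextD y) hym)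
  · intro h x hx hdx hxm
    obtain ⟨y, hy, rfl⟩ := Stage.exists_nextD_eq (𝒜 := 𝒜) hx hdx
    exact (hbd y).1 (h y hy hxm)

/-- The definition of `Tor₃` in terms of the standard resolution, rewritten in terms of the
differential `F₂ → F₁`. -/
theorem subsingleton_torPos_iff (m : ℕ) : Subsingleton (TorPos 𝒜 3 m) ↔
    TorVanishes 𝒜 (stdResolution 𝒜 2).grade (stdResolution 𝒜 2).d m := by
  have h1 : Subsingleton (TorPos 𝒜 3 m) ↔ torCycles 𝒜 3 m ≤ torBoundaries 𝒜 3 :=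
    QuotientAddGroup.subsingleton_iff.trans AddSubgroup.addSubgroupOf_eq_top
  have hbd : ∀ x : (stdResolution 𝒜 2).Syz →₀ A, x ∈ torBoundaries 𝒜 3 ↔
      x ∈ augSmul 𝒜 ((stdResolution 𝒜 2).Syz →₀ A) ⊔ LinearMap.ker (stdResolution 𝒜 2).nextD := by
    intro x
    have h2 : LinearMap.range ((stdResolution 𝒜 3).next 𝒜).d =
        LinearMap.ker (stdResolution 𝒜 3).d := (isGraded_stdResolution 𝒜 3).range_nextD
    have h3 : torBoundaries 𝒜 3 = (augSmul 𝒜 (stdResolution 𝒜 3).F ⊔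
        LinearMap.ker (stdResolution 𝒜 3).d).toAddSubgroup :=
      congrArg (fun K => (augSmul 𝒜 (stdResolution 𝒜 3).F ⊔ K).toAddSubgroup) h2
    exact SetLike.ext_iff.1 h3 x
  rw [h1, (isGraded_stdResolution 𝒜 2).torVanishes_iff]
  constructor
  · exact fun h y hy hym => (hbd y).1 (h ⟨hy, hym⟩)
  · exact fun h y hy => (hbd y).2 (h y hy.1 hy.2)

/-- `Tor₃` can be computed from any graded projective resolution `F₂ → F₁ → A → S`. -/
theorem subsingleton_torPos_iff_torVanishes.{b, c} {F₁ : Type b} {F₂ : Type c} [AddCommGroup F₁]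
    [Module A F₁] [AddCommGroup F₂] [Module A F₂] {G₁ : ℕ → AddSubgroup F₁}
    {G₂ : ℕ → AddSubgroup F₂} {d₁ : F₁ →ₗ[A] A} {d₂ : F₂ →ₗ[A] F₁}
    (hF : IsPartialResolution 𝒜 G₁ G₂ d₁ d₂)
    (hd₁ : ∀ n, ∀ x ∈ G₁ n, d₁ x ∈ 𝒜 n ∧ d₁ x ∈ augIdeal 𝒜)
    (hd₁' : ∀ n, ∀ a ∈ 𝒜 n, a ∈ augIdeal 𝒜 → ∃ x ∈ G₁ n, d₁ x = a)
    (l₁ : HasGradedLifts.{u, v, b, v, v} 𝒜 G₁) (l₂ : HasGradedLifts.{u, v, c, v, v} 𝒜 G₂)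
    (l₁' : HasGradedLifts.{u, v, b, c, b} 𝒜 G₁) (m : ℕ) :
    Subsingleton (TorPos 𝒜 3 m) ↔ TorVanishes 𝒜 G₂ d₂ m := by
  rw [subsingleton_torPos_iff]
  have h0 := isGraded_stdResolution 𝒜 0
  have h1 := (isGraded_stdResolution 𝒜 1).isPartialResolution
  have hFE : ∀ n, ∀ x ∈ G₁ n, ∃ y ∈ (stdResolution 𝒜 1).grade n,
      (stdResolution 𝒜 1).d y = d₁ x := fun n x hx =>
    Stage.exists_nextD_eq (𝒜 := 𝒜) (X := stdResolution 𝒜 0) (hd₁ n x hx).1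
      ((Submodule.Quotient.mk_eq_zero _).2 (hd₁ n x hx).2)
  have hEF : ∀ n, ∀ x ∈ (stdResolution 𝒜 1).grade n, ∃ y ∈ G₁ n,
      d₁ y = (stdResolution 𝒜 1).d x := fun n x hx => hd₁' n _ (h0.nextD_mem n x hx)
    ((Submodule.Quotient.mk_eq_zero _).1 (Stage.d_nextD (X := stdResolution 𝒜 0) x))
  constructor
  · exact TorVanishes.of_comparison 𝒜 hF h1 hFE hEF l₁ (hasGradedLifts_freeGrade 𝒜 _) l₂
      (hasGradedLifts_freeGrade 𝒜 _) l₁'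
  · exact TorVanishes.of_comparison 𝒜 h1 hF hEF hFE (hasGradedLifts_freeGrade 𝒜 _) l₁
      (hasGradedLifts_freeGrade 𝒜 _) l₂ (hasGradedLifts_freeGrade 𝒜 _)

end Standard

/-! ### Construction of resolutions -/

section Construction

theorem IsGradedModule.mem_closure_of_mem_ker {A M M' : Type*} [Ring A] [AddCommGroup M]
    [Module A M] [AddCommGroup M'] [Module A M'] {G : ℕ → AddSubgroup M} {G' : ℕ → AddSubgroup M'}
    (h : IsGradedModule G) (h' : IsGradedModule G') (d : M →ₗ[A] M')
    (hd : ∀ n, ∀ x ∈ G n, d x ∈ G' n) (x : M) (hx : x ∈ LinearMap.ker d) :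
    x ∈ AddSubgroup.closure {y | ∃ n, y ∈ G n ∧ y ∈ LinearMap.ker d} :=
  h.mem_closure_of_map_eq_zero h' d.toAddMonoidHom hd hx

theorem isInternal_of_proj {S V : Type*} [Ring S] [AddCommGroup V] [Module S V]
    {𝒱 : ℕ → Submodule S V} (p : ℕ → V →ₗ[S] V) (h1 : ∀ n, ∀ x ∈ 𝒱 n, p n x = x)
    (h2 : ∀ n m, m ≠ n → ∀ x ∈ 𝒱 m, p n x = 0) (h3 : ∀ x, x ∈ ⨆ n, 𝒱 n) :
    DirectSum.IsInternal 𝒱 := by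
  refine DirectSum.isInternal_submodule_of_iSupIndep_of_iSup_eq_top ?_
    (eq_top_iff.2 fun x _ => h3 x)
  intro n
  rw [Submodule.disjoint_def]
  intro x hx hx'
  have h4 : ⨆ j, ⨆ _ : j ≠ n, 𝒱 j ≤ LinearMap.ker (p n) :=
    iSup₂_le fun j hj y hy => h2 n j hj y hy
  rw [← h1 n x hx]
  exact h4 hx'

/-- The degree `n` part of the free module on generators `x ∈ X` of degrees `deg x`. -/
def suppGrade (S : Type u) [Ring S] {X : Type w} (deg : X → ℕ) (n : ℕ) : Submodule S (X →₀ S) :=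
  Finsupp.supported S S {x | deg x = n}

theorem isInternal_suppGrade (S : Type u) [Ring S] {X : Type w} (deg : X → ℕ) :
    DirectSum.IsInternal (suppGrade S deg) := by
  refine isInternal_of_proj
    (fun n => (suppGrade S deg n).subtype.comp (Finsupp.restrictDom S S {x | deg x = n})) ?_ ?_ ?_
  · intro n f hf
    change Finsupp.filter (fun x => deg x = n) f = f
    rw [Finsupp.filter_eq_self_iff]
    intro x hx
    exact (Finsupp.mem_supported _ _).1 hf (Finset.mem_coe.2 (Finsupp.mem_support_iff.2 hx))
  · intro n m hmn f hf
    change Finsupp.filter (fun x => deg x = n) f = 0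
    rw [Finsupp.filter_eq_zero_iff]
    intro x hx
    by_contra h
    have h1 : deg x = m :=
      (Finsupp.mem_supported _ _).1 hf (Finset.mem_coe.2 (Finsupp.mem_support_iff.2 h))
    exact hmn (h1.symm.trans hx)
  · intro f
    induction f using Finsupp.induction_linear with
    | zero => exact zero_mem _
    | add f g hf hg => exact add_mem hf hg
    | single x a =>
      exact Submodule.mem_iSup_of_mem (deg x) (Finsupp.single_mem_supported S a rfl)

variable {S : Type u} {A : Type v} [Ring S] [Ring A] [Module S A] [IsScalarTower S A A]
  (𝒜 : ℕ → Submodule S A) [GradedRing 𝒜]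

/-- A graded projective `S`-module `V`, zero in degrees `0` and `1`, with a graded `A`-submodule `K`
of `A ⊗ V`, the kernel of a differential on `A ⊗ V`. -/
structure ProjStage where
  V : Type w
  [addV : AddCommGroup V]
  [modV : Module S V]
  grade : ℕ → Submodule S V
  internal : DirectSum.IsInternal grade
  projective : Module.Projective S V
  grade_zero : grade 0 = ⊥
  grade_one : grade 1 = ⊥
  K : Submodule A (BTensor S A V)
  hK : ∀ x ∈ K, x ∈ AddSubgroup.closure {y | ∃ n, y ∈ tensorGrade 𝒜 grade n ∧ y ∈ K}

attribute [instance] ProjStage.addV ProjStage.modV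

namespace ProjStage

variable {𝒜} (X : ProjStage.{u, v, w} 𝒜) (sel : ℕ → Prop)

/-- The homogeneous elements of `K` of the selected degrees `n ≥ 2`. -/
def Syz : Type (max v w) :=
  {i : ℕ × BTensor S A X.V // i.2 ∈ tensorGrade 𝒜 X.grade i.1 ∧ i.2 ∈ X.K ∧ 2 ≤ i.1 ∧ sel i.1}

/-- The degree of a homogeneous element. -/
def deg (i : X.Syz sel) : ℕ := i.1.1

/-- The map from the free module on the selected homogeneous elements of `K` to `K ⊆ A ⊗ V`. -/
def nextD : BTensor S A (X.Syz sel →₀ S) →ₗ[A] BTensor S A X.V :=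
  tensorLift (Finsupp.linearCombination S (fun i : X.Syz sel => i.1.2))

theorem nextD_single (i : X.Syz sel) (a : A) (s : S) :
    X.nextD sel (tmul a (Finsupp.single i s)) = a • s • i.1.2 := by
  rw [nextD, tensorLift_tmul, Finsupp.linearCombination_single]

theorem nextD_mem (n : ℕ) (x : BTensor S A (X.Syz sel →₀ S))
    (hx : x ∈ tensorGrade 𝒜 (suppGrade S (X.deg sel)) n) :
    X.nextD sel x ∈ tensorGrade 𝒜 X.grade n := by
  refine map_mem_of_forall_tmul_one 𝒜 (suppGrade S (X.deg sel)) (f := X.nextD sel) (k := 0)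
    (𝒩 := tensorGrade 𝒜 X.grade)
    (fun i n b m hb hm => smul_mem_tensorGrade 𝒜 _ hb hm) (fun j hj => by omega) ?_ hx
  intro j _ f hf
  rw [nextD, tensorLift_tmul_one, Finsupp.linearCombination_apply]
  refine sum_mem fun i hi => ?_
  have h1 : i.1.1 = j := (Finsupp.mem_supported _ _).1 hf (Finset.mem_coe.2 hi)
  have h2 : i.1.2 ∈ tensorGradeₛ 𝒜 X.grade j := h1 ▸ i.2.1
  exact Submodule.smul_mem _ (f i) h2

theorem nextD_mem_K (x : BTensor S A (X.Syz sel →₀ S)) : X.nextD sel x ∈ X.K := by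
  induction x using BTensor.induction with
  | h0 => rw [map_zero]; exact zero_mem _
  | hadd x y hx hy => rw [map_add]; exact add_mem hx hy
  | ht a f =>
    induction f using Finsupp.induction_linear with
    | zero => rw [tmul_zero, map_zero]; exact zero_mem _
    | add f g hf hg => rw [tmul_add, map_add]; exact add_mem hf hg
    | single i s =>
      rw [nextD_single, ← smul_one_smul' (B := A) s]
      exact Submodule.smul_mem _ _ (Submodule.smul_mem _ _ i.2.2.1)

/-- The next step of a resolution. -/
def next : ProjStage.{u, v, max u v w} 𝒜 where
  V := X.Syz sel →₀ S
  grade := suppGrade S (X.deg sel)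
  internal := isInternal_suppGrade S _
  projective := inferInstance
  grade_zero := by
    rw [eq_bot_iff]
    intro f hf
    rw [Submodule.mem_bot, ← Finsupp.support_eq_empty, Finset.eq_empty_iff_forall_notMem]
    intro i hi
    have h1 : i.1.1 = 0 := (Finsupp.mem_supported _ _).1 hf (Finset.mem_coe.2 hi)
    have h2 := i.2.2.2.1
    omega
  grade_one := by
    rw [eq_bot_iff]
    intro f hf
    rw [Submodule.mem_bot, ← Finsupp.support_eq_empty, Finset.eq_empty_iff_forall_notMem]
    intro i hi
    have h1 : i.1.1 = 1 := (Finsupp.mem_supported _ _).1 hf (Finset.mem_coe.2 hi)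
    have h2 := i.2.2.2.1
    omega
  K := LinearMap.ker (X.nextD sel)
  hK := (isGradedModule_tensorGrade 𝒜 (isInternal_suppGrade S _)).mem_closure_of_mem_ker
    (isGradedModule_tensorGrade 𝒜 X.internal) (X.nextD sel) (X.nextD_mem sel)

variable (𝒜) in
/-- The elements of `A⁺ K` for a submodule `K` are sums of products of homogeneous elements. -/
theorem mem_closure_of_mem_map_augSmul {M : Type*} [AddCommGroup M] [Module A M]
    {G : ℕ → AddSubgroup M} {K : Submodule A M}
    (hK : ∀ x ∈ K, x ∈ AddSubgroup.closure {y | ∃ n, y ∈ G n ∧ y ∈ K}) {x : M}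
    (hx : x ∈ (augSmul 𝒜 K).map K.subtype) :
    x ∈ AddSubgroup.closure {y | ∃ (i j : ℕ) (a : A) (k : M),
      0 < i ∧ a ∈ 𝒜 i ∧ k ∈ G j ∧ k ∈ K ∧ y = a • k} := by
  set Q := AddSubgroup.closure {y | ∃ (i j : ℕ) (a : A) (k : M),
      0 < i ∧ a ∈ 𝒜 i ∧ k ∈ G j ∧ k ∈ K ∧ y = a • k} with hQ
  have h1 : ∀ a ∈ augIdeal 𝒜, ∀ k ∈ K, a • k ∈ Q := by
    intro a ha k hk
    refine AddSubgroup.closure_induction (p := fun k _ => a • k ∈ Q) ?_ ?_ ?_ ?_ (hK k hk)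
    · rintro k ⟨j, hkj, hkK⟩
      rw [mem_augIdeal_iff] at ha
      obtain ⟨N, hN⟩ := exists_eq_sum_proj 𝒜 a
      rw [hN N le_rfl, Finset.sum_smul]
      refine sum_mem fun i _ => ?_
      rcases Nat.eq_zero_or_pos i with rfl | hi
      · rw [ha, zero_smul]; exact zero_mem _
      · exact AddSubgroup.subset_closure ⟨i, j, _, k, hi, proj_mem 𝒜 i a, hkj, hkK, rfl⟩
    · rw [smul_zero]; exact zero_mem _
    · intro x y _ _ hx hy
      rw [smul_add]; exact add_mem hx hy
    · intro x _ hx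
      rw [smul_neg]; exact neg_mem hx
  obtain ⟨k, hk, rfl⟩ := hx
  have h2 : ∀ b : A, b • (k : M) ∈ Q := by
    refine Submodule.span_induction (p := fun (k : K) _ => ∀ b : A, b • (k : M) ∈ Q) ?_ ?_ ?_ ?_ hk
    · rintro _ ⟨a, ha, m, rfl⟩ b
      rw [Submodule.coe_smul, ← mul_smul]
      exact h1 _ (Ideal.mul_mem_left _ _ ha) _ m.2
    · intro b
      rw [Submodule.coe_zero, smul_zero]; exact zero_mem _
    · intro x y _ _ hx hy b
      rw [Submodule.coe_add, smul_add]; exact add_mem (hx b) (hy b)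
    · intro a x _ hx b
      rw [Submodule.coe_smul, ← mul_smul]; exact hx _
  have h3 := h2 1
  rwa [one_smul] at h3

theorem tensorGrade_eq_zero {n : ℕ} (hn : n < 2) {x : BTensor S A X.V}
    (hx : x ∈ tensorGrade 𝒜 X.grade n) : x = 0 := by
  refine AddSubgroup.closure_induction (p := fun x _ => x = 0) ?_ rfl ?_ ?_ hx
  · rintro _ ⟨i, j, b, v, hij, -, hv, rfl⟩
    have h1 : v = 0 := by
      have h2 : j = 0 ∨ j = 1 := by omega
      rcases h2 with rfl | rfl
      · rw [X.grade_zero] at hv; exact hv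
      · rw [X.grade_one] at hv; exact hv
    rw [h1, tmul_zero]
  · rintro _ _ _ _ rfl rfl; exact add_zero _
  · rintro _ _ rfl; exact neg_zero

/-- Graded Nakayama lemma: it suffices to select the degrees in which `K` is not contained in
`A⁺ K`. -/
theorem range_nextD (hsel : ∀ n, ¬ sel n → ∀ x ∈ tensorGrade 𝒜 X.grade n, x ∈ X.K →
    x ∈ (augSmul 𝒜 X.K).map X.K.subtype) : LinearMap.range (X.nextD sel) = X.K := by
  have hG := isGradedModule_tensorGrade 𝒜 X.internal
  have key : ∀ n, ∀ x ∈ tensorGrade 𝒜 X.grade n, x ∈ X.K → x ∈ LinearMap.range (X.nextD sel) := by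
    intro n
    induction n using Nat.strong_induction_on with
    | _ n ih =>
      intro x hx hxK
      by_cases hn : n < 2
      · rw [X.tensorGrade_eq_zero hn hx]; exact zero_mem _
      by_cases hs : sel n
      · let i : X.Syz sel := ⟨(n, x), hx, hxK, by omega, hs⟩
        refine ⟨tmul 1 (Finsupp.single i 1), ?_⟩
        rw [nextD_single, one_smul, one_smul]
      · have h1 := mem_closure_of_mem_map_augSmul 𝒜 X.hK (hsel n hs x hx hxK)
        rw [← hG.proj_of_mem hx]
        refine AddSubgroup.closure_induction
          (p := fun x _ => hG.proj n x ∈ LinearMap.range (X.nextD sel)) ?_ ?_ ?_ ?_ h1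
        · rintro _ ⟨i, j, a, k, hi, ha, hk, hkK, rfl⟩
          by_cases hij : i + j = n
          · rw [hG.proj_of_mem (hij ▸ smul_mem_tensorGrade 𝒜 _ ha hk)]
            exact Submodule.smul_mem _ _ (ih j (by omega) k hk hkK)
          · rw [hG.proj_of_mem_ne hij (smul_mem_tensorGrade 𝒜 _ ha hk)]
            exact zero_mem _
        · rw [map_zero]; exact zero_mem _
        · intro x y _ _ hx hy
          rw [map_add]; exact add_mem hx hy
        · intro x _ hx
          rw [map_neg]; exact neg_mem hx
  refine le_antisymm ?_ fun x hx => ?_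
  · rintro _ ⟨x, rfl⟩
    exact X.nextD_mem_K sel x
  · have h1 : AddSubgroup.closure {y | ∃ n, y ∈ tensorGrade 𝒜 X.grade n ∧ y ∈ X.K} ≤
        (LinearMap.range (X.nextD sel)).toAddSubgroup := by
      rw [AddSubgroup.closure_le]
      rintro y ⟨n, hy, hyK⟩
      exact key n y hy hyK
    exact h1 (X.hK x hx)

theorem exact_nextD_nextD (sel' : ℕ → Prop)
    (hsel : ∀ n, ¬ sel' n → ∀ x ∈ tensorGrade 𝒜 (X.next sel).grade n, x ∈ (X.next sel).K →
      x ∈ (augSmul 𝒜 (X.next sel).K).map (X.next sel).K.subtype) :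
    Function.Exact ((X.next sel).nextD sel') (X.nextD sel) := by
  intro x
  have h1 := (X.next sel).range_nextD sel' hsel
  exact (SetLike.ext_iff.1 h1 x).symm

end ProjStage

/-- The stages of the resolution which starts with `X`: the degrees `n` with `sel n` are selected in
the first step, and all degrees in the later ones. -/
def stageSeq {𝒜 : ℕ → Submodule S A} [GradedRing 𝒜] (X : ProjStage.{u, v, max u v} 𝒜)
    (sel : ℕ → Prop) : ℕ → ProjStage.{u, v, max u v} 𝒜
  | 0 => X
  | k + 1 => (stageSeq X sel k).next (fun n => k = 0 → sel n)

/-- The resolution which starts with a given differential `d₂ : A ⊗ V → A ⊗ A^1`. -/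
def Resolution.ofStage {𝒜 : ℕ → Submodule S A} [GradedRing 𝒜] (X : ProjStage.{u, v, max u v} 𝒜)
    (sel : ℕ → Prop) (d₂ : BTensor S A X.V →ₗ[A] BTensor S A (𝒜 1))
    (hd₂ : ∀ n, ∀ x ∈ tensorGrade 𝒜 X.grade n, d₂ x ∈ tensorGrade 𝒜 (gradeOne 𝒜) n)
    (hK : LinearMap.ker d₂ = X.K) (hexact : Function.Exact d₂ (d₁ 𝒜))
    (hsel : ∀ n, ¬ sel n → ∀ x ∈ tensorGrade 𝒜 X.grade n, x ∈ X.K →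
      x ∈ (augSmul 𝒜 X.K).map X.K.subtype) : Resolution.{u, v, max u v} 𝒜 where
  V k := (stageSeq X sel k).V
  addV k := (stageSeq X sel k).addV
  modV k := (stageSeq X sel k).modV
  grade k := (stageSeq X sel k).grade
  internal k := (stageSeq X sel k).internal
  projective k := (stageSeq X sel k).projective
  grade_zero k := (stageSeq X sel k).grade_zero
  grade_one k := (stageSeq X sel k).grade_one
  d₂ := d₂
  d k := (stageSeq X sel k).nextD (fun n => k = 0 → sel n)
  d₂_graded := hd₂
  d_graded k := (stageSeq X sel k).nextD_mem (fun n => k = 0 → sel n)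
  exact₁ := hexact
  exact₂ x := by
    have h1 := X.range_nextD (fun n => 0 = 0 → sel n) fun n hn => hsel n fun h => hn fun _ => h
    rw [← hK] at h1
    exact (SetLike.ext_iff.1 h1 x).symm
  exact k := (stageSeq X sel k).exact_nextD_nextD _ _
    fun n hn => absurd (fun h => absurd h (Nat.succ_ne_zero k)) hn

theorem complexity_congr {V : ℕ → Type v} {W : ℕ → Type w}
    (h : ∀ n, Nontrivial (V n) ↔ Nontrivial (W n)) : complexity V = complexity W := by
  have h' : (∃ n, Nontrivial (V n)) ↔ ∃ n, Nontrivial (W n) := exists_congr h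
  by_cases hV : ∃ n, Nontrivial (V n)
  · rw [complexity, complexity, if_pos hV, if_pos (h'.1 hV)]
    simp only [h]
  · rw [complexity, complexity, if_neg hV, if_neg fun hW => hV (h'.2 hW)]

end Construction

/-! ### The resolution attached to a projective bimodule of relations -/

section RelationResolution

variable {S : Type u} {A : Type v} [Ring S] [Ring A] [Module S A] [IsScalarTower S A A]
  (𝒜 : ℕ → Submodule S A) [GradedRing 𝒜] (R : Submodule S (TA 𝒜))

/-- The grading of a submodule of `T_A`. -/
def relGrade (n : ℕ) : Submodule S R := (gradeTA 𝒜 n).comap R.subtype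

variable {R}

theorem isInternal_relGrade (hR : IsGradedSub (gradeTA 𝒜) R) :
    DirectSum.IsInternal (relGrade 𝒜 R) := by
  refine isInternal_of_proj (fun n =>
    { toFun := fun r => ⟨GradedRing.proj (gradeTA 𝒜) n r, hR r r.2 n⟩
      map_add' := fun r s => Subtype.ext (map_add _ _ _)
      map_smul' := fun s r => Subtype.ext (proj_smul (gradeTA 𝒜) n s r.1) }) ?_ ?_ ?_
  · intro n r hr
    exact Subtype.ext ((proj_of_mem (𝒯 := gradeTA 𝒜) hr n).trans (if_pos rfl))
  · intro n m hmn r hr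
    exact Subtype.ext ((proj_of_mem (𝒯 := gradeTA 𝒜) hr n).trans (if_neg hmn))
  · intro r
    obtain ⟨N, hN⟩ := exists_eq_sum_proj (gradeTA 𝒜) (r : TA 𝒜)
    have h1 : r = ∑ i ∈ Finset.range N,
        (⟨GradedRing.proj (gradeTA 𝒜) i r, hR r r.2 i⟩ : R) := by
      refine Subtype.ext ?_
      rw [AddSubmonoidClass.coe_finsetSum]
      exact hN N le_rfl
    rw [h1]
    exact sum_mem fun i _ => Submodule.mem_iSup_of_mem i (proj_mem (gradeTA 𝒜) i r.1)

variable {𝒜}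

variable (R) in
theorem relDiff_mem (n : ℕ) (x : BTensor S A R) (hx : x ∈ tensorGrade 𝒜 (relGrade 𝒜 R) n) :
    relDiff 𝒜 R x ∈ tensorGrade 𝒜 (gradeOne 𝒜) n := by
  refine map_mem_of_forall_tmul_one 𝒜 (relGrade 𝒜 R) (f := relDiff 𝒜 R) (k := 0)
    (𝒩 := tensorGrade 𝒜 (gradeOne 𝒜))
    (fun i n b m hb hm => smul_mem_tensorGrade 𝒜 _ hb hm) (fun j hj => by omega) ?_ hx
  intro j _ r hr
  rw [relDiff_tmul, one_smul]
  exact tau_mem hr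

variable (𝒜) in
theorem isInternal_gradeOne : DirectSum.IsInternal (gradeOne 𝒜) := by
  refine isInternal_of_proj (fun n => open Classical in if n = 1 then LinearMap.id else 0) ?_ ?_ ?_
  · intro n x hx
    split_ifs with h
    · rfl
    · rw [gradeOne, if_neg h, Submodule.mem_bot] at hx
      exact hx.symm
  · intro n m hmn x hx
    split_ifs with h
    · rw [gradeOne, if_neg (fun h' => hmn (h'.trans h.symm)), Submodule.mem_bot] at hx
      rw [hx, map_zero]
    · rfl
  · intro x
    exact Submodule.mem_iSup_of_mem 1 (mem_gradeOne x)

/-- The `S`-module `R` of relations, with the kernel of `A ⊗ R → A ⊗ A^1`. -/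
def relStage (hconn : IsConnected 𝒜) (hgr : IsGradedSub (gradeTA 𝒜) R)
    (hgen : idealOf (R : Set (TA 𝒜)) = idealA 𝒜) (hproj : Module.Projective S R) :
    ProjStage.{u, v, max u v} 𝒜 where
  V := R
  grade := relGrade 𝒜 R
  internal := isInternal_relGrade 𝒜 hgr
  projective := hproj
  grade_zero := by
    rw [eq_bot_iff]
    intro r hr
    have h2 : r.1 ∈ idealA 𝒜 := hgen ▸ TwoSidedIdeal.subset_span r.2
    have h1 := proj_zero_of_mem_idealA hconn h2
    rw [proj_of_mem (𝒯 := gradeTA 𝒜) (x := r.1) hr, if_pos rfl] at h1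
    exact Subtype.ext h1
  grade_one := by
    rw [eq_bot_iff]
    intro r hr
    have h2 : r.1 ∈ idealA 𝒜 := hgen ▸ TwoSidedIdeal.subset_span r.2
    have h1 := proj_one_of_mem_idealA h2
    rw [proj_of_mem (𝒯 := gradeTA 𝒜) (x := r.1) hr, if_pos rfl] at h1
    exact Subtype.ext h1
  K := LinearMap.ker (relDiff 𝒜 R)
  hK := (isGradedModule_tensorGrade 𝒜 (isInternal_relGrade 𝒜 hgr)).mem_closure_of_mem_ker
    (isGradedModule_tensorGrade 𝒜 (isInternal_gradeOne 𝒜)) (relDiff 𝒜 R) (relDiff_mem R)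

/-- `Tor₃` can be computed from `A ⊗ R → A ⊗ A^1 → A` for a projective bimodule of relations. -/
theorem subsingleton_torPos_iff_relDiff [Module.Projective S (𝒜 1)] [Module.Projective S R]
    (hconn : IsConnected 𝒜) (hstrong : IsStronglyGraded 𝒜) (hbim : IsSubbimodule R)
    (hgr : IsGradedSub (gradeTA 𝒜) R) (hgen : idealOf (R : Set (TA 𝒜)) = idealA 𝒜) (m : ℕ) :
    Subsingleton (TorPos 𝒜 3 m) ↔ TorVanishes 𝒜 (tensorGrade 𝒜 (relGrade 𝒜 R)) (relDiff 𝒜 R) m := by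
  have hex := exact_relDiff (R := R) hconn hstrong hbim hgen
  have hd₁ : ∀ n, ∀ x ∈ tensorGrade 𝒜 (gradeOne 𝒜) n, d₁ 𝒜 x ∈ (𝒜 n).toAddSubgroup := by
    intro n x hx
    refine map_mem_of_forall_tmul_one 𝒜 (gradeOne 𝒜) (f := d₁ 𝒜) (k := 0)
      (𝒩 := fun n => (𝒜 n).toAddSubgroup) (fun i n b m hb hm => SetLike.GradedMul.mul_mem hb hm)
      (fun j hj => by omega) ?_ hx
    intro j _ v hv
    rw [d₁, tensorLift_tmul_one]
    by_cases hj : j = 1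
    · subst hj; exact v.2
    · rw [gradeOne, if_neg hj, Submodule.mem_bot] at hv
      rw [hv, map_zero]; exact zero_mem _
  have hd₁aug : ∀ x, d₁ 𝒜 x ∈ augIdeal 𝒜 := by
    intro x
    induction x using BTensor.induction with
    | h0 => rw [map_zero]; exact zero_mem _
    | hadd x y hx hy => rw [map_add]; exact add_mem hx hy
    | ht a v =>
      rw [d₁, tensorLift_tmul]
      exact Submodule.smul_mem _ _ (mem_augIdeal_of_mem 𝒜 one_pos v.2)
  refine subsingleton_torPos_iff_torVanishes 𝒜 (d₁ := d₁ 𝒜) (G₁ := tensorGrade 𝒜 (gradeOne 𝒜))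
    ⟨fun i n b m hb hm => smul_mem_tensorGrade 𝒜 _ hb hm,
      fun i n b m hb hm => smul_mem_tensorGrade 𝒜 _ hb hm, relDiff_mem R,
      fun x => hex.apply_apply_eq_zero x, ?_,
      (isGradedModule_tensorGrade 𝒜 (isInternal_gradeOne 𝒜)).mem_closure_of_mem_ker
        (isGradedModule_of_gradedRing 𝒜) (d₁ 𝒜) hd₁⟩
    (fun n x hx => ⟨hd₁ n x hx, hd₁aug x⟩) ?_ (hasGradedLifts_tensorGrade 𝒜 (isInternal_gradeOne 𝒜))
    (hasGradedLifts_tensorGrade 𝒜 (isInternal_relGrade 𝒜 hgr))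
    (hasGradedLifts_tensorGrade 𝒜 (isInternal_gradeOne 𝒜)) m
  · intro n x hx hdx
    obtain ⟨y, rfl⟩ := (hex x).1 hdx
    have hG := isGradedModule_tensorGrade 𝒜 (isInternal_relGrade 𝒜 hgr)
    have hG₁ := isGradedModule_tensorGrade 𝒜 (isInternal_gradeOne 𝒜)
    refine ⟨hG.proj n y, hG.proj_mem n y, ?_⟩
    exact (hG.map_proj hG₁ (relDiff 𝒜 R).toAddMonoidHom (relDiff_mem R) n y).trans
      (hG₁.proj_of_mem hx)
  · intro n a ha haug
    obtain ⟨t, ht, rfl⟩ := exists_piA_eq 𝒜 hconn hstrong n a ha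
    rcases Nat.eq_zero_or_pos n with rfl | hn
    · refine ⟨0, zero_mem _, ?_⟩
      rw [mem_augIdeal_iff, proj_of_mem ha, if_pos rfl] at haug
      rw [haug, map_zero]
    · refine ⟨tau 𝒜 t, tau_mem ht, d₁_tau ?_⟩
      rw [proj_of_mem ht, if_neg hn.ne']

/-- The resolution attached to a projective bimodule of relations `R`, with `V₂ = R`, which is
minimal at `V₃`. -/
def relResolution (hA : Module.Projective S (𝒜 1)) (hconn : IsConnected 𝒜)
    (hstrong : IsStronglyGraded 𝒜) (hR : IsBimoduleOfRelations (gradeTA 𝒜) R (idealA 𝒜))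
    (hproj : Module.Projective S R) : Resolution.{u, v, max u v} 𝒜 :=
  Resolution.ofStage (relStage hconn hR.2.1 hR.idealOf_eq hproj)
    (fun n => ¬ TorVanishes 𝒜 (tensorGrade 𝒜 (relGrade 𝒜 R)) (relDiff 𝒜 R) n) (relDiff 𝒜 R)
    (relDiff_mem R) rfl (exact_relDiff hconn hstrong hR.1 hR.idealOf_eq)
    (fun _ hn x hx hxK => not_not.1 hn x hx hxK
      (mem_augSmul_of_relDiff_eq_zero hconn hstrong hR hxK))

theorem complexity₃_relResolution (hA : Module.Projective S (𝒜 1)) (hconn : IsConnected 𝒜)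
    (hstrong : IsStronglyGraded 𝒜) (hR : IsBimoduleOfRelations (gradeTA 𝒜) R (idealA 𝒜))
    (hproj : Module.Projective S R) :
    (relResolution hA hconn hstrong hR hproj).complexity₃ = homComplexity 𝒜 := by
  refine complexity_congr fun m => ?_
  rw [← not_subsingleton_iff_nontrivial (α := TorPos 𝒜 3 m),
    subsingleton_torPos_iff_relDiff hconn hstrong hR.1 hR.2.1 hR.idealOf_eq]
  set X := relStage hconn hR.2.1 hR.idealOf_eq hproj with hX
  set sel : ℕ → Prop := fun n => 0 = 0 →
    ¬ TorVanishes 𝒜 (tensorGrade 𝒜 (relGrade 𝒜 R)) (relDiff 𝒜 R) n with hsel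
  change Nontrivial (suppGrade S (X.deg sel) m) ↔ _
  constructor
  · intro h
    obtain ⟨⟨f, hf⟩, hne⟩ := exists_ne (0 : suppGrade S (X.deg sel) m)
    have h1 : f ≠ 0 := fun h => hne (Subtype.ext h)
    obtain ⟨i, hi⟩ := Finsupp.support_nonempty_iff.2 h1
    have h2 : i.1.1 = m := (Finsupp.mem_supported _ _).1 hf (Finset.mem_coe.2 hi)
    exact h2 ▸ i.2.2.2.2 rfl
  · intro h
    have h1 := h
    unfold TorVanishes at h1
    push Not at h1
    obtain ⟨x, hx, hdx, -, hx'⟩ := h1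
    have hx0 : x ≠ 0 := by rintro rfl; exact hx' (zero_mem _)
    have hm : 2 ≤ m := by
      by_contra hm
      exact hx0 (X.tensorGrade_eq_zero (by omega) hx)
    have hS : (1 : S) ≠ 0 := by
      intro h0
      refine hx0 ?_
      rw [← one_smul S x, h0, zero_smul]
    let i : X.Syz sel := ⟨(m, x), hx, hdx, hm, fun _ => h⟩
    refine nontrivial_of_ne (⟨Finsupp.single i 1, Finsupp.single_mem_supported S _ rfl⟩ :
      suppGrade S (X.deg sel) m) 0 fun h0 => hS ?_
    exact Finsupp.single_eq_zero.1 (congrArg Subtype.val h0)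

end RelationResolution

/-! ### Filtered maps on a graded bimodule -/

section Filtered

variable {S : Type u} {T : Type v} [Ring S] [Ring T] [Module S T] [IsScalarTower S T T]
  {𝒯 : ℕ → Submodule S T} [GradedRing 𝒯] {R : Submodule S T}

theorem filtLT_mono {m n : ℕ} (h : m ≤ n) : filtLT 𝒯 m ≤ filtLT 𝒯 n := fun x hx => by
  rw [mem_filtLT_iff] at *
  exact fun i hi => hx i (h.trans hi)

theorem IsGradedSub.exists_eq_sum (hR : IsGradedSub 𝒯 R) (r : R) : ∃ N, r =
    ∑ i ∈ Finset.range N, (⟨GradedRing.proj 𝒯 i r, hR r r.2 i⟩ : R) := by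
  obtain ⟨N, hN⟩ := exists_eq_sum_proj 𝒯 (r : T)
  refine ⟨N, Subtype.ext ?_⟩
  rw [AddSubmonoidClass.coe_finsetSum]
  exact hN N le_rfl

namespace FilteredMap

variable (α : FilteredMap 𝒯 R) (hR : IsGradedSub 𝒯 R)

include hR in
theorem sub_mem_filtLT {n : ℕ} {r : R} (hr : (r : T) ∈ filt 𝒯 n) :
    α.toFun r - r ∈ filtLT 𝒯 n := by
  obtain ⟨N, hN⟩ := hR.exists_eq_sum r
  have h1 : α.toFun r - r = ∑ i ∈ Finset.range N,
      (α.toFun ⟨GradedRing.proj 𝒯 i r, hR r r.2 i⟩ - GradedRing.proj 𝒯 i r) := by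
    conv_lhs => rw [hN]
    rw [map_sum, AddSubmonoidClass.coe_finsetSum, ← Finset.sum_sub_distrib]
  rw [h1]
  refine sum_mem fun i _ => ?_
  by_cases hi : i ≤ n
  · exact filtLT_mono hi (α.filtered i ⟨_, hR r r.2 i⟩ (proj_mem 𝒯 i r))
  · have h2 : GradedRing.proj 𝒯 i (r : T) = 0 := (mem_filt_iff 𝒯).1 hr i (by omega)
    have h3 : (⟨GradedRing.proj 𝒯 i r, hR r r.2 i⟩ : R) = 0 := Subtype.ext h2
    rw [h3, map_zero, h2, sub_zero]
    exact zero_mem _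

include hR in
theorem proj_apply {n : ℕ} {r : R} (hr : (r : T) ∈ filt 𝒯 n) :
    GradedRing.proj 𝒯 n (α.toFun r) = GradedRing.proj 𝒯 n r := by
  have h1 := (mem_filtLT_iff 𝒯).1 (α.sub_mem_filtLT hR hr) n le_rfl
  rwa [map_sub, sub_eq_zero] at h1

theorem filtLT_le (n : ℕ) : filtLT 𝒯 n ≤ filt 𝒯 n := fun x hx => by
  rw [mem_filt_iff]
  exact fun i hi => (mem_filtLT_iff 𝒯).1 hx i hi.le

include hR in
theorem apply_mem_filt {n : ℕ} {r : R} (hr : (r : T) ∈ filt 𝒯 n) : α.toFun r ∈ filt 𝒯 n := by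
  have h1 := add_mem (filtLT_le n (α.sub_mem_filtLT hR hr)) hr
  rwa [sub_add_cancel] at h1

include hR in
/-- A filtered map whose leading part is the identity does not lower degrees. -/
theorem mem_filt_of_apply_mem {n : ℕ} {r : R} (hr : α.toFun r ∈ filt 𝒯 n) :
    (r : T) ∈ filt 𝒯 n := by
  obtain ⟨m, hm⟩ := exists_mem_filt 𝒯 (r : T)
  have key : ∀ k, (r : T) ∈ filt 𝒯 (n + k) → (r : T) ∈ filt 𝒯 n := by
    intro k
    induction k with
    | zero => exact id
    | succ k ih =>
      intro h
      refine ih ?_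
      have h1 := α.proj_apply hR h
      rw [(mem_filt_iff 𝒯).1 hr _ (by omega)] at h1
      have h2 := filt_sub_proj 𝒯 h
      rwa [← h1, sub_zero, ← add_assoc, filtLT_succ] at h2
  exact key m (filt_mono 𝒯 (Nat.le_add_left m n) hm)

include hR in
theorem leading_range : leading 𝒯 (LinearMap.range α.toFun) = R := by
  refine le_antisymm ?_ fun r hr => ?_
  · refine Submodule.span_le.2 ?_
    rintro _ ⟨_, ⟨r, rfl⟩, rfl⟩
    have h1 : (r : T) ∈ filt 𝒯 (topDegree 𝒯 (α.toFun r)) :=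
      α.mem_filt_of_apply_mem hR (mem_filt_topDegree 𝒯 _)
    rw [SetLike.mem_coe, LH, α.proj_apply hR h1]
    exact hR r r.2 _
  · obtain ⟨N, hN⟩ := exists_eq_sum_proj 𝒯 r
    rw [hN N le_rfl]
    refine sum_mem fun n _ => ?_
    by_cases h0 : GradedRing.proj 𝒯 n r = 0
    · rw [h0]; exact zero_mem _
    let r' : R := ⟨GradedRing.proj 𝒯 n r, hR r hr n⟩
    have h1 : (r' : T) ∈ filt 𝒯 n := mem_filt_of_mem 𝒯 le_rfl (proj_mem 𝒯 n r)
    have h2 : GradedRing.proj 𝒯 n (α.toFun r') = GradedRing.proj 𝒯 n r := by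
      rw [α.proj_apply hR h1, proj_of_mem (proj_mem 𝒯 n r), if_pos rfl]
    have h3 : topDegree 𝒯 (α.toFun r') = n :=
      topDegree_eq 𝒯 (α.apply_mem_filt hR h1) (h2 ▸ h0)
    refine Submodule.subset_span ⟨α.toFun r', ⟨r', rfl⟩, ?_⟩
    rw [LH, h3, h2]

/-- The homogenization of `α(r)` for homogeneous `r`. -/
theorem homAt_apply {n : ℕ} {r : R} (hr : (r : T) ∈ 𝒯 (n + 1)) :
    homAt 𝒯 (n + 1) (α.toFun r) =
      homAt 𝒯 n (α.toFun r - r) * Polynomial.X + Polynomial.C (r : T) := by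
  have h1 := α.filtered (n + 1) r hr
  rw [filtLT_succ] at h1
  conv_lhs => rw [← sub_add_cancel (α.toFun r) (r : T)]
  rw [map_add, homAt_add 𝒯 h1 1, homAt_of_mem hr, if_pos le_rfl, pow_one, Polynomial.X_mul,
    Nat.sub_self, Polynomial.monomial_zero_left]

end FilteredMap

end Filtered

theorem exists_linearMap_of_isInternal {S V M : Type*} [Ring S] [AddCommGroup V] [Module S V]
    [AddCommGroup M] [Module S M] {𝒱 : ℕ → Submodule S V} (h : DirectSum.IsInternal 𝒱)
    (f : ℕ → V →ₗ[S] M) : ∃ φ : V →ₗ[S] M, ∀ n, ∀ x ∈ 𝒱 n, φ x = f n x := by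
  let e := LinearEquiv.ofBijective (DirectSum.coeLinearMap 𝒱) h
  refine ⟨(DirectSum.toModule S ℕ M fun n => (f n).comp (𝒱 n).subtype).comp e.symm.toLinearMap,
    fun n x hx => ?_⟩
  have h1 : e.symm x = DirectSum.lof S ℕ (fun n => 𝒱 n) n ⟨x, hx⟩ := by
    rw [LinearEquiv.symm_apply_eq]
    exact (DirectSum.coeLinearMap_lof 𝒱 n ⟨x, hx⟩).symm
  rw [LinearMap.comp_apply, LinearEquiv.coe_coe, h1, DirectSum.toModule_lof]
  rfl

/-- The elements `(∂₂ u - z v, ∂₁ v + f₂ u)`, for a central element `z`. -/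
def coneBoundaries {D M W : Type*} [Ring D] [AddCommGroup M] [Module D M] [AddCommGroup W]
    [Module D W] (z : D) (hz : ∀ d, z * d = d * z) (del₂ : W →ₗ[D] M) (del₁ : M →ₗ[D] D)
    (f₂ : W →ₗ[D] D) : Submodule D (M × D) where
  carrier := {p | ∃ (u : W) (v : M), del₂ u - z • v = p.1 ∧ del₁ v + f₂ u = p.2}
  zero_mem' := ⟨0, 0, by simp, by simp⟩
  add_mem' := by
    rintro _ _ ⟨u, v, h1, h2⟩ ⟨u', v', h1', h2'⟩
    refine ⟨u + u', v + v', ?_, ?_⟩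
    · rw [Prod.fst_add, ← h1, ← h1', map_add, smul_add]; abel
    · rw [Prod.snd_add, ← h2, ← h2', map_add, map_add]; abel
  smul_mem' := by
    rintro d _ ⟨u, v, h1, h2⟩
    refine ⟨d • u, d • v, ?_, ?_⟩
    · rw [Prod.smul_fst, ← h1, map_smul, smul_sub, ← mul_smul, ← mul_smul, hz]
    · rw [Prod.smul_snd, ← h2, map_smul, map_smul, smul_add]

/-! ### Exactness of the complex of a deformation given by a filtered map -/

section Explicit

open TensorRing

variable {S : Type u} {V : Type v} [Ring S] [AddCommGroup V] [Module S V] [Module Sᵐᵒᵖ V]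
  [SMulCommClass S Sᵐᵒᵖ V] {D : Type w} [Ring D] [Module S D] [IsScalarTower S D D]
  (q : (TensorRing S V)[X] →+* D) (ι : SRingHom S (TensorRing S V) D)
  (hι : ∀ t, ι.toRingHom t = q (Polynomial.C t))

/-- The map `T[z] → (D ⊗ V) × D` which sends `t v` to `([t] ⊗ v, 0)` and `f z` to `(0, [f])`, for
`t ∈ T = T_S(V)`, `v ∈ V` and `f ∈ T[z]`; here `[f]` denotes the image of `f` under a ring
homomorphism `q : T[z] → D`. -/
def theta : (TensorRing S V)[X] →+ BTensor S D V × D :=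
  AddMonoidHom.prod
    ((tensorMap ι).comp ((delta S V).toAddMonoidHom.comp
      (Polynomial.constantCoeff : (TensorRing S V)[X] →+* TensorRing S V).toAddMonoidHom))
    (q.toAddMonoidHom.comp Polynomial.divX_hom)

theorem theta_apply (f : (TensorRing S V)[X]) : theta q ι f =
    (tensorMap ι (delta S V (f.coeff 0)), q f.divX) := rfl

theorem theta_mul_X (f : (TensorRing S V)[X]) : theta q ι (f * Polynomial.X) = (0, q f) := by
  rw [theta_apply, Polynomial.mul_coeff_zero, Polynomial.coeff_X_zero, mul_zero, map_zero, map_zero]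
  have h1 : (f * Polynomial.X).divX = f := by
    ext n
    rw [Polynomial.coeff_divX, Polynomial.coeff_mul_X]
  rw [h1]

theorem theta_C (t : TensorRing S V) :
    theta q ι (Polynomial.C t) = (tensorMap ι (delta S V t), 0) := by
  rw [theta_apply, Polynomial.coeff_C_zero, Polynomial.divX_C, map_zero]

variable {W : Type x} [AddCommGroup W] [Module D W] (hz : ∀ d, q Polynomial.X * d = d * q Polynomial.X)
  (del₂ : W →ₗ[D] BTensor S D V) (del₁ : BTensor S D V →ₗ[D] D) (f₂ : W →ₗ[D] D)
  (hdel₁ : ∀ d v, del₁ (tmul d v) = d * q (Polynomial.C (vec S V v)))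

include hι hdel₁ in
theorem theta_mul_vec (f : (TensorRing S V)[X]) (v : V) :
    theta q ι (f * Polynomial.C (vec S V v)) - (tmul (q f) v, 0) ∈
      coneBoundaries (q Polynomial.X) hz del₂ del₁ f₂ := by
  have h1 : f * Polynomial.C (vec S V v) =
      f.divX * Polynomial.C (vec S V v) * Polynomial.X +
        Polynomial.C (f.coeff 0 * vec S V v) := by
    conv_lhs => rw [← Polynomial.divX_mul_X_add f]
    rw [add_mul, mul_assoc, Polynomial.X_mul, ← mul_assoc, Polynomial.C_mul]
  have h2 : tmul (S := S) (q f) v = q Polynomial.X • tmul (q f.divX) v +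
      tmul (q (Polynomial.C (f.coeff 0))) v := by
    rw [smul_tmul, ← add_tmul, ← map_mul, ← map_add, Polynomial.X_mul, Polynomial.divX_mul_X_add]
  rw [h1, map_add, theta_mul_X, theta_C, delta_mul_vec, tensorMap_tmul, hι, h2]
  -- the difference is the image of `(0, [f.divX] ⊗ v)`
  refine ⟨0, tmul (q f.divX) v, ?_, ?_⟩
  · rw [map_zero]
    simp only [Prod.fst_sub, Prod.fst_add, zero_add]
    abel
  · rw [map_zero, hdel₁, ← map_mul]
    simp only [Prod.snd_sub, Prod.snd_add, add_zero, sub_zero]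

include hι hdel₁ in
theorem theta_mul_mulVec (f : (TensorRing S V)[X]) (y : BTensor S (TensorRing S V) V) :
    theta q ι (f * Polynomial.C (mulVec S V y)) - q f • (tensorMap ι y, 0) ∈
      coneBoundaries (q Polynomial.X) hz del₂ del₁ f₂ := by
  induction y using BTensor.induction with
  | h0 =>
    simp only [map_zero, mul_zero, Prod.mk_zero_zero, smul_zero, sub_zero]
    exact zero_mem _
  | ht t v =>
    have h1 := theta_mul_vec q ι hι hz del₂ del₁ f₂ hdel₁ (f * Polynomial.C t) v
    rw [mulVec_tmul, Polynomial.C_mul, ← mul_assoc, tensorMap_tmul, hι,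
      Prod.smul_mk, smul_zero, smul_tmul, ← map_mul]
    exact h1
  | hadd x y hx hy =>
    have h1 := add_mem hx hy
    rw [map_add, Polynomial.C_add, mul_add, map_add, map_add]
    have h2 : ((tensorMap ι x + tensorMap ι y, 0) : BTensor S D V × D) =
        (tensorMap ι x, 0) + (tensorMap ι y, 0) := by rw [Prod.mk_add_mk, add_zero]
    rw [h2, smul_add, add_sub_add_comm]
    exact h1

include hι hdel₁ in
/-- Modulo boundaries, `theta` is linear over `T[z]` on the polynomials without constant term. -/
theorem theta_mul (f : (TensorRing S V)[X]) {g : (TensorRing S V)[X]}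
    (hg : GradedRing.proj (grade S V) 0 (g.coeff 0) = 0) :
    theta q ι (f * g) - q f • theta q ι g ∈ coneBoundaries (q Polynomial.X) hz del₂ del₁ f₂ := by
  have h1 := theta_mul_mulVec q ι hι hz del₂ del₁ f₂ hdel₁ f (delta S V (g.coeff 0))
  rw [mulVec_delta_of_proj hg, ← theta_C q] at h1
  have h2 : theta q ι (f * (g.divX * Polynomial.X)) = q f • theta q ι (g.divX * Polynomial.X) := by
    rw [← mul_assoc, theta_mul_X, theta_mul_X, map_mul, Prod.smul_mk, smul_zero, smul_eq_mul]
  rw [← Polynomial.divX_mul_X_add g, mul_add, map_add, map_add, smul_add, h2,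
    add_sub_add_left_eq_sub]
  exact h1

variable {R P : Submodule S (TensorRing S V)} (α : FilteredMap (grade S V) R)
  (hbim : IsSubbimodule R) (hgr : IsGradedSub (grade S V) R)
  (hR0 : ∀ r : R, GradedRing.proj (grade S V) 0 (r : TensorRing S V) = 0)
  (hP : P = LinearMap.range α.toFun)
  (hq : ∀ f, q f = 0 ↔ ∀ n, dehom (grade S V) n f ∈ jacobiFilt (grade S V) P n)
  (ρ : R → W) (hρ₁ : ∀ r, del₂ (ρ r) = tensorMap ι (delta S V r))
  (hρ₂ : ∀ n (r : R), (r : TensorRing S V) ∈ grade S V (n + 1) →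
    f₂ (ρ r) = q (homAt (grade S V) n (α.toFun r - r)))

include hP hgr hq in
theorem map_homAt_eq_zero {n : ℕ} {r : R} (hr : (r : TensorRing S V) ∈ grade S V n) :
    q (homAt (grade S V) n (α.toFun r)) = 0 := by
  have h1 := α.apply_mem_filt hgr (mem_filt_of_mem _ le_rfl hr)
  rw [hq]
  intro m
  rw [dehom_homAt _ h1]
  split_ifs with h
  · rw [h]
    exact mem_jacobiFilt_of_mem _ (hP ▸ LinearMap.mem_range_self α.toFun r) h1
  · exact zero_mem _

include hρ₁ hρ₂ in
/-- `theta` sends the homogenization of `α(r)` to the boundary of `(1 ⊗ r, 0)`. -/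
theorem theta_homAt {n : ℕ} {r : R} (hr : (r : TensorRing S V) ∈ grade S V (n + 1)) :
    theta q ι (homAt (grade S V) (n + 1) (α.toFun r)) ∈
      coneBoundaries (q Polynomial.X) hz del₂ del₁ f₂ := by
  rw [α.homAt_apply hr, map_add, theta_mul_X, theta_C]
  refine ⟨ρ r, 0, ?_, ?_⟩
  · rw [hρ₁, smul_zero, sub_zero]
    exact (zero_add _).symm
  · rw [map_zero, hρ₂ n r hr, zero_add]
    exact (add_zero _).symm

include hι hdel₁ hbim hgr hP hq hρ₁ hρ₂ in
/-- Modulo boundaries, `theta (f v)` and `theta (f z)` depend only on the class of `f` in `D`. This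
disposes of the right-hand factors in `T` that are not scalars. -/
theorem theta_mul_homAt_mul {n : ℕ} {r : R} (hr : (r : TensorRing S V) ∈ grade S V (n + 1))
    (f g : (TensorRing S V)[X]) :
    theta q ι (f * homAt (grade S V) (n + 1) (α.toFun r) * g) ∈
      coneBoundaries (q Polynomial.X) hz del₂ del₁ f₂ := by
  have h0 : ∀ h : (TensorRing S V)[X],
      q (f * homAt (grade S V) (n + 1) (α.toFun r) * h) = 0 := by
    intro h
    rw [map_mul, map_mul, map_homAt_eq_zero q α hgr hP hq hr, mul_zero, zero_mul]
  induction g using Polynomial.induction_on' with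
  | add g g' hg hg' => rw [mul_add, map_add]; exact add_mem hg hg'
  | monomial k t =>
    cases k with
    | succ k =>
      rw [← Polynomial.monomial_mul_X, ← mul_assoc, theta_mul_X, h0]
      exact zero_mem _
    | zero =>
      rw [Polynomial.monomial_zero_left]
      induction t using TensorRing.induction with
      | hadd a b ha hb => rw [Polynomial.C_add, mul_add, map_add]; exact add_mem ha hb
      | hv t v _ =>
        have h1 := theta_mul_vec q ι hι hz del₂ del₁ f₂ hdel₁
          (f * homAt (grade S V) (n + 1) (α.toFun r) * Polynomial.C t) v
        rw [h0, zero_tmul, Prod.mk_zero_zero, sub_zero] at h1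
        rw [Polynomial.C_mul, ← mul_assoc]
        exact h1
      | hs s =>
        -- multiplication by a scalar on the right replaces `r` by `r s`
        let r' : R := ⟨r * (s • (1 : TensorRing S V)), hbim r r.2 s⟩
        have hr' : (r' : TensorRing S V) ∈ grade S V (n + 1) := by
          have h2 := mul_scalar_mem hr s
          rwa [scalar_eq_smul_one] at h2
        have h3 : homAt (grade S V) (n + 1) (α.toFun r) * Polynomial.C (scalar S V s) =
            homAt (grade S V) (n + 1) (α.toFun r') := by
          have h4 : Polynomial.C (scalar S V s) = homAt (grade S V) 0 (scalar S V s) := by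
            rw [homAt_of_mem (scalar_mem s), if_pos le_rfl, Nat.sub_self,
              Polynomial.monomial_zero_left]
          rw [h4, ← homAt_mul _ (α.apply_mem_filt hgr (mem_filt_of_mem _ le_rfl hr))
            (mem_filt_of_mem _ le_rfl (scalar_mem s)),
            α.map_right r r' s rfl, scalar_eq_smul_one, add_zero]
        have h5 : GradedRing.proj (grade S V) 0
            ((homAt (grade S V) (n + 1) (α.toFun r')).coeff 0) = 0 := by
          rw [α.homAt_apply hr', Polynomial.coeff_add, Polynomial.mul_coeff_zero,
            Polynomial.coeff_X_zero, mul_zero, zero_add, Polynomial.coeff_C_zero, proj_of_mem hr',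
            if_neg (Nat.succ_ne_zero n)]
        have h6 := add_mem (theta_mul q ι hι hz del₂ del₁ f₂ hdel₁ f h5)
          (Submodule.smul_mem _ (q f) (theta_homAt q ι hz del₂ del₁ f₂ α ρ hρ₁ hρ₂ hr'))
        rw [sub_add_cancel] at h6
        rw [mul_assoc, h3]
        exact h6

include hι hdel₁ hbim hgr hR0 hP hq hρ₁ hρ₂ in
/-- `theta` sends the kernel of `T[z] → D` to boundaries: the kernel is spanned by the products
`a p* b z^k`, and `P` is spanned by the `α(r)` with `r` homogeneous. -/
theorem theta_mem_coneBoundaries {f : (TensorRing S V)[X]} (hf : q f = 0) :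
    theta q ι f ∈ coneBoundaries (q Polynomial.X) hz del₂ del₁ f₂ := by
  -- the case of the homogenization of an element of `P`
  have hp : ∀ (j : ℕ) (p : TensorRing S V), p ∈ P → p ∈ filt (grade S V) j →
      ∀ a b : (TensorRing S V)[X], theta q ι (a * homAt (grade S V) j p * b) ∈
        coneBoundaries (q Polynomial.X) hz del₂ del₁ f₂ := by
    intro j p hp hpj a b
    obtain ⟨r, rfl⟩ : p ∈ LinearMap.range α.toFun := hP ▸ hp
    have hrj := α.mem_filt_of_apply_mem hgr hpj
    obtain ⟨N, hN⟩ := hgr.exists_eq_sum r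
    rw [hN, map_sum, map_sum, Finset.mul_sum, Finset.sum_mul, map_sum]
    refine sum_mem fun i _ => ?_
    by_cases hi : i ≤ j
    · cases i with
      | zero =>
        have h1 : (⟨GradedRing.proj (grade S V) 0 r, hgr r r.2 0⟩ : R) = 0 := Subtype.ext (hR0 r)
        rw [h1, map_zero, map_zero, mul_zero, zero_mul, map_zero]
        exact zero_mem _
      | succ i =>
        obtain ⟨k, rfl⟩ := Nat.exists_eq_add_of_le hi
        have h2 := proj_mem (grade S V) (i + 1) (r : TensorRing S V)
        rw [homAt_add _ (α.apply_mem_filt hgr (r := ⟨_, hgr r r.2 (i + 1)⟩)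
          (mem_filt_of_mem _ le_rfl h2)), ← mul_assoc]
        exact theta_mul_homAt_mul q ι hι hz del₂ del₁ f₂ hdel₁ α hbim hgr hP hq ρ hρ₁ hρ₂ h2 _ _
    · have h1 : (⟨GradedRing.proj (grade S V) i r, hgr r r.2 i⟩ : R) = 0 :=
        Subtype.ext ((mem_filt_iff (grade S V)).1 hrj i (by omega))
      rw [h1, map_zero, map_zero, mul_zero, zero_mul, map_zero]
      exact zero_mem _
  have hJ : ∀ n, ∀ t ∈ jacobiFilt (grade S V) P n, ∀ a : (TensorRing S V)[X],
      theta q ι (a * homAt (grade S V) n t) ∈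
        coneBoundaries (q Polynomial.X) hz del₂ del₁ f₂ := by
    intro n t ht
    refine Submodule.span_induction (p := fun t _ => ∀ a : (TensorRing S V)[X],
      theta q ι (a * homAt (grade S V) n t) ∈
        coneBoundaries (q Polynomial.X) hz del₂ del₁ f₂) ?_ ?_ ?_ ?_ ht
    · rintro _ ⟨i, j, k, b, p, c, rfl, hb, hpP, hpj, hc, rfl⟩ a
      rw [homAt_mul _ (filt_mul_mem _ hb hpj) hc, homAt_mul _ hb hpj, ← mul_assoc, ← mul_assoc]
      exact hp j p hpP hpj _ _
    · intro a
      rw [map_zero, mul_zero, map_zero]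
      exact zero_mem _
    · intro x y _ _ hx hy a
      rw [map_add, mul_add, map_add]
      exact add_mem (hx a) (hy a)
    · intro s x _ hx a
      have h1 : a * homAt (grade S V) n (s • x) =
          a * (s • (1 : (TensorRing S V)[X])) * homAt (grade S V) n x := by
        rw [homAt_smul, mul_assoc, smul_mul_assoc, one_mul]
      rw [h1]
      exact hx _
  obtain ⟨N, hN⟩ := exists_eq_sum_homAt (grade S V) f
  rw [hN N le_rfl, map_sum]
  refine sum_mem fun n _ => ?_
  have h1 := hJ n _ ((hq f).1 hf n) 1
  rwa [one_mul] at h1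

include hι hdel₁ hbim hgr hR0 hP hq hρ₁ hρ₂ in
/-- Exactness of `¹M_*` at `M₁` for the lifts built from `α`: a cycle `(y, x)` is, modulo boundaries,
the value of `theta` at an element of the kernel of `T[z] → D`. -/
theorem mem_coneBoundaries_of_cycle (hqs : Function.Surjective q) {y : BTensor S D V} {x : D}
    (h : del₁ y + q Polynomial.X * x = 0) :
    (y, x) ∈ coneBoundaries (q Polynomial.X) hz del₂ del₁ f₂ := by
  have hy : ∃ f : (TensorRing S V)[X], q f = del₁ y ∧
      theta q ι f - (y, 0) ∈ coneBoundaries (q Polynomial.X) hz del₂ del₁ f₂ := by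
    clear h
    induction y using BTensor.induction with
    | h0 => exact ⟨0, by simp only [map_zero], by
        rw [map_zero, Prod.mk_zero_zero, sub_zero]; exact zero_mem _⟩
    | ht d v =>
      obtain ⟨f, rfl⟩ := hqs d
      exact ⟨f * Polynomial.C (vec S V v), by rw [map_mul, hdel₁],
        theta_mul_vec q ι hι hz del₂ del₁ f₂ hdel₁ f v⟩
    | hadd y y' hy hy' =>
      obtain ⟨f, hf, hfy⟩ := hy
      obtain ⟨f', hf', hfy'⟩ := hy'
      refine ⟨f + f', by rw [map_add, map_add, hf, hf'], ?_⟩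
      have h2 : ((y + y', 0) : BTensor S D V × D) = (y, 0) + (y', 0) := by
        rw [Prod.mk_add_mk, add_zero]
      rw [map_add, h2, add_sub_add_comm]
      exact add_mem hfy hfy'
  obtain ⟨f, hf, hfy⟩ := hy
  obtain ⟨g, rfl⟩ := hqs x
  have h1 : q (f + g * Polynomial.X) = 0 := by
    rw [map_add, hf, map_mul, ← hz, h]
  have h2 := theta_mem_coneBoundaries q ι hι hz del₂ del₁ f₂ hdel₁ α hbim hgr hR0 hP hq ρ hρ₁ hρ₂ h1
  rw [map_add, theta_mul_X] at h2
  have h3 := sub_mem h2 hfy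
  have h4 : theta q ι f + (0, q g) - (theta q ι f - (y, 0)) = (y, q g) := by
    rw [add_sub_sub_cancel, Prod.mk_add_mk, add_zero, zero_add]
  rwa [h4] at h3

include hz hgr hP hq in
theorem map_C_eq (φ : R → D) (hφ : ∀ n (r : R), (r : TensorRing S V) ∈ grade S V (n + 1) →
    φ r = q (homAt (grade S V) n (α.toFun r - r))) {n : ℕ} {r : R}
    (hr : (r : TensorRing S V) ∈ grade S V (n + 1)) :
    q (Polynomial.C (r : TensorRing S V)) = -(q Polynomial.X * φ r) := by
  have h3 := map_homAt_eq_zero q α hgr hP hq hr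
  rw [α.homAt_apply hr, map_add, map_mul, ← hz, add_comm] at h3
  rw [hφ n r hr]
  exact eq_neg_of_add_eq_zero_left h3

end Explicit

/-! ### Lifts of the differentials for a bimodule of relations -/

section ExplicitLift

open TensorRing

variable {S : Type u} {A : Type v} [Ring S] [Ring A] [Module S A] [IsScalarTower S A A]
  {𝒜 : ℕ → Submodule S A} [GradedRing 𝒜] {R P : Submodule S (TA 𝒜)} {D : Type w} [Ring D]
  [Module S D] [IsScalarTower S D D]

variable (𝒜 P) in
/-- The homomorphism `T → D(P)`, `t ↦ [t]`. -/
def constHom : SRingHom S (TA 𝒜) (CentralExt (gradeTA 𝒜) P) where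
  toRingHom := (toQuot (homogSet (gradeTA 𝒜) P)).comp Polynomial.C
  map_smul' s t := by
    change toCentral (gradeTA 𝒜) P (Polynomial.C (s • t)) = s • toCentral _ P (Polynomial.C t)
    rw [← map_smul, Polynomial.smul_C]

/-- For `P = α(R)`, the obvious lifts of `d₁` and `d₂` to `D = D(P)`, together with
`f₂(1 ⊗ r) = ∑ [sᵢ] z^{n-1-i}` if `α(r) = r + ∑ sᵢ` with `r ∈ R^n` and `sᵢ ∈ T^i`, `i < n`, give a
complex `¹M_*` with `H₁ = 0`. -/
theorem exists_liftData_subsingleton_H₁ (hA : Module.Projective S (𝒜 1)) (hconn : IsConnected 𝒜)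
    (hstrong : IsStronglyGraded 𝒜) (hR : IsBimoduleOfRelations (gradeTA 𝒜) R (idealA 𝒜))
    (hproj : Module.Projective S R) (α : FilteredMap (gradeTA 𝒜) R)
    (hP : P = LinearMap.range α.toFun) (q : (TA 𝒜)[X] →+* D) (hqs : Function.Surjective q)
    (hq : ∀ f, q f = 0 ↔ ∀ n, dehom (gradeTA 𝒜) n f ∈ jacobiFilt (gradeTA 𝒜) P n)
    (ι : SRingHom S (TA 𝒜) D) (hι : ∀ t, ι.toRingHom t = q (Polynomial.C t))
    (hqS : ∀ (s : S) f, q (s • f) = s • q f) (𝒟 : ℕ → Submodule S D) [SetLike.GradedMonoid 𝒟]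
    (h𝒟 : ∀ n t, q (homAt (gradeTA 𝒜) n t) ∈ 𝒟 n) (π : SRingHom S D A)
    (hπ : ∀ f, π.toRingHom (q f) = piA 𝒜 (f.coeff 0)) :
    ∃ L : LiftData (relResolution hA hconn hstrong hR hproj) 𝒟 π (q Polynomial.X),
      Subsingleton L.H₁ := by
  have hgr := hR.2.1
  have hz : ∀ d, q Polynomial.X * d = d * q Polynomial.X := by
    intro d
    obtain ⟨f, rfl⟩ := hqs d
    rw [← map_mul, ← map_mul, Polynomial.X_mul]
  have hR0 : ∀ r : R, GradedRing.proj (gradeTA 𝒜) 0 (r : TA 𝒜) = 0 := fun r =>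
    proj_zero_of_mem_idealA hconn (hR.idealOf_eq ▸ TwoSidedIdeal.subset_span r.2)
  have hι𝒟 : ∀ n, ∀ t ∈ gradeTA 𝒜 n, ι.toRingHom t ∈ 𝒟 n := by
    intro n t ht
    have h1 := h𝒟 n t
    rwa [homAt_of_mem ht, if_pos le_rfl, Nat.sub_self, Polynomial.monomial_zero_left, ← hι] at h1
  have hsmul : ∀ {X : Type v} [AddCommGroup X] [Module S X] (𝒳 : ℕ → Submodule S X),
      ∀ i n b (m : BTensor S D X), b ∈ 𝒟 i → m ∈ tensorGrade 𝒟 𝒳 n →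
        b • m ∈ tensorGrade 𝒟 𝒳 (i + n) := fun 𝒳 i n b m hb hm => smul_mem_tensorGrade 𝒟 𝒳 hb hm
  have hmul : ∀ i n b m, b ∈ 𝒟 i → m ∈ (𝒟 n).toAddSubgroup → b • m ∈ (𝒟 (i + n)).toAddSubgroup :=
    fun i n b m hb hm => SetLike.GradedMul.mul_mem hb hm
  obtain ⟨φ, hφ⟩ := exists_linearMap_of_isInternal (isInternal_relGrade 𝒜 hgr) (fun n =>
    { toFun := fun r : R => q (homAt (gradeTA 𝒜) (n - 1) (α.toFun r - r))
      map_add' := fun r r' => by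
        rw [map_add, Submodule.coe_add, add_sub_add_comm, map_add, map_add]
      map_smul' := fun s r => by
        rw [map_smul, Submodule.coe_smul, ← smul_sub, homAt_smul, hqS, RingHom.id_apply] })
  have hφ' : ∀ n (r : R), (r : TA 𝒜) ∈ gradeTA 𝒜 (n + 1) →
      φ r = q (homAt (gradeTA 𝒜) n (α.toFun r - r)) := fun n r hr => hφ (n + 1) r hr
  let del₁ : BTensor S D (𝒜 1) →ₗ[D] D := tensorLift (ι.toLinear.comp (vecₗ S (𝒜 1)))
  let del₂ : BTensor S D R →ₗ[D] BTensor S D (𝒜 1) :=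
    tensorLift (((tensorMapₛ (𝒜 1) ι).comp (delta S (𝒜 1))).comp R.subtype)
  have hdel₁ : ∀ d v, del₁ (tmul d v) = d * q (Polynomial.C (vec S (𝒜 1) v)) := fun d v =>
    congrArg (d * ·) (hι _)
  have hdel₂ : ∀ d (r : R), del₂ (tmul d r) = d • tensorMap ι (delta S (𝒜 1) (r : TA 𝒜)) :=
    fun _ _ => rfl
  have hdel₁ι : ∀ y, del₁ (tensorMap ι y) = q (Polynomial.C (mulVec S (𝒜 1) y)) := by
    intro y
    induction y using BTensor.induction with
    | h0 => simp only [map_zero]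
    | ht t v => rw [tensorMap_tmul, hdel₁, hι, ← map_mul, ← map_mul, mulVec_tmul]
    | hadd x y hx hy => simp only [map_add, hx, hy]
  have hC : ∀ r : R, q (Polynomial.C (r : TA 𝒜)) = -(q Polynomial.X * φ r) := by
    intro r
    obtain ⟨N, hN⟩ := hgr.exists_eq_sum r
    have h1 : ∀ n, q (Polynomial.C (GradedRing.proj (gradeTA 𝒜) n (r : TA 𝒜))) =
        -(q Polynomial.X * φ ⟨GradedRing.proj (gradeTA 𝒜) n r, hgr r r.2 n⟩) := by
      intro n
      cases n with
      | zero =>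
        have h2 : (⟨GradedRing.proj (gradeTA 𝒜) 0 r, hgr r r.2 0⟩ : R) = 0 := Subtype.ext (hR0 r)
        rw [h2, hR0 r, map_zero, map_zero, map_zero, mul_zero, neg_zero]
      | succ n =>
        exact map_C_eq q hz α hgr hP hq φ hφ' (r := ⟨_, hgr r r.2 (n + 1)⟩) (proj_mem _ _ _)
    rw [hN, map_sum, Finset.mul_sum, ← Finset.sum_neg_distrib, AddSubmonoidClass.coe_finsetSum,
      map_sum, map_sum]
    exact Finset.sum_congr rfl fun n _ => h1 n
  have hlift₂ : ∀ x : BTensor S D R,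
      tensorMap π (del₂ x) = relDiff 𝒜 R (tensorMap π x) := by
    intro x
    induction x using BTensor.induction with
    | h0 => simp only [map_zero]
    | ht d r =>
      have h1 : ∀ y : BTensor S (TA 𝒜) (𝒜 1),
          tensorMap π (tensorMap ι y) = tensorMap (piAHom 𝒜) y := by
        intro y
        induction y using BTensor.induction with
        | h0 => simp only [map_zero]
        | ht t v =>
          rw [tensorMap_tmul, tensorMap_tmul, tensorMap_tmul, hι, hπ, Polynomial.coeff_C_zero]
          rfl
        | hadd x y hx hy => simp only [map_add, hx, hy]
      rw [hdel₂, tensorMap_smul, h1]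
      rfl
    | hadd x y hx hy => simp only [map_add, hx, hy]
  have hcomp : ∀ x : BTensor S D R, del₁ (del₂ x) = -(q Polynomial.X * tensorLift φ x) := by
    intro x
    induction x using BTensor.induction with
    | h0 => simp only [map_zero, mul_zero, neg_zero]
    | ht d r =>
      rw [hdel₂, map_smul, hdel₁ι, mulVec_delta_of_proj (hR0 r), hC, tensorLift_tmul, smul_neg,
        smul_eq_mul, smul_eq_mul, ← mul_assoc, ← mul_assoc, hz]
    | hadd x y hx hy => rw [map_add, map_add, map_add, hx, hy, mul_add, neg_add]
  let L : LiftData (relResolution hA hconn hstrong hR hproj) 𝒟 π (q Polynomial.X) :=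
    { del₁ := del₁
      del₂ := del₂
      f₂ := tensorLift φ
      del₁_graded := by
        intro n x hx
        refine map_mem_of_forall_tmul_one 𝒟 (gradeOne 𝒜) (f := del₁) (k := 0)
          (𝒩 := fun n => (𝒟 n).toAddSubgroup) hmul (fun j hj => by omega) ?_ hx
        intro j _ v hv
        rw [hdel₁, one_mul, ← hι]
        by_cases hj : j = 1
        · subst hj
          exact hι𝒟 _ _ (vec_mem v)
        · rw [gradeOne, if_neg hj, Submodule.mem_bot] at hv
          rw [hv, map_zero, map_zero]
          exact zero_mem _
      del₂_graded := by
        intro n x hx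
        refine map_mem_of_forall_tmul_one 𝒟 (relGrade 𝒜 R) (f := del₂) (k := 0)
          (𝒩 := tensorGrade 𝒟 (gradeOne 𝒜)) (hsmul _) (fun j hj => by omega) ?_ hx
        intro j _ r hr
        rw [hdel₂, one_smul]
        exact tensorMap_mem_tensorGrade ι hι𝒟 (delta_mem hr)
      f₂_graded := by
        intro n x hx
        refine map_mem_of_forall_tmul_one 𝒟 (relGrade 𝒜 R) (f := tensorLift φ) (k := 1)
          (𝒩 := fun n => (𝒟 n).toAddSubgroup) hmul ?_ ?_ hx
        · intro j hj
          obtain rfl : j = 0 := by omega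
          exact (relStage hconn hR.2.1 hR.idealOf_eq hproj).grade_zero
        · intro j hj r hr
          rw [tensorLift_tmul_one, hφ j r hr]
          exact h𝒟 _ _
      del₁_lift := by
        intro x
        induction x using BTensor.induction with
        | h0 => simp only [map_zero]
        | ht d v =>
          rw [hdel₁, map_mul, hπ, Polynomial.coeff_C_zero, piA_vec]
          rfl
        | hadd x y hx hy => simp only [map_add, hx, hy]
      del₂_lift := hlift₂
      del_comp := hcomp }
  refine ⟨L, L.subsingleton_H₁_iff.2 fun y x hyx => ?_⟩
  exact mem_coneBoundaries_of_cycle q ι hι hz del₂ del₁ (tensorLift φ) hdel₁ α hR.1 hgr hR0 hP hq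
    (fun r => tmul 1 r) (fun r => by rw [hdel₂, one_smul])
    (fun n r hr => by rw [tensorLift_tmul_one, hφ' n r hr]) hqs hyx

/-- For `P = α(R)` the conditions `⟨R⟩ = ⟨R_P⟩` and `H₁(¹M_*) = 0` hold automatically. -/
theorem isPBWDeformation_range_iff (hA : Module.Projective S (𝒜 1)) (hconn : IsConnected 𝒜)
    (hstrong : IsStronglyGraded 𝒜) (hR : IsBimoduleOfRelations (gradeTA 𝒜) R (idealA 𝒜))
    (hproj : Module.Projective S R) (α : FilteredMap (gradeTA 𝒜) R)
    (hP : P = LinearMap.range α.toFun) :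
    IsPBWDeformation (gradeTA 𝒜) P R ↔
      (homComplexity 𝒜 = -1 ∨ ∀ n : ℕ, 1 ≤ n → (n : EReal) ≤ homComplexity 𝒜 →
        Jacobi (gradeTA 𝒜) P n) := by
  have hlead : leading (gradeTA 𝒜) P = R := hP ▸ α.leading_range hR.2.1
  have hgen := hR.idealOf_eq
  have h : idealOf (R : Set (TA 𝒜)) = idealOf (leading (gradeTA 𝒜) P : Set (TA 𝒜)) := by
    rw [hlead]
  rw [isPBWDeformation_iff_jacobi (gradeTA 𝒜) P R hlead.ge]
  refine ⟨fun hJ => Or.inr fun n _ _ => hJ.2 n, fun hJ => ⟨h, ?_⟩⟩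
  obtain ⟨L, hL⟩ := exists_liftData_subsingleton_H₁ hA hconn hstrong hR hproj α hP
    (toQuot (homogSet (gradeTA 𝒜) P)) (toCentral_surjective (gradeTA 𝒜) P)
    (fun f => toCentral_eq_zero (gradeTA 𝒜) P) (constHom 𝒜 P) (fun _ => rfl)
    (map_smul (toCentral (gradeTA 𝒜) P)) (centralGrade (gradeTA 𝒜) P)
    (toCentral_homAt_mem (gradeTA 𝒜) P) (projection 𝒜 P R hgen h) (fun _ => rfl)
  exact jacobi_of_subsingleton_H₁ 𝒜 P hconn hstrong hgen h _
    (complexity₃_relResolution hA hconn hstrong hR hproj) L hL hJ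

end ExplicitLift

end PBW

end

open PBW in
theorem mainTheorem1 {S : Type u} {A : Type v} [Ring S] [Ring A] [Module S A]
    [IsScalarTower S A A] (𝒜 : ℕ → Submodule S A) [GradedRing 𝒜]
    (hconn : IsConnected 𝒜) (hstrong : IsStronglyGraded 𝒜)
    (hA : Module.Projective S (𝒜 1))
    (R : Submodule S (TA 𝒜)) (hbim : IsSubbimodule R) (hgraded : IsGradedSub (gradeTA 𝒜) R)
    (hgen : idealOf (R : Set (TA 𝒜)) = idealA 𝒜) (hR : Module.Projective S R) :
    -- arbitrary `P`: the criterion, for every resolution with `c_{V₃} = c(A)` and every choice of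
    -- the lifts that define the complex (such lifts exist)
    (∀ P : Submodule S (TA 𝒜), IsSubbimodule P → R ≤ leading (gradeTA 𝒜) P →
      ∀ F : Resolution.{u, v, w} 𝒜, F.complexity₃ = homComplexity 𝒜 →
        (∀ h : idealOf (R : Set (TA 𝒜)) = idealOf (leading (gradeTA 𝒜) P : Set (TA 𝒜)),
          Nonempty (LiftData F (centralGrade (gradeTA 𝒜) P) (projection 𝒜 P R hgen h)
            (centralElt (gradeTA 𝒜) P))) ∧
        ∀ L : (∀ h : idealOf (R : Set (TA 𝒜)) = idealOf (leading (gradeTA 𝒜) P : Set (TA 𝒜)),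
          LiftData F (centralGrade (gradeTA 𝒜) P) (projection 𝒜 P R hgen h)
            (centralElt (gradeTA 𝒜) P)),
          IsPBWDeformation (gradeTA 𝒜) P R ↔
            ∃ h : idealOf (R : Set (TA 𝒜)) = idealOf (leading (gradeTA 𝒜) P : Set (TA 𝒜)),
              Subsingleton (L h).H₁ ∧
              (homComplexity 𝒜 = -1 ∨ ∀ n : ℕ, 1 ≤ n → (n : EReal) ≤ homComplexity 𝒜 →
                Jacobi (gradeTA 𝒜) P n)) ∧
    -- such resolutions exist as soon as `A` has a left projective bimodule of relations
    ((∃ R₀ : Submodule S (TA 𝒜), IsBimoduleOfRelations (gradeTA 𝒜) R₀ (idealA 𝒜) ∧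
        Module.Projective S R₀) →
      ∃ F : Resolution.{u, v, max u v} 𝒜, F.complexity₃ = homComplexity 𝒜) ∧
    -- `P = α(R)` for a filtered map `α`
    (IsBimoduleOfRelations (gradeTA 𝒜) R (idealA 𝒜) →
      ∀ (α : FilteredMap (gradeTA 𝒜) R) (P : Submodule S (TA 𝒜)),
        P = LinearMap.range α.toFun →
        (IsPBWDeformation (gradeTA 𝒜) P R ↔
          (homComplexity 𝒜 = -1 ∨ ∀ n : ℕ, 1 ≤ n → (n : EReal) ≤ homComplexity 𝒜 →
            Jacobi (gradeTA 𝒜) P n))) := by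
  refine ⟨fun P _ hRP F hF => ⟨fun h =>
    (isCentralExtension_projection 𝒜 P R hconn hstrong hgen h).nonempty_liftData F,
    fun L => ⟨fun hPBW => ?_, ?_⟩⟩, ?_, ?_⟩
  · obtain ⟨h, hJ⟩ := (isPBWDeformation_iff_jacobi (gradeTA 𝒜) P R hRP).1 hPBW
    exact ⟨h, (L h).subsingleton_H₁_of_regular
      (isCentralExtension_projection 𝒜 P R hconn hstrong hgen h)
      (regular_of_jacobi (gradeTA 𝒜) P hJ), Or.inr fun n _ _ => hJ n⟩
  · rintro ⟨h, hH, hJ⟩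
    exact (isPBWDeformation_iff_jacobi (gradeTA 𝒜) P R hRP).2
      ⟨h, jacobi_of_subsingleton_H₁ 𝒜 P hconn hstrong hgen h F hF (L h) hH hJ⟩
  · rintro ⟨R₀, hR₀, hproj⟩
    exact ⟨relResolution hA hconn hstrong hR₀ hproj,
      complexity₃_relResolution hA hconn hstrong hR₀ hproj⟩
  · intro hRel α P hP
    exact isPBWDeformation_range_iff hA hconn hstrong hRel hR α hP
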